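/- Let $W$ be a Coxeter group with finite set $S$ of simple generators and length function $\ell$, and let $\le$ be the (right) weak order on $W$, the reflexive and transitive closure of the relations $w < wr$ for $w\in W$, $r\in S$ with $\ell(w)<\ell(wr)$; write $\vee$ for the join in this order, when it exists. Let $c=s_1s_2\cdots s_n$ be a Coxeter element of $W$, i.e. a product of all the elements of $S$, each taken exactly once, in some order. For a reduced word $s_1\cdots s_n$ for $c$, the $(s_1\cdots s_n)$-sorting word for $v\in W$ is the lexicographically first (as a sequence of positions) subword of the half-infinite word $s_1\cdots s_n|s_1\cdots s_n|s_1\cdots s_n|\cdots$ that is a reduced word for $v$; the element $v$ is $c$-sortable if, for some reduced word for $c$, the sets of letters of its sorting word that lie between consecutive dividers form a weakly decreasing sequence of subsets of $S$. For $x\in W$, let $x_{\langle s\rangle}$ be the element of the subgroup $W_{\langle s\rangle}$ generated by $S\setminus\{s\}$ such that $x=x_{\langle s\rangle}\cdot y$, where $y$ is the element of minimal length in the coset $W_{\langle s\rangle}x$. Let $s\in S$ be initial in $c$, i.e. some reduced word for $c$ starts with $s$. Then the map $$v\mapsto\begin{cases} sv & \text{if } v\ge s,\\ s\vee v & \text{if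 } v\not\ge s\end{cases}$$ is a bijection from the set of all $c$-sortable elements $v$ such that $s\vee v$ exists to the set of all $scs$-sortable elements. The inverse map is $$x\mapsto\begin{cases} sx & \text{if } x\not\ge s,\\ x_{\langle s\rangle} & \text{if } x\ge s.\end{cases}$$ -/

import Mathlib

namespace CoxeterSystem

variable {B : Type*} {M : CoxeterMatrix B} {W : Type*} [Group W] (cs : CoxeterSystem M W)

/-! ### Weak order -/

/-- The (right) weak order on `W`: the reflexive transitive closure of the relations `x < x s` for
`s` a simple reflection with `ℓ(x) < ℓ(x s)`. -/
def WeakLE : W → W → Prop :=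
  Relation.ReflTransGen fun x y =>
    ∃ i : B, y = x * cs.simple i ∧ cs.length x < cs.length (x * cs.simple i)

/-- `z` is the join (least upper bound) of `x` and `y` in the weak order. -/
def IsWeakJoin (x y z : W) : Prop :=
  cs.WeakLE x z ∧ cs.WeakLE y z ∧ ∀ u : W, cs.WeakLE x u → cs.WeakLE y u → cs.WeakLE z u

/-- The join `x ∨ y` exists in the weak order. -/
def HasWeakJoin (x y : W) : Prop :=
  ∃ z : W, cs.IsWeakJoin x y z

open Classical in
/-- The join `x ∨ y` in the weak order, with the irrelevant value `1` if it does not exist. -/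
noncomputable def weakJoin (x y : W) : W :=
  if h : cs.HasWeakJoin x y then h.choose else 1

theorem WeakLE.eq_or_length_lt {x y : W} (h : cs.WeakLE x y) :
    x = y ∨ cs.length x < cs.length y := by
  induction h with
  | refl => exact Or.inl rfl
  | tail _ hbc ih =>
    obtain ⟨i, rfl, hi⟩ := hbc
    rcases ih with rfl | ih
    · exact Or.inr hi
    · exact Or.inr (ih.trans hi)

theorem WeakLE.antisymm {x y : W} (hxy : cs.WeakLE x y) (hyx : cs.WeakLE y x) : x = y := by
  rcases hxy.eq_or_length_lt with h | h
  · exact h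
  · rcases hyx.eq_or_length_lt with h' | h'
    · exact h'.symm
    · omega

/-- Joins in the weak order are unique, so `weakJoin` is the join whenever a join exists. -/
theorem IsWeakJoin.weakJoin_eq {x y z : W} (h : cs.IsWeakJoin x y z) : cs.weakJoin x y = z := by
  have hex : cs.HasWeakJoin x y := ⟨z, h⟩
  have hw : cs.weakJoin x y = hex.choose := by rw [weakJoin, dif_pos hex]
  rw [hw]
  have hc := hex.choose_spec
  exact WeakLE.antisymm cs (hc.2.2 z h.1 h.2.1) (h.2.2 _ hc.1 hc.2.1)

/-! ### Standard parabolic subgroups and the projection `w ↦ w_J` -/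

/-- The standard parabolic subgroup `W_J` generated by the simple reflections in `J`. -/
def standardParabolic (J : Set B) : Subgroup W :=
  Subgroup.closure (cs.simple '' J)

/-- The element of minimal length in the coset `W_J w`. -/
noncomputable def minCosetRep (J : Set B) (w : W) : W :=
  Function.argminOn cs.length {u : W | ∃ p ∈ cs.standardParabolic J, u = p * w}
    ⟨w, 1, one_mem _, (one_mul w).symm⟩

/-- The element `w_J` of `W_J`, defined by the factorization of `w` as `w_J` times the element of
minimal length in `W_J w`. -/
noncomputable def parabolicProj (J : Set B) (w : W) : W :=
  w * (cs.minCosetRep J w)⁻¹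

/-! ### Coxeter elements -/

/-- `c` is a Coxeter element: the product of all the simple reflections, each taken exactly once,
in some order. -/
def IsCoxeterElement (c : W) : Prop :=
  ∃ ω : List B, ω.Nodup ∧ (∀ i : B, i ∈ ω) ∧ cs.wordProd ω = c

/-- `ω` is a reduced word for `w`. -/
def IsReducedWordFor (ω : List B) (w : W) : Prop :=
  cs.IsReduced ω ∧ cs.wordProd ω = w

/-- The simple generator `i` is initial in `c`: some reduced word for `c` starts with `i`. -/
def IsInitial (i : B) (c : W) : Prop :=
  ∃ ω : List B, cs.IsReducedWordFor (i :: ω) c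

/-! ### Sorting words and sortable elements -/

/-- The positions in the half-infinite word `ω^∞ = ω | ω | ω | ⋯`: the position `(k, j)` is the
`j`-th letter of the `k`-th copy of `ω`. The order of the positions is lexicographic. -/
abbrev Position (ω : List B) : Type :=
  ℕ ×ₗ Fin ω.length

/-- The word formed by the letters of `ω^∞` at the given positions. -/
def letters (ω : List B) (p : List (Position ω)) : List B :=
  p.map fun a => ω.get (ofLex a).2

/-- The increasing sequence of positions `p` is a subword of `ω^∞` which is a reduced word
for `w`. -/
def IsReducedSubword (ω : List B) (w : W) (p : List (Position ω)) : Prop :=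
  p.Pairwise (· < ·) ∧ cs.IsReducedWordFor (letters ω p) w

/-- `p` is the sequence of positions of the `ω`-sorting word for `w`: the lexicographically first
(as a sequence of positions in `ω^∞`) subword of `ω^∞` which is a reduced word for `w`. -/
def IsSortingSubword (ω : List B) (w : W) (p : List (Position ω)) : Prop :=
  cs.IsReducedSubword ω w p ∧ ∀ q : List (Position ω), cs.IsReducedSubword ω w q → p ≤ q

/-- The set of letters of the subword `p` which lie in the `k`-th copy of `ω` in `ω^∞`. -/
def blockLetters (ω : List B) (p : List (Position ω)) (k : ℕ) : Set B :=
  {i | ∃ j : Fin ω.length, toLex (k, j) ∈ p ∧ ω.get j = i}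

/-- `v` is `c`-sortable: a `c`-sorting word for `v` (an `ω`-sorting word for `v`, for a reduced
word `ω` for `c`) defines a sequence of subsets which is weakly decreasing under inclusion. -/
def IsSortable (c v : W) : Prop :=
  ∃ (ω : List B) (p : List (Position ω)), cs.IsReducedWordFor ω c ∧ cs.IsSortingSubword ω v p ∧
    Antitone (blockLetters ω p)

/-! ### The two maps -/

open Classical in
/-- The map `v ↦ s v` if `v ≥ s` and `v ↦ s ∨ v` if `v ≱ s`. -/
noncomputable def sortableMap (i : B) (v : W) : W :=
  if cs.WeakLE (cs.simple i) v then cs.simple i * v else cs.weakJoin (cs.simple i) v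

open Classical in
/-- The map `x ↦ s x` if `x ≱ s` and `x ↦ x_⟨s⟩` if `x ≥ s`, where `⟨s⟩` is the set of all simple
generators other than `s`. -/
noncomputable def sortableInvMap (i : B) (x : W) : W :=
  if cs.WeakLE (cs.simple i) x then cs.parabolicProj {i}ᶜ x else cs.simple i * x

end CoxeterSystem

/-! In the geometric representation every root is positive or negative
(`geomRep_simpleRoot_nonneg`). Hence an element is determined by its inversion set, and the weak
order is inclusion of inversion sets (`weakLE_iff`). The inversions of x_⟨s⟩ are those of x with
zero s-coordinate (`mem_inversions_parabolicProj`), and two elements with a common upper bound have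
a join (`exists_isWeakJoin`).

Sortability is a recursion on a word `l` without repetitions (`WordSortable`): if the first letter i
is not below v, delete it from the word; if it is, replace v by s_i v and move i to the end. The
greedy construction of the sorting word shows that this is the blockwise definition
(`exists_isSortingSubword_iff_wordSortable`), and the choice of the reduced word for c does not
matter (`WordSortable.of_wordProd_eq`).

Write c = s·l. For v ≥ s the theorem is the recursion itself. An element v not above s is sortable
for s·l exactly when it is sortable for l, and then it lies in W_⟨s⟩. So it remains to see that v ↦
s ∨ v and x ↦ x_⟨s⟩ are inverse to each other between the l-sortable v for which s ∨ v exists and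
the (l·s)-sortable x ≥ s. This takes four facts: x_⟨s⟩ is l-sortable (`WordSortable.parabolicProj`);
s ∨ v has no inversions in W_⟨s⟩ other than those of v (`mem_inversions_of_isWeakJoin_simple`); s ∨
v is sortable (`WordSortable.join_final`); and x = s ∨ x_⟨s⟩
(`WordSortable.isWeakJoin_parabolicProj`).

The main tool is the Euler form of a word. Its symmetrization is the Cartan form, and moving the
first letter s to the end amounts to applying s to both arguments (`eulerForm_rotate`). Sortable
elements are those with a reduced word in which every earlier inversion β and later inversion γ have
skew form at least 0, with equality only if they are orthogonal (`Aligned`). This criterion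
restricts to parabolic subgroups and sees the word only through the form. The last fact also uses
that distinct cover reflections of a sortable element are orthogonal for the Euler form in one of
the two orders (`WordSortable.coversOrthogonal`). -/

open Polynomial.Chebyshev

/-! ### Cartan matrix, simple reflections and Chebyshev values -/

namespace CoxeterMatrix

variable {B : Type*} (M : CoxeterMatrix B)

/-- The entry `-2 cos (π / M i j)` of the Cartan matrix; it is `-2` if `M i j = 0`, that is, if
`s_i s_j` has infinite order. -/
noncomputable def cartanEntry (i j : B) : ℝ :=
  -(2 * Real.cos (Real.pi / M i j))

/-- The symmetric bilinear form of the geometric representation, normalized so that all simple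
roots have square length `2`. -/
noncomputable def cartanForm : (B →₀ ℝ) →ₗ[ℝ] (B →₀ ℝ) →ₗ[ℝ] ℝ :=
  Finsupp.linearCombination ℝ fun i => Finsupp.linearCombination ℝ fun j => M.cartanEntry i j

/-- The simple roots, the standard basis of the space of the geometric representation. -/
noncomputable def simpleRoot (_M : CoxeterMatrix B) (i : B) : B →₀ ℝ :=
  Finsupp.single i 1

theorem cartanEntry_comm (i j : B) : M.cartanEntry i j = M.cartanEntry j i := by
  rw [cartanEntry, cartanEntry, M.symmetric]

theorem cartanEntry_self (i : B) : M.cartanEntry i i = 2 := by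
  simp [cartanEntry]

theorem cartanEntry_nonpos {i j : B} (h : i ≠ j) : M.cartanEntry i j ≤ 0 := by
  have h1 := M.off_diagonal i j h
  rw [cartanEntry, neg_nonpos]
  refine mul_nonneg zero_le_two (Real.cos_nonneg_of_neg_pi_div_two_le_of_le ?_ ?_)
  · have : 0 ≤ Real.pi / (M i j : ℝ) := by positivity
    linarith [Real.pi_pos]
  · rcases Nat.eq_zero_or_pos (M i j) with h0 | h0
    · rw [h0]; simp; positivity
    · have h2 : (2 : ℝ) ≤ M i j := by
        have : 2 ≤ M i j := by
          have : M i j ≠ 1 := h1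
          omega
        exact_mod_cast this
      exact div_le_div_of_nonneg_left Real.pi_pos.le (by norm_num) h2

@[simp]
theorem cartanForm_simpleRoot (i j : B) :
    M.cartanForm (M.simpleRoot i) (M.simpleRoot j) = M.cartanEntry i j := by
  simp [cartanForm, simpleRoot]

theorem cartanForm_comm (x y : B →₀ ℝ) : M.cartanForm x y = M.cartanForm y x := by
  have : M.cartanForm = M.cartanForm.flip := by
    ext i j
    simpa [simpleRoot] using
      (M.cartanForm_simpleRoot i j).trans
        ((M.cartanEntry_comm i j).trans (M.cartanForm_simpleRoot j i).symm)
  conv_lhs => rw [this]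
  rfl

theorem cartanForm_simpleRoot_self (i : B) :
    M.cartanForm (M.simpleRoot i) (M.simpleRoot i) = 2 := by
  rw [cartanForm_simpleRoot, cartanEntry_self]

/-- The simple reflections of the geometric representation. -/
noncomputable def simpleReflection (i : B) : (B →₀ ℝ) ≃ₗ[ℝ] (B →₀ ℝ) :=
  Module.reflection (M.cartanForm_simpleRoot_self i)

theorem simpleReflection_apply (i : B) (x : B →₀ ℝ) :
    M.simpleReflection i x = x - M.cartanForm (M.simpleRoot i) x • M.simpleRoot i := by
  rw [simpleReflection, Module.reflection_apply]

/-- In rank two the product of the reflections is a rotation by 2θ with θ = π/m. The coefficients of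
its m-th power are Chebyshev values at 2 cos 2θ, which vanish because S_n(2 cos φ) sin φ =
sin((n+1)φ). -/
theorem isLiftable_simpleReflection : M.IsLiftable M.simpleReflection := by
  intro i j
  by_cases hij : i = j
  · subst hij
    have : M.simpleReflection i * M.simpleReflection i = 1 := by
      ext1 x
      exact Module.involutive_reflection (M.cartanForm_simpleRoot_self i) x
    rw [this, one_pow]
  set m := M i j with hm
  have hm1 : m ≠ 1 := M.off_diagonal i j hij
  rcases Nat.eq_zero_or_pos m with h0 | h0
  · rw [h0, pow_zero]
  apply LinearEquiv.toLinearMap_injective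
  set θ : ℝ := Real.pi / m with hθ
  have hc : M.cartanEntry i j = -(2 * Real.cos θ) := rfl
  have key := Module.reflection_mul_reflection_pow (M.cartanForm_simpleRoot_self i)
    (M.cartanForm_simpleRoot_self j) m (2 * Real.cos (2 * θ)) (by
      rw [cartanForm_simpleRoot, cartanForm_simpleRoot, M.cartanEntry_comm j i, hc,
        Real.cos_two_mul]
      ring)
  refine Eq.trans key ?_
  have hS := S_two_mul_real_cos (2 * θ)
  have hmθ : (m : ℝ) * θ = Real.pi := by
    rw [hθ]; field_simp
  -- For m = 2 the factor sin 2θ is zero and cannot be cancelled; there the roots are orthogonal and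
  -- the claim is checked directly.
  rcases Nat.lt_or_ge m 3 with h3 | h3
  · have h2 : m = 2 := by omega
    have hθ2 : θ = Real.pi / 2 := by rw [hθ, h2]; norm_num
    have h1 : M.cartanEntry i j = 0 := by rw [hc, hθ2]; simp
    rw [h2, cartanForm_simpleRoot, cartanForm_simpleRoot, M.cartanEntry_comm j i, h1, hθ2]
    have hcos : Real.cos (2 * (Real.pi / 2)) = -1 := by
      rw [mul_div_cancel₀ _ two_ne_zero, Real.cos_pi]
    rw [hcos]
    norm_num
    ext1 x
    ext1
    simp
    module
  · have hsin : Real.sin (2 * θ) ≠ 0 := by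
      apply ne_of_gt
      apply Real.sin_pos_of_pos_of_lt_pi
      · rw [hθ]; positivity
      · rw [← hmθ]
        have : (3 : ℝ) ≤ m := by exact_mod_cast h3
        have hθ0 : 0 < θ := by rw [hθ]; positivity
        nlinarith
    -- The indices in the power formula are integer quotients by 2. For m = 2n the factor S_{n-1}
    -- vanishes; for m = 2n+1 it is S_n + S_{n-1}, as sin(π+θ) + sin(π-θ) = 0.
    rcases Nat.even_or_odd' m with ⟨n, hn | hn⟩
    · have e1 : ((m : ℤ) - 2) / 2 = n - 1 := by omega
      have e2 : ((m : ℤ) - 1) / 2 = n - 1 := by omega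
      have hz : (S ℝ ((n : ℤ) - 1)).eval (2 * Real.cos (2 * θ)) = 0 := by
        have := hS (n - 1)
        have e3 : (((n : ℤ) - 1 : ℤ) + 1 : ℝ) * (2 * θ) = Real.pi := by
          rw [← hmθ, hn]; push_cast; ring
        rw [e3, Real.sin_pi] at this
        exact (mul_eq_zero.1 this).resolve_right hsin
      rw [e1, e2, hz]
      simp only [zero_mul, zero_smul, add_zero]
      rfl
    · have e1 : ((m : ℤ) - 2) / 2 = n - 1 := by omega
      have e2 : ((m : ℤ) - 1) / 2 = n := by omega
      have e3 : ((m : ℤ) - 3) / 2 = n - 1 := by omega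
      have e4 : (m : ℤ) / 2 = n := by omega
      have hz : (S ℝ (n : ℤ)).eval (2 * Real.cos (2 * θ)) +
          (S ℝ ((n : ℤ) - 1)).eval (2 * Real.cos (2 * θ)) = 0 := by
        have h1 := hS n
        have h2 := hS (n - 1)
        have e5 : (((n : ℤ) : ℝ) + 1) * (2 * θ) = Real.pi + θ := by
          rw [← hmθ, hn]; push_cast; ring
        have e6 : (((n : ℤ) - 1 : ℤ) + 1 : ℝ) * (2 * θ) = Real.pi - θ := by
          rw [← hmθ, hn]; push_cast; ring
        rw [e5, add_comm, Real.sin_add_pi] at h1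
        rw [e6, Real.sin_pi_sub] at h2
        have : ((S ℝ (n : ℤ)).eval (2 * Real.cos (2 * θ)) +
          (S ℝ ((n : ℤ) - 1)).eval (2 * Real.cos (2 * θ))) * Real.sin (2 * θ) = 0 := by
          rw [add_mul, h1, h2]; ring
        exact (mul_eq_zero.1 this).resolve_right hsin
      rw [e1, e2, e3, e4, hz]
      simp only [mul_zero, zero_smul, add_zero]
      rfl

/-- For `p ≤ m` the value `sin (p π / m) / sin (π / m)` of a Chebyshev polynomial is nonnegative. -/
theorem eval_chebyshev_nonneg {i j : B} (hij : i ≠ j) (p : ℕ) (hp : M i j = 0 ∨ p ≤ M i j) :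
    0 ≤ (S ℝ ((p : ℤ) - 1)).eval (-M.cartanEntry i j) := by
  have hc : -M.cartanEntry i j = 2 * Real.cos (Real.pi / M i j) := by rw [cartanEntry, neg_neg]
  rw [hc]
  rcases Nat.eq_zero_or_pos (M i j) with h0 | h0
  · rw [h0]
    have : ∀ n : ℕ, (S ℝ ((n : ℤ) - 1)).eval 2 = n ∧ (S ℝ (n : ℤ)).eval 2 = n + 1 := by
      intro n
      induction n with
      | zero => simp
      | succ n ih =>
        have h := S_add_two ℝ ((n : ℤ) - 1)
        have e1 : (n : ℤ) - 1 + 2 = ((n + 1 : ℕ) : ℤ) := by push_cast; ring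
        have e2 : (n : ℤ) - 1 + 1 = n := by ring
        rw [e1, e2] at h
        refine ⟨by simp [ih.2], ?_⟩
        rw [h]
        simp only [Polynomial.eval_sub, Polynomial.eval_mul, Polynomial.eval_X, ih.1, ih.2]
        push_cast; ring
    have h1 := (this p).1
    simp only [Nat.cast_zero, div_zero, Real.cos_zero, mul_one]
    rw [h1]
    positivity
  · have hp' : p ≤ M i j := by omega
    have h2 : 2 ≤ M i j := by
      have := M.off_diagonal i j hij
      have : M i j ≠ 1 := this
      omega
    have h2' : (2 : ℝ) ≤ M i j := by exact_mod_cast h2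
    have hS := S_two_mul_real_cos (Real.pi / M i j) (p - 1)
    have hpos : 0 < Real.sin (Real.pi / M i j) := by
      apply Real.sin_pos_of_pos_of_lt_pi
      · positivity
      · rw [div_lt_iff₀ (by positivity)]
        nlinarith [Real.pi_pos]
    have h3 : 0 ≤ Real.sin ((((p : ℤ) - 1 : ℤ) + 1 : ℝ) * (Real.pi / M i j)) := by
      apply Real.sin_nonneg_of_nonneg_of_le_pi
      · push_cast
        rw [sub_add_cancel]
        positivity
      · push_cast
        rw [sub_add_cancel, mul_div_assoc', div_le_iff₀ (by positivity), mul_comm]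
        have : (p : ℝ) ≤ M i j := by exact_mod_cast hp'
        exact mul_le_mul_of_nonneg_left this Real.pi_pos.le
    rw [← hS] at h3
    exact nonneg_of_mul_nonneg_left h3 hpos

end CoxeterMatrix

/-! ### The geometric representation and positivity of roots -/

namespace CoxeterSystem

variable {B : Type*} {M : CoxeterMatrix B} {W : Type*} [Group W] (cs : CoxeterSystem M W)

/-- The geometric representation. -/
noncomputable def geomRep : W →* ((B →₀ ℝ) ≃ₗ[ℝ] (B →₀ ℝ)) :=
  cs.lift ⟨M.simpleReflection, M.isLiftable_simpleReflection⟩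

theorem geomRep_simple (i : B) (x : B →₀ ℝ) :
    cs.geomRep (cs.simple i) x = x - M.cartanForm (M.simpleRoot i) x • M.simpleRoot i := by
  rw [geomRep, cs.lift_apply_simple, M.simpleReflection_apply]

theorem geomRep_mul (u w : W) (x : B →₀ ℝ) :
    cs.geomRep (u * w) x = cs.geomRep u (cs.geomRep w x) := by
  rw [map_mul, LinearEquiv.mul_apply]

@[simp]
theorem geomRep_inv_self (w : W) (x : B →₀ ℝ) : cs.geomRep w⁻¹ (cs.geomRep w x) = x := by
  rw [← geomRep_mul, inv_mul_cancel, map_one, LinearEquiv.coe_one, id]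

@[simp]
theorem geomRep_self_inv (w : W) (x : B →₀ ℝ) : cs.geomRep w (cs.geomRep w⁻¹ x) = x := by
  rw [← geomRep_mul, mul_inv_cancel, map_one, LinearEquiv.coe_one, id]

theorem geomRep_simple_simple (i : B) (x : B →₀ ℝ) :
    cs.geomRep (cs.simple i) (cs.geomRep (cs.simple i) x) = x := by
  rw [← geomRep_mul, cs.simple_mul_simple_self, map_one, LinearEquiv.coe_one, id]

theorem geomRep_simple_simpleRoot (i j : B) :
    cs.geomRep (cs.simple i) (M.simpleRoot j) =
      M.simpleRoot j - M.cartanEntry i j • M.simpleRoot i := by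
  rw [geomRep_simple, M.cartanForm_simpleRoot]

theorem geomRep_simple_self (i : B) :
    cs.geomRep (cs.simple i) (M.simpleRoot i) = -M.simpleRoot i := by
  rw [geomRep_simple_simpleRoot, M.cartanEntry_self]
  module

theorem simpleRoot_nonneg (M : CoxeterMatrix B) (i : B) : 0 ≤ M.simpleRoot i := by
  simp [CoxeterMatrix.simpleRoot]

theorem cartanForm_geomRep (w : W) (x y : B →₀ ℝ) :
    M.cartanForm (cs.geomRep w x) (cs.geomRep w y) = M.cartanForm x y := by
  induction w using cs.simple_induction_left generalizing x y with
  | one => simp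
  | mul_simple_left w i ih =>
    rw [geomRep_mul, geomRep_mul, geomRep_simple, geomRep_simple]
    simp only [map_sub, map_smul, LinearMap.sub_apply, LinearMap.smul_apply, smul_eq_mul,
      M.cartanForm_simpleRoot_self]
    rw [M.cartanForm_comm _ (M.simpleRoot i), ih]
    ring

/-- Each new letter on the left changes one of the two coordinates, and the change is the three-term
recurrence of the Chebyshev polynomials S. -/
theorem geomRep_alternatingWord {i j : B} (p : ℕ) :
    cs.geomRep (cs.wordProd (alternatingWord i j p)) (M.simpleRoot i) =
      if Even p then
        (S ℝ (p : ℤ)).eval (-M.cartanEntry i j) • M.simpleRoot i +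
          (S ℝ ((p : ℤ) - 1)).eval (-M.cartanEntry i j) • M.simpleRoot j
      else
        (S ℝ ((p : ℤ) - 1)).eval (-M.cartanEntry i j) • M.simpleRoot i +
          (S ℝ (p : ℤ)).eval (-M.cartanEntry i j) • M.simpleRoot j := by
  induction p with
  | zero => simp [alternatingWord]
  | succ p ih =>
    rw [alternatingWord_succ', wordProd_cons, geomRep_mul, ih]
    have h := S_add_two ℝ ((p : ℤ) - 1)
    have e1 : (p : ℤ) - 1 + 2 = ((p + 1 : ℕ) : ℤ) := by push_cast; ring
    have e2 : (p : ℤ) - 1 + 1 = p := by ring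
    rw [e1, e2] at h
    have e3 : ((p + 1 : ℕ) : ℤ) - 1 = p := by push_cast; ring
    rw [h, e3]
    simp only [Polynomial.eval_sub, Polynomial.eval_mul, Polynomial.eval_X]
    by_cases hp : Even p
    · have hp' : ¬ Even (p + 1) := by simpa [parity_simps] using hp
      simp only [hp, hp', if_true, if_false, map_add, map_smul, geomRep_simple_self,
        geomRep_simple_simpleRoot, M.cartanEntry_comm j i]
      module
    · have hp' : Even (p + 1) := by simpa [parity_simps] using hp
      simp only [hp, hp', if_true, if_false, map_add, map_smul, geomRep_simple_self,
        geomRep_simple_simpleRoot]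
      module

/-- The fundamental positivity property of the geometric representation. -/
theorem geomRep_simpleRoot_nonneg {w : W} {i : B} (h : cs.length w < cs.length (w * cs.simple i)) :
    0 ≤ cs.geomRep w (M.simpleRoot i) := by
  induction hn : cs.length w using Nat.strong_induction_on generalizing w i with
  | _ n ih =>
  subst hn
  by_cases hw : w = 1
  · subst hw
    simpa using simpleRoot_nonneg M i
  obtain ⟨j, hj⟩ := cs.exists_rightDescent_of_ne_one hw
  have hij : i ≠ j := by
    rintro rfl
    exact absurd hj (not_lt.2 h.le)
  -- `w = v * alternatingWord i j p` with `p` maximal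
  let Q : ℕ → Prop := fun p => ∃ v, w = v * cs.wordProd (alternatingWord i j p) ∧
    cs.length w = cs.length v + p
  have hQ1 : Q 1 := by
    refine ⟨w * cs.simple j, by simp [alternatingWord], ?_⟩
    rw [cs.isRightDescent_iff] at hj
    exact hj.symm
  have hQb : ∀ p, Q p → p ≤ cs.length w := by
    rintro p ⟨v, -, hv⟩
    omega
  classical
  obtain ⟨p, hp1, ⟨v, hwv, hlv⟩, hmax⟩ : ∃ p, 1 ≤ p ∧ Q p ∧ ¬ Q (p + 1) := by
    refine ⟨Nat.findGreatest Q (cs.length w), ?_, ?_, ?_⟩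
    · exact Nat.le_findGreatest (hQb 1 hQ1) hQ1
    · exact Nat.findGreatest_spec (hQb 1 hQ1) hQ1
    · intro hq
      have := Nat.le_findGreatest (hQb _ hq) hq
      omega
  have hup : ∀ u : W, ∀ k : B, cs.length (u * cs.simple k) < cs.length u →
      cs.length (u * cs.simple k) + 1 = cs.length u := by
    intro u k hk
    rcases cs.length_mul_simple u k with h' | h' <;> omega
  -- neither `i` nor `j` is a right descent of `v`
  have hfirst : ∀ k, k = (if Even p then j else i) → ¬ cs.length (v * cs.simple k) < cs.length v := by
    rintro k rfl hk
    apply hmax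
    refine ⟨v * cs.simple (if Even p then j else i), ?_, ?_⟩
    · rw [alternatingWord_succ', wordProd_cons, ← mul_assoc,
        cs.simple_mul_simple_cancel_right, hwv]
    · have := hup _ _ hk
      omega
  -- Here k is the first letter of the alternating word. If it were a descent of v, the two copies
  -- would cancel and `w` would have length at most ℓ(v) + p - 2.
  have hsecond : ∀ k, k = (if Even p then i else j) →
      ¬ cs.length (v * cs.simple k) < cs.length v := by
    rintro k rfl hk
    obtain ⟨q, rfl⟩ : ∃ q, p = q + 1 := ⟨p - 1, by omega⟩
    have e : (if Even (q + 1) then i else j) = (if Even q then j else i) := by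
      by_cases hq : Even q <;> simp [hq, parity_simps]
    have h1 : w = (v * cs.simple (if Even (q + 1) then i else j)) *
        cs.wordProd (alternatingWord i j q) := by
      rw [hwv, alternatingWord_succ', wordProd_cons, e, mul_assoc]
    have h2 := cs.length_mul_le (v * cs.simple (if Even (q + 1) then i else j))
      (cs.wordProd (alternatingWord i j q))
    rw [← h1] at h2
    have h3 := cs.length_wordProd_le (alternatingWord i j q)
    rw [length_alternatingWord] at h3
    omega
  have hvi : ∀ k, k = i ∨ k = j → cs.length v < cs.length (v * cs.simple k) := by
    intro k hk
    have hnd : ¬ cs.length (v * cs.simple k) < cs.length v := by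
      by_cases hpe : Even p
      · rcases hk with rfl | rfl
        · exact hsecond _ (by simp [hpe])
        · exact hfirst _ (by simp [hpe])
      · rcases hk with rfl | rfl
        · exact hfirst _ (by simp [hpe])
        · exact hsecond _ (by simp [hpe])
    rcases cs.length_mul_simple v k with h' | h' <;> omega
  have hlt : cs.length v < cs.length w := by omega
  have hpi := ih _ hlt (hvi i (Or.inl rfl)) rfl
  have hpj := ih _ hlt (hvi j (Or.inr rfl)) rfl
  -- Otherwise a braid move on the last M i j letters gives a word for `w` ending in i, so that i
  -- would be a right descent of `w`, against `h`.
  have hpm : M i j = 0 ∨ p + 1 ≤ M i j := by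
    by_contra hcon
    push Not at hcon
    obtain ⟨h0, h1⟩ := hcon
    have hge : M i j ≤ p := by omega
    have hb : cs.wordProd (alternatingWord i j (M i j)) =
        cs.wordProd (alternatingWord j i (M i j)) := by
      have := cs.wordProd_braidWord_eq i j
      rwa [braidWord, braidWord, M.symmetric j i] at this
    -- split off the last `M i j` letters
    have hsplit : ∀ q r : ℕ, ∃ ω : List B, ω.length = q ∧
        alternatingWord i j (q + r) = ω ++ alternatingWord i j r := by
      intro q
      induction q with
      | zero => intro r; exact ⟨[], rfl, by simp⟩
      | succ q ihq =>
        intro r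
        obtain ⟨ω, h1, h2⟩ := ihq r
        rw [Nat.add_right_comm, alternatingWord_succ', h2]
        exact ⟨_ :: ω, by simp [h1], rfl⟩
    obtain ⟨ω, hω1, hω2⟩ := hsplit (p - M i j) (M i j)
    rw [Nat.sub_add_cancel hge] at hω2
    obtain ⟨m, hm⟩ : ∃ m, M i j = m + 1 := ⟨M i j - 1, by omega⟩
    have hw' : w * cs.simple i = v * cs.wordProd ω * cs.wordProd (alternatingWord i j m) := by
      rw [hwv, hω2, wordProd_append, hb, hm, alternatingWord_succ, wordProd_concat]
      simp only [mul_assoc, cs.simple_mul_simple_self, mul_one]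
    have l1 := cs.length_mul_le (v * cs.wordProd ω) (cs.wordProd (alternatingWord i j m))
    have l2 := cs.length_mul_le v (cs.wordProd ω)
    have l3 := cs.length_wordProd_le ω
    have l4 := cs.length_wordProd_le (alternatingWord i j m)
    rw [length_alternatingWord] at l4
    rw [← hw'] at l1
    omega
  have c1 : 0 ≤ (S ℝ ((p : ℤ) - 1)).eval (-M.cartanEntry i j) :=
    M.eval_chebyshev_nonneg hij p (by omega)
  have c2 : 0 ≤ (S ℝ (p : ℤ)).eval (-M.cartanEntry i j) := by
    have := M.eval_chebyshev_nonneg hij (p + 1) hpm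
    rwa [Nat.cast_succ, add_sub_cancel_right] at this
  rw [hwv, geomRep_mul, geomRep_alternatingWord]
  split_ifs
  · rw [map_add, map_smul, map_smul]
    exact add_nonneg (smul_nonneg c2 hpi) (smul_nonneg c1 hpj)
  · rw [map_add, map_smul, map_smul]
    exact add_nonneg (smul_nonneg c1 hpi) (smul_nonneg c2 hpj)

end CoxeterSystem

namespace CoxeterSystem

variable {B : Type*} {M : CoxeterMatrix B} {W : Type*} [Group W] (cs : CoxeterSystem M W)

/-! ### Roots -/

theorem sum_smul_simpleRoot (M : CoxeterMatrix B) (β : B →₀ ℝ) :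
    (β.sum fun i c => c • M.simpleRoot i) = β := by
  simp [CoxeterMatrix.simpleRoot, Finsupp.smul_single]

theorem simpleRoot_apply_self (M : CoxeterMatrix B) (i : B) : M.simpleRoot i i = 1 := by
  simp [CoxeterMatrix.simpleRoot]

theorem simpleRoot_apply_ne (M : CoxeterMatrix B) {i j : B} (h : i ≠ j) :
    M.simpleRoot i j = 0 := by
  simp [CoxeterMatrix.simpleRoot, h]

theorem simpleRoot_injective (M : CoxeterMatrix B) : Function.Injective M.simpleRoot := by
  intro i j h
  by_contra hij
  have := DFunLike.congr_fun h i
  rw [simpleRoot_apply_self, simpleRoot_apply_ne M (Ne.symm hij)] at this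
  exact one_ne_zero this

theorem map_nonneg_of_support {N : Type*} [AddCommGroup N] [PartialOrder N] [IsOrderedAddMonoid N]
    [Module ℝ N] [PosSMulMono ℝ N] (f : (B →₀ ℝ) →ₗ[ℝ] N) {β : B →₀ ℝ} (hβ : 0 ≤ β)
    (h : ∀ i, β i ≠ 0 → 0 ≤ f (M.simpleRoot i)) : 0 ≤ f β := by
  rw [← sum_smul_simpleRoot M β, Finsupp.sum, map_sum]
  refine Finset.sum_nonneg fun i hi => ?_
  rw [map_smul]
  exact smul_nonneg (hβ i) (h i (Finsupp.mem_support_iff.1 hi))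

/-- The roots of a Coxeter system: the images of the simple roots under the group. -/
def IsRoot (β : B →₀ ℝ) : Prop :=
  ∃ w i, cs.geomRep w (M.simpleRoot i) = β

theorem isRoot_simpleRoot (i : B) : cs.IsRoot (M.simpleRoot i) :=
  ⟨1, i, by simp⟩

variable {cs}

theorem IsRoot.geomRep {β : B →₀ ℝ} (h : cs.IsRoot β) (w : W) : cs.IsRoot (cs.geomRep w β) := by
  obtain ⟨u, i, rfl⟩ := h
  exact ⟨w * u, i, cs.geomRep_mul _ _ _⟩

theorem IsRoot.neg {β : B →₀ ℝ} (h : cs.IsRoot β) : cs.IsRoot (-β) := by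
  obtain ⟨u, i, rfl⟩ := h
  exact ⟨u * cs.simple i, i, by rw [cs.geomRep_mul, cs.geomRep_simple_self, map_neg]⟩

theorem IsRoot.cartanForm_self {β : B →₀ ℝ} (h : cs.IsRoot β) : M.cartanForm β β = 2 := by
  obtain ⟨u, i, rfl⟩ := h
  rw [cs.cartanForm_geomRep, M.cartanForm_simpleRoot_self]

theorem IsRoot.ne_zero {β : B →₀ ℝ} (h : cs.IsRoot β) : β ≠ 0 := by
  rintro rfl
  simpa using h.cartanForm_self

theorem IsRoot.not_nonpos {β : B →₀ ℝ} (h : cs.IsRoot β) (hβ : 0 ≤ β) : ¬ β ≤ 0 :=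
  fun h' => h.ne_zero (le_antisymm h' hβ)

variable (cs)

theorem geomRep_simpleRoot_nonpos {w : W} {i : B}
    (h : cs.length (w * cs.simple i) < cs.length w) : cs.geomRep w (M.simpleRoot i) ≤ 0 := by
  have h1 : 0 ≤ cs.geomRep (w * cs.simple i) (M.simpleRoot i) :=
    cs.geomRep_simpleRoot_nonneg (by rwa [cs.simple_mul_simple_cancel_right])
  rw [geomRep_mul, geomRep_simple_self, map_neg] at h1
  exact neg_nonneg.1 h1

theorem geomRep_simpleRoot_nonneg_iff {w : W} {i : B} :
    0 ≤ cs.geomRep w (M.simpleRoot i) ↔ cs.length w < cs.length (w * cs.simple i) := by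
  refine ⟨fun h => ?_, cs.geomRep_simpleRoot_nonneg⟩
  rcases lt_or_gt_of_ne (cs.length_mul_simple_ne w i) with h' | h'
  · exact absurd (cs.geomRep_simpleRoot_nonpos h')
      (((cs.isRoot_simpleRoot i).geomRep w).not_nonpos h)
  · exact h'

theorem geomRep_simpleRoot_nonpos_iff {w : W} {i : B} :
    cs.geomRep w (M.simpleRoot i) ≤ 0 ↔ cs.length (w * cs.simple i) < cs.length w := by
  refine ⟨fun h => ?_, cs.geomRep_simpleRoot_nonpos⟩
  rcases lt_or_gt_of_ne (cs.length_mul_simple_ne w i) with h' | h'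
  · exact h'
  · exact absurd h (((cs.isRoot_simpleRoot i).geomRep w).not_nonpos (cs.geomRep_simpleRoot_nonneg h'))

variable {cs}

theorem IsRoot.nonneg_or_nonpos {β : B →₀ ℝ} (h : cs.IsRoot β) : 0 ≤ β ∨ β ≤ 0 := by
  obtain ⟨w, i, rfl⟩ := h
  rcases lt_or_gt_of_ne (cs.length_mul_simple_ne w i) with h' | h'
  · exact Or.inr (cs.geomRep_simpleRoot_nonpos h')
  · exact Or.inl (cs.geomRep_simpleRoot_nonneg h')

theorem IsRoot.nonneg_of_apply_pos {β : B →₀ ℝ} (h : cs.IsRoot β) {i : B} (hi : 0 < β i) :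
    0 ≤ β := by
  rcases h.nonneg_or_nonpos with h' | h'
  · exact h'
  · exact absurd (h' i) (not_le.2 hi)

theorem IsRoot.eq_simpleRoot {β : B →₀ ℝ} (h : cs.IsRoot β) (hβ : 0 ≤ β) {i : B}
    (hi : ∀ j, j ≠ i → β j = 0) : β = M.simpleRoot i := by
  have h1 : β = β i • M.simpleRoot i := by
    ext j
    by_cases hj : j = i
    · subst hj; simp [simpleRoot_apply_self]
    · simp [hi j hj, simpleRoot_apply_ne M (Ne.symm hj)]
  have h2 := h.cartanForm_self
  rw [h1, map_smul, map_smul, LinearMap.smul_apply, M.cartanForm_simpleRoot_self] at h2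
  simp only [smul_eq_mul] at h2
  have h3 : 0 ≤ β i := hβ i
  have h4 : β i = 1 := by nlinarith
  rw [h1, h4, one_smul]

/-- A positive root other than α_i has a positive coordinate at some j ≠ i. The reflection s_i
leaves it unchanged, and one positive coordinate makes a root positive. -/
theorem IsRoot.geomRep_simple_nonneg {β : B →₀ ℝ} (h : cs.IsRoot β) (hβ : 0 ≤ β) {i : B}
    (hi : β ≠ M.simpleRoot i) : 0 ≤ cs.geomRep (cs.simple i) β := by
  have h1 : ∃ j, j ≠ i ∧ β j ≠ 0 := by
    by_contra hcon
    push Not at hcon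
    exact hi (h.eq_simpleRoot hβ hcon)
  obtain ⟨j, hj, hj0⟩ := h1
  refine (h.geomRep _).nonneg_of_apply_pos (i := j) ?_
  rw [cs.geomRep_simple]
  have h2 : 0 < β j := lt_of_le_of_ne (hβ j) (Ne.symm hj0)
  simpa [simpleRoot_apply_ne M (Ne.symm hj)] using h2

theorem IsRoot.nonpos_of_not_nonneg {β : B →₀ ℝ} (h : cs.IsRoot β) (hβ : ¬ 0 ≤ β) : β ≤ 0 :=
  h.nonneg_or_nonpos.resolve_left hβ

variable (cs)

/-! ### Inversion sets -/

/-- The set of positive roots made negative by `w⁻¹`. -/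
def inversions (w : W) : Set (B →₀ ℝ) :=
  {β | cs.IsRoot β ∧ 0 ≤ β ∧ cs.geomRep w⁻¹ β ≤ 0}

variable {cs}

theorem geomRep_inv_nonneg {w : W} {β : B →₀ ℝ} (h : cs.IsRoot β) (hβ : 0 ≤ β)
    (hw : β ∉ cs.inversions w) : 0 ≤ cs.geomRep w⁻¹ β :=
  (h.geomRep _).nonneg_or_nonpos.resolve_right fun h' => hw ⟨h, hβ, h'⟩

theorem not_mem_inversions {w : W} {β : B →₀ ℝ} (hw : 0 ≤ cs.geomRep w⁻¹ β) :
    β ∉ cs.inversions w :=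
  fun h => (h.1.geomRep _).not_nonpos hw h.2.2

variable (cs)

theorem inversions_one : cs.inversions 1 = ∅ := by
  ext β
  simp only [Set.mem_empty_iff_false, iff_false]
  rintro ⟨h, h0, h1⟩
  exact h.not_nonpos h0 (by simpa using h1)

theorem simpleRoot_mem_inversions {w : W} {i : B} :
    M.simpleRoot i ∈ cs.inversions w ↔ cs.length (cs.simple i * w) < cs.length w := by
  have h1 : cs.geomRep w⁻¹ (M.simpleRoot i) ≤ 0 ↔ _ := cs.geomRep_simpleRoot_nonpos_iff
  rw [← cs.inv_simple, ← mul_inv_rev, cs.length_inv, cs.length_inv] at h1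
  rw [inversions, Set.mem_ofPred_eq, h1]
  exact ⟨fun h => h.2.2, fun h => ⟨cs.isRoot_simpleRoot i, simpleRoot_nonneg M i, h⟩⟩

theorem geomRep_simpleRoot_not_mem_inversions (x : W) (i : B) :
    cs.geomRep x (M.simpleRoot i) ∉ cs.inversions x :=
  not_mem_inversions (by simpa using simpleRoot_nonneg M i)

/-- Since s_i permutes the positive roots other than α_i, passing from x to x s_i changes the sign
behaviour only at the root x α_i (up to sign). -/
theorem mem_inversions_mul_simple {x : W} {i : B} (h : cs.length x < cs.length (x * cs.simple i))
    {β : B →₀ ℝ} : β ∈ cs.inversions (x * cs.simple i) ↔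
      β = cs.geomRep x (M.simpleRoot i) ∨ β ∈ cs.inversions x := by
  have e : cs.geomRep (x * cs.simple i)⁻¹ β = cs.geomRep (cs.simple i) (cs.geomRep x⁻¹ β) := by
    rw [mul_inv_rev, cs.inv_simple, geomRep_mul]
  constructor
  · rintro ⟨h1, h2, h3⟩
    rw [e] at h3
    by_cases hβ : β ∈ cs.inversions x
    · exact Or.inr hβ
    · left
      have h4 := geomRep_inv_nonneg h1 h2 hβ
      by_contra hne
      have h5 : cs.geomRep x⁻¹ β ≠ M.simpleRoot i := by
        rintro h6
        exact hne (by rw [← h6, geomRep_self_inv])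
      exact ((h1.geomRep _).geomRep _).not_nonpos ((h1.geomRep _).geomRep_simple_nonneg h4 h5) h3
  · rintro (rfl | hβ)
    · refine ⟨(cs.isRoot_simpleRoot i).geomRep x, cs.geomRep_simpleRoot_nonneg h, ?_⟩
      rw [e, geomRep_inv_self, geomRep_simple_self]
      exact neg_nonpos.2 (simpleRoot_nonneg M i)
    · obtain ⟨h1, h2, h3⟩ := hβ
      refine ⟨h1, h2, ?_⟩
      rw [e]
      have h4 : 0 ≤ cs.geomRep x⁻¹ (-β) := by rw [map_neg]; exact neg_nonneg.2 h3
      have h5 : cs.geomRep x⁻¹ (-β) ≠ M.simpleRoot i := by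
        intro h6
        have h7 : -β = cs.geomRep x (M.simpleRoot i) := by rw [← h6, geomRep_self_inv]
        have h8 := cs.geomRep_simpleRoot_nonneg h
        rw [← h7] at h8
        exact h1.not_nonpos h2 (neg_nonneg.1 h8)
      have h6 := (h1.neg.geomRep x⁻¹).geomRep_simple_nonneg h4 h5
      rw [map_neg, map_neg] at h6
      exact neg_nonneg.1 h6

theorem mem_inversions_simple_mul {x : W} {i : B} {β : B →₀ ℝ} (hβ : β ≠ M.simpleRoot i) :
    β ∈ cs.inversions (cs.simple i * x) ↔
      cs.geomRep (cs.simple i) β ∈ cs.inversions x ∧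
        cs.geomRep (cs.simple i) β ≠ M.simpleRoot i := by
  have e : cs.geomRep (cs.simple i * x)⁻¹ β = cs.geomRep x⁻¹ (cs.geomRep (cs.simple i) β) := by
    rw [mul_inv_rev, cs.inv_simple, geomRep_mul]
  constructor
  · rintro ⟨h1, h2, h3⟩
    refine ⟨⟨h1.geomRep _, h1.geomRep_simple_nonneg h2 hβ, by rwa [e] at h3⟩, fun h4 => ?_⟩
    have h5 : β = -M.simpleRoot i := by
      rw [← geomRep_simple_self cs, ← h4, geomRep_simple_simple]
    rw [h5] at h2 h1
    exact h1.not_nonpos h2 (neg_nonpos.2 (simpleRoot_nonneg M i))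
  · rintro ⟨⟨h1, h2, h3⟩, h4⟩
    have h5 := h1.geomRep_simple_nonneg h2 h4
    rw [geomRep_simple_simple] at h5
    have h6 := h1.geomRep (cs.simple i)
    rw [geomRep_simple_simple] at h6
    exact ⟨h6, h5, by rwa [e]⟩

theorem simpleRoot_mem_inversions_simple_mul {x : W} {i : B} :
    M.simpleRoot i ∈ cs.inversions (cs.simple i * x) ↔ M.simpleRoot i ∉ cs.inversions x := by
  rw [simpleRoot_mem_inversions, simpleRoot_mem_inversions, cs.simple_mul_simple_cancel_left]
  have := cs.length_simple_mul_ne x i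
  omega

/-! ### The weak order and inversion sets -/

variable {cs}

theorem WeakLE.inversions_subset {x z : W} (h : cs.WeakLE x z) :
    cs.inversions x ⊆ cs.inversions z := by
  induction h with
  | refl => exact subset_rfl
  | tail _ hbc ih =>
    obtain ⟨i, rfl, hi⟩ := hbc
    exact ih.trans fun β hβ => (cs.mem_inversions_mul_simple hi).2 (Or.inr hβ)

/-- No element of the interval has i as a left descent, so left multiplication by s_i raises all
lengths by one and keeps each step of the chain ascending. -/
theorem WeakLE.simple_mul {x z : W} {i : B} (h : cs.WeakLE x z)
    (hi : M.simpleRoot i ∉ cs.inversions z) :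
    cs.WeakLE (cs.simple i * x) (cs.simple i * z) := by
  induction h with
  | refl => exact Relation.ReflTransGen.refl
  | @tail y z hy hbc ih =>
    have hyz : cs.WeakLE y z := Relation.ReflTransGen.single hbc
    obtain ⟨j, rfl, hj⟩ := hbc
    have hi' : M.simpleRoot i ∉ cs.inversions y := fun h => hi (hyz.inversions_subset h)
    refine (ih hi').tail ⟨j, mul_assoc _ _ _ |>.symm, ?_⟩
    rw [cs.simpleRoot_mem_inversions] at hi hi'
    rw [mul_assoc]
    have h1 := cs.length_simple_mul y i
    have h2 := cs.length_simple_mul (y * cs.simple j) i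
    omega

variable (cs)

theorem exists_simpleRoot_mem_inversions {w : W} (hw : w ≠ 1) :
    ∃ i, M.simpleRoot i ∈ cs.inversions w := by
  obtain ⟨i, hi⟩ := cs.exists_leftDescent_of_ne_one hw
  exact ⟨i, cs.simpleRoot_mem_inversions.2 hi⟩

theorem weakLE_one (z : W) : cs.WeakLE 1 z := by
  induction hn : cs.length z using Nat.strong_induction_on generalizing z with
  | _ n ih =>
  subst hn
  by_cases hz : z = 1
  · rw [hz]; exact Relation.ReflTransGen.refl
  obtain ⟨i, hi⟩ := cs.exists_rightDescent_of_ne_one hz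
  refine (ih _ hi _ rfl).tail ⟨i, (cs.simple_mul_simple_cancel_right i).symm, ?_⟩
  rw [cs.simple_mul_simple_cancel_right]
  exact hi

/-- For the converse, a left descent i of x is also one of z. Removing it from both keeps the
inclusion, since inversion sets are reflected by s_i apart from α_i, and induction on the length
applies. -/
theorem weakLE_iff {x z : W} : cs.WeakLE x z ↔ cs.inversions x ⊆ cs.inversions z := by
  refine ⟨fun h => h.inversions_subset, fun h => ?_⟩
  induction hn : cs.length x using Nat.strong_induction_on generalizing x z with
  | _ n ih =>
  subst hn
  by_cases hx : x = 1
  · rw [hx]; exact cs.weakLE_one z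
  obtain ⟨i, hi⟩ := cs.exists_simpleRoot_mem_inversions hx
  have h1 := ih _ (cs.simpleRoot_mem_inversions.1 hi) (x := cs.simple i * x)
    (z := cs.simple i * z) ?_ rfl
  · have h2 := h1.simple_mul (i := i) (by
      rw [cs.simpleRoot_mem_inversions_simple_mul, not_not]; exact h hi)
    rwa [cs.simple_mul_simple_cancel_left, cs.simple_mul_simple_cancel_left] at h2
  · intro β hβ
    have hne : β ≠ M.simpleRoot i := by
      rintro rfl
      exact cs.simpleRoot_mem_inversions_simple_mul.1 hβ hi
    rw [cs.mem_inversions_simple_mul hne] at hβ ⊢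
    exact ⟨h hβ.1, hβ.2⟩

theorem inversions_injective : Function.Injective cs.inversions := fun _ _ h =>
  WeakLE.antisymm cs ((cs.weakLE_iff).2 h.le) ((cs.weakLE_iff).2 h.ge)

theorem length_le_of_inversions_subset {x z : W} (h : cs.inversions x ⊆ cs.inversions z) :
    cs.length x ≤ cs.length z := by
  rcases WeakLE.eq_or_length_lt cs ((cs.weakLE_iff).2 h) with rfl | h
  · exact le_rfl
  · exact h.le

theorem inversions_simple (i : B) : cs.inversions (cs.simple i) = {M.simpleRoot i} := by
  ext β
  have := cs.mem_inversions_mul_simple (x := 1) (i := i) (β := β) (by simp)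
  simpa [inversions_one] using this

theorem simple_weakLE_iff {i : B} {x : W} :
    cs.WeakLE (cs.simple i) x ↔ M.simpleRoot i ∈ cs.inversions x := by
  rw [weakLE_iff, inversions_simple, Set.singleton_subset_iff]

theorem geomRep_injective {x y : W} (h : ∀ v, cs.geomRep x v = cs.geomRep y v) : x = y := by
  apply cs.inversions_injective
  have h' : ∀ v, cs.geomRep x⁻¹ v = cs.geomRep y⁻¹ v := fun v => by
    apply (cs.geomRep x).injective
    rw [geomRep_self_inv, h, geomRep_self_inv]
  ext β
  simp only [inversions, Set.mem_ofPred_eq, h']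

/-- If an element strictly below `z` in the weak order is given, there is a coatom of the interval
above it. -/
theorem exists_cover_of_weakLE {y z : W} (h : cs.WeakLE y z) (hne : y ≠ z) :
    ∃ x i, z = x * cs.simple i ∧ cs.length x < cs.length z ∧ cs.WeakLE y x := by
  rcases Relation.ReflTransGen.cases_tail h with h | ⟨x, hx, i, rfl, hi⟩
  · exact absurd h.symm hne
  · exact ⟨x, i, rfl, hi, hx⟩

end CoxeterSystem

namespace CoxeterSystem

variable {B : Type*} {M : CoxeterMatrix B} {W : Type*} [Group W] (cs : CoxeterSystem M W)

/-! ### Parabolic projections -/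

theorem apply_simpleRoot_eq_zero_of_support (f : (B →₀ ℝ) →ₗ[ℝ] ℝ) {β : B →₀ ℝ} (hβ : 0 ≤ β)
    (h : ∀ i, β i ≠ 0 → 0 ≤ f (M.simpleRoot i)) (h0 : f β = 0) {i : B} (hi : β i ≠ 0) :
    f (M.simpleRoot i) = 0 := by
  rw [← sum_smul_simpleRoot M β, Finsupp.sum, map_sum, Finset.sum_eq_zero_iff_of_nonneg] at h0
  · have := h0 i (Finsupp.mem_support_iff.2 hi)
    rw [map_smul, smul_eq_mul] at this
    exact (mul_eq_zero.1 this).resolve_left hi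
  · intro j hj
    rw [map_smul]
    exact smul_nonneg (hβ j) (h j (Finsupp.mem_support_iff.1 hj))

theorem geomRep_apply_of_mem_standardParabolic {J : Set B} {p : W}
    (hp : p ∈ cs.standardParabolic J) (x : B →₀ ℝ) {i : B} (hi : i ∉ J) :
    cs.geomRep p x i = x i := by
  induction hp using Subgroup.closure_induction generalizing x with
  | mem y hy =>
    obtain ⟨j, hj, rfl⟩ := hy
    have hij : j ≠ i := fun h => hi (h ▸ hj)
    rw [geomRep_simple]
    simp [simpleRoot_apply_ne M hij]
  | one => simp
  | mul u v _ _ hu hv => rw [geomRep_mul, hu, hv]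
  | inv u _ hu => rw [← hu, geomRep_self_inv]

theorem exists_minCosetRep_eq (J : Set B) (w : W) :
    ∃ p ∈ cs.standardParabolic J, cs.minCosetRep J w = p * w :=
  Function.argminOn_mem cs.length {u : W | ∃ p ∈ cs.standardParabolic J, u = p * w}
    ⟨w, 1, one_mem _, (one_mul w).symm⟩

theorem length_minCosetRep_le (J : Set B) (w : W) {p : W} (hp : p ∈ cs.standardParabolic J) :
    cs.length (cs.minCosetRep J w) ≤ cs.length (p * w) :=
  Function.argminOn_le cs.length {u : W | ∃ p ∈ cs.standardParabolic J, u = p * w} ⟨p, hp, rfl⟩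

theorem parabolicProj_mem (J : Set B) (w : W) :
    cs.parabolicProj J w ∈ cs.standardParabolic J := by
  obtain ⟨p, hp, h⟩ := cs.exists_minCosetRep_eq J w
  rw [parabolicProj, h]
  simpa using hp

theorem parabolicProj_mul_minCosetRep (J : Set B) (w : W) :
    cs.parabolicProj J w * cs.minCosetRep J w = w := by
  simp [parabolicProj]

theorem geomRep_minCosetRep_inv_nonneg {J : Set B} (w : W) {i : B} (hi : i ∈ J) :
    0 ≤ cs.geomRep (cs.minCosetRep J w)⁻¹ (M.simpleRoot i) := by
  refine geomRep_inv_nonneg (cs.isRoot_simpleRoot i) (simpleRoot_nonneg M i) fun h => ?_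
  rw [simpleRoot_mem_inversions] at h
  obtain ⟨p, hp, h'⟩ := cs.exists_minCosetRep_eq J w
  have := cs.length_minCosetRep_le J w (p := cs.simple i * p)
    (mul_mem (Subgroup.subset_closure ⟨i, hi, rfl⟩) hp)
  rw [mul_assoc, ← h'] at this
  omega

theorem geomRep_minCosetRep_inv_nonneg_of_supported {J : Set B} (w : W) {β : B →₀ ℝ} (hβ : 0 ≤ β)
    (hJ : ∀ i ∉ J, β i = 0) : 0 ≤ cs.geomRep (cs.minCosetRep J w)⁻¹ β :=
  map_nonneg_of_support (M := M) (cs.geomRep (cs.minCosetRep J w)⁻¹).toLinearMap hβ fun i hi =>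
    cs.geomRep_minCosetRep_inv_nonneg w (by by_contra h; exact hi (hJ i h))

/-- Write w = p y with y minimal in its coset. The factor p⁻¹ preserves all coordinates outside J,
so an inversion of p is supported on J; y⁻¹ preserves the sign of roots supported on J, so on these
p and w have the same inversions. -/
theorem mem_inversions_parabolicProj {J : Set B} {w : W} {β : B →₀ ℝ} :
    β ∈ cs.inversions (cs.parabolicProj J w) ↔ β ∈ cs.inversions w ∧ ∀ i ∉ J, β i = 0 := by
  have hp := cs.parabolicProj_mem J w
  have hw : cs.geomRep w⁻¹ β = cs.geomRep (cs.minCosetRep J w)⁻¹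
      (cs.geomRep (cs.parabolicProj J w)⁻¹ β) := by
    rw [← geomRep_mul, ← mul_inv_rev, parabolicProj_mul_minCosetRep]
  have hoff : ∀ i ∉ J, cs.geomRep (cs.parabolicProj J w)⁻¹ β i = β i := fun i hi =>
    cs.geomRep_apply_of_mem_standardParabolic (inv_mem hp) β hi
  constructor
  · rintro ⟨h1, h2, h3⟩
    have hJ : ∀ i ∉ J, β i = 0 := fun i hi =>
      le_antisymm ((hoff i hi).symm.trans_le (h3 i)) (h2 i)
    refine ⟨⟨h1, h2, ?_⟩, hJ⟩
    have := cs.geomRep_minCosetRep_inv_nonneg_of_supported (J := J) w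
      (β := -cs.geomRep (cs.parabolicProj J w)⁻¹ β) (neg_nonneg.2 h3)
      fun i hi => by rw [Finsupp.neg_apply, hoff i hi, hJ i hi, neg_zero]
    rw [map_neg, ← hw] at this
    exact neg_nonneg.1 this
  · rintro ⟨⟨h1, h2, h3⟩, hJ⟩
    refine ⟨h1, h2, (h1.geomRep _).nonpos_of_not_nonneg fun h => ?_⟩
    have := cs.geomRep_minCosetRep_inv_nonneg_of_supported (J := J) w h
      fun i hi => by rw [hoff i hi, hJ i hi]
    rw [← hw] at this
    exact (h1.geomRep _).not_nonpos this h3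

theorem parabolicProj_eq {J : Set B} {w p : W}
    (h : ∀ β, β ∈ cs.inversions p ↔ β ∈ cs.inversions w ∧ ∀ i ∉ J, β i = 0) :
    cs.parabolicProj J w = p :=
  cs.inversions_injective <| by
    ext β
    rw [mem_inversions_parabolicProj, h]

theorem mem_standardParabolic_iff {J : Set B} {w : W} :
    w ∈ cs.standardParabolic J ↔ ∀ β ∈ cs.inversions w, ∀ i ∉ J, β i = 0 := by
  constructor
  · rintro h β ⟨-, h2, h3⟩ i hi
    have h4 := h3 i
    rw [cs.geomRep_apply_of_mem_standardParabolic (inv_mem h) β hi] at h4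
    exact le_antisymm h4 (h2 i)
  · intro h
    have : cs.parabolicProj J w = w := cs.parabolicProj_eq fun β => ⟨fun hβ => ⟨hβ, h β hβ⟩, And.left⟩
    rw [← this]
    exact cs.parabolicProj_mem J w

theorem parabolicProj_mul_simple_of_not_supported {J : Set B} {x : W} {i : B}
    (h : cs.length x < cs.length (x * cs.simple i))
    (hJ : ¬ ∀ k ∉ J, cs.geomRep x (M.simpleRoot i) k = 0) :
    cs.parabolicProj J (x * cs.simple i) = cs.parabolicProj J x :=
  cs.parabolicProj_eq fun β => by
    rw [mem_inversions_parabolicProj, cs.mem_inversions_mul_simple h]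
    constructor
    · rintro ⟨h1, h2⟩
      exact ⟨Or.inr h1, h2⟩
    · rintro ⟨rfl | h1, h2⟩
      · exact absurd h2 hJ
      · exact ⟨h1, h2⟩

/-- Together with the previous lemma this says that, along a reduced word of x, the inversions
supported on J form the inversion sequence of a reduced word of x_J. -/
theorem parabolicProj_mul_simple_of_supported {J : Set B} {x : W} {i : B}
    (h : cs.length x < cs.length (x * cs.simple i))
    (hJ : ∀ k ∉ J, cs.geomRep x (M.simpleRoot i) k = 0) :
    ∃ j, cs.parabolicProj J (x * cs.simple i) = cs.parabolicProj J x * cs.simple j ∧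
      cs.length (cs.parabolicProj J x) < cs.length (cs.parabolicProj J x * cs.simple j) ∧
      cs.geomRep (cs.parabolicProj J x) (M.simpleRoot j) = cs.geomRep x (M.simpleRoot i) := by
  set γ := cs.geomRep x (M.simpleRoot i) with hγ
  set y := cs.minCosetRep J x with hy
  set p := cs.parabolicProj J x with hp
  have hpy : p * y = x := cs.parabolicProj_mul_minCosetRep J x
  have hγr : cs.IsRoot γ := (cs.isRoot_simpleRoot i).geomRep x
  have hγ0 : 0 ≤ γ := cs.geomRep_simpleRoot_nonneg h
  have hγx : γ ∉ cs.inversions x := cs.geomRep_simpleRoot_not_mem_inversions x i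
  have hγp : γ ∉ cs.inversions p := fun h' => hγx (cs.mem_inversions_parabolicProj.1 h').1
  set δ := cs.geomRep p⁻¹ γ with hδ
  have hδ0 : 0 ≤ δ := geomRep_inv_nonneg hγr hγ0 hγp
  have hδJ : ∀ k ∉ J, δ k = 0 := fun k hk => by
    rw [hδ, cs.geomRep_apply_of_mem_standardParabolic (inv_mem (cs.parabolicProj_mem J x)) γ hk,
      hJ k hk]
  have hyδ : cs.geomRep y⁻¹ δ = M.simpleRoot i := by
    rw [hδ, ← geomRep_mul, ← mul_inv_rev, hpy, hγ, geomRep_inv_self]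
  have hδr : cs.IsRoot δ := hγr.geomRep _
  obtain ⟨j, hj⟩ : ∃ j, δ j ≠ 0 := by
    by_contra hcon
    push Not at hcon
    exact hδr.ne_zero (Finsupp.ext hcon)
  have hpos : ∀ k, δ k ≠ 0 → 0 ≤ cs.geomRep y⁻¹ (M.simpleRoot k) := fun k hk =>
    cs.geomRep_minCosetRep_inv_nonneg x (by by_contra h'; exact hk (hδJ k h'))
  -- The simple root α_i = y⁻¹δ is a nonnegative combination of the nonnegative vectors y⁻¹α_k, so
  -- every term that occurs vanishes off the coordinate i and the root y⁻¹α_j must be α_i.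
  have hyj : cs.geomRep y⁻¹ (M.simpleRoot j) = M.simpleRoot i := by
    refine ((cs.isRoot_simpleRoot j).geomRep _).eq_simpleRoot (hpos j hj) fun k hk => ?_
    refine apply_simpleRoot_eq_zero_of_support (M := M)
      (Finsupp.lapply k ∘ₗ (cs.geomRep y⁻¹).toLinearMap) hδ0 (fun l hl => hpos l hl k) ?_ hj
    change cs.geomRep y⁻¹ δ k = 0
    rw [hyδ, simpleRoot_apply_ne M (Ne.symm hk)]
  have hjδ : M.simpleRoot j = δ := by
    apply (cs.geomRep y⁻¹).injective
    rw [hyj, hyδ]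
  have hpj : cs.geomRep p (M.simpleRoot j) = γ := by
    rw [hjδ, hδ, geomRep_self_inv]
  have hlt : cs.length p < cs.length (p * cs.simple j) :=
    cs.geomRep_simpleRoot_nonneg_iff.1 (hpj ▸ hγ0)
  refine ⟨j, cs.parabolicProj_eq fun β => ?_, hlt, hpj⟩
  rw [cs.mem_inversions_mul_simple hlt, cs.mem_inversions_mul_simple h, hpj,
    mem_inversions_parabolicProj]
  constructor
  · rintro (rfl | ⟨h1, h2⟩)
    · exact ⟨Or.inl rfl, hJ⟩
    · exact ⟨Or.inr h1, h2⟩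
  · rintro ⟨rfl | h1, h2⟩
    · exact Or.inl rfl
    · exact Or.inr ⟨h1, h2⟩

/-! ### Joins in the weak order -/

variable {cs}

theorem WeakLE.trans {x y z : W} (h : cs.WeakLE x y) (h' : cs.WeakLE y z) : cs.WeakLE x z :=
  Relation.ReflTransGen.trans h h'

theorem WeakLE.length_le {x y : W} (h : cs.WeakLE x y) : cs.length x ≤ cs.length y :=
  cs.length_le_of_inversions_subset h.inversions_subset

variable (cs)

theorem weakLE_refl (x : W) : cs.WeakLE x x :=
  Relation.ReflTransGen.refl

theorem exists_mul_simple_weakLE {p x : W} (h : cs.WeakLE p x) (hne : p ≠ x) :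
    ∃ i, cs.length p < cs.length (p * cs.simple i) ∧ cs.WeakLE (p * cs.simple i) x := by
  rcases Relation.ReflTransGen.cases_head h with h | ⟨y, ⟨i, rfl, hi⟩, hy⟩
  · exact absurd h hne
  · exact ⟨i, hi, hy⟩

/-- A bounded order ideal of the weak order in which any two upper covers of an element have an
upper bound has a greatest element. -/
theorem exists_greatest_of_diamond {I : Set W} (hne : I.Nonempty) {N : ℕ}
    (hdown : ∀ x ∈ I, ∀ y, cs.WeakLE y x → y ∈ I) (hN : ∀ x ∈ I, cs.length x ≤ N)
    (hd : ∀ p i j, cs.length p < cs.length (p * cs.simple i) →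
      cs.length p < cs.length (p * cs.simple j) → p * cs.simple i ∈ I → p * cs.simple j ∈ I →
      ∃ q ∈ I, cs.WeakLE (p * cs.simple i) q ∧ cs.WeakLE (p * cs.simple j) q) :
    ∃ m ∈ I, ∀ x ∈ I, cs.WeakLE x m := by
  -- As in Newman's lemma: by downward induction on the length, the part of I above p is bounded by
  -- an element of I. Bounds over two different covers of p are compared through the common upper
  -- bound q.
  have key : ∀ n, ∀ p ∈ I, N - cs.length p = n → ∃ m ∈ I, ∀ x ∈ I, cs.WeakLE p x →
      cs.WeakLE x m := by
    intro n
    induction n using Nat.strong_induction_on with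
    | _ n ih =>
    rintro p hp rfl
    by_cases hcov : ∃ i, cs.length p < cs.length (p * cs.simple i) ∧ p * cs.simple i ∈ I
    · obtain ⟨i, hi, hiI⟩ := hcov
      have hm : ∀ j, cs.length p < cs.length (p * cs.simple j) → p * cs.simple j ∈ I →
          ∃ m ∈ I, ∀ x ∈ I, cs.WeakLE (p * cs.simple j) x → cs.WeakLE x m := by
        intro j hj hjI
        refine ih _ ?_ _ hjI rfl
        have := hN _ hjI
        omega
      obtain ⟨m, hmI, hm1⟩ := hm i hi hiI
      refine ⟨m, hmI, fun x hx hpx => ?_⟩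
      by_cases hpx' : p = x
      · subst hpx'
        exact (Relation.ReflTransGen.single ⟨i, rfl, hi⟩).trans (hm1 _ hiI (cs.weakLE_refl _))
      obtain ⟨j, hj, hjx⟩ := cs.exists_mul_simple_weakLE hpx hpx'
      have hjI := hdown x hx _ hjx
      obtain ⟨m', hmI', hm1'⟩ := hm j hj hjI
      obtain ⟨q, hq, hiq, hjq⟩ := hd p i j hi hj hiI hjI
      exact (hm1' x hx hjx).trans (hm1 _ hmI' (hiq.trans (hm1' q hq hjq)))
    · refine ⟨p, hp, fun x hx hpx => ?_⟩
      by_cases hpx' : p = x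
      · exact hpx' ▸ cs.weakLE_refl _
      obtain ⟨j, hj, hjx⟩ := cs.exists_mul_simple_weakLE hpx hpx'
      exact absurd ⟨j, hj, hdown x hx _ hjx⟩ hcov
  obtain ⟨x, hx⟩ := hne
  obtain ⟨m, hm, h⟩ := key _ 1 (hdown x hx _ (cs.weakLE_one x)) rfl
  exact ⟨m, hm, fun x hx => h x hx (cs.weakLE_one x)⟩

/-- Two upper covers `p s_i`, `p s_j` of `p` with an upper bound have an upper bound whose further
inversions lie in the cone spanned by `p α_i` and `p α_j`. -/
theorem exists_rank_two_upper_bound {p u : W} {i j : B}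
    (hi : cs.length p < cs.length (p * cs.simple i))
    (hj : cs.length p < cs.length (p * cs.simple j))
    (hiu : cs.WeakLE (p * cs.simple i) u) (hju : cs.WeakLE (p * cs.simple j) u) :
    ∃ q, cs.WeakLE (p * cs.simple i) q ∧ cs.WeakLE (p * cs.simple j) q ∧
      ∀ β ∈ cs.inversions q, β ∈ cs.inversions p ∨ ∃ a b : ℝ, 0 ≤ a ∧ 0 ≤ b ∧
        β = a • cs.geomRep p (M.simpleRoot i) + b • cs.geomRep p (M.simpleRoot j) := by
  classical
  set K : Set B := {i, j}
  -- The upper bound is p k: both α_i and α_j are inversions of p⁻¹u supported on K, hence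
  -- inversions of k.
  set k := cs.parabolicProj K (p⁻¹ * u) with hk
  have hpi := cs.geomRep_simpleRoot_nonneg hi
  have hpj := cs.geomRep_simpleRoot_nonneg hj
  have hkinv : ∀ δ ∈ cs.inversions k, ∃ a b : ℝ, 0 ≤ a ∧ 0 ≤ b ∧
      cs.geomRep p δ = a • cs.geomRep p (M.simpleRoot i) + b • cs.geomRep p (M.simpleRoot j) := by
    intro δ hδ
    obtain ⟨⟨-, hδ0, -⟩, hδK⟩ := cs.mem_inversions_parabolicProj.1 hδ
    by_cases hij : i = j
    · subst hij
      refine ⟨δ i, 0, hδ0 i, le_rfl, ?_⟩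
      rw [zero_smul, add_zero, ← map_smul]
      congr 1
      ext l
      by_cases hl : l = i
      · subst hl; simp [simpleRoot_apply_self]
      · simp [hδK l (by simp [K, hl]), simpleRoot_apply_ne M (Ne.symm hl)]
    · refine ⟨δ i, δ j, hδ0 i, hδ0 j, ?_⟩
      rw [← map_smul, ← map_smul, ← map_add]
      congr 1
      ext l
      by_cases hl : l = i
      · subst hl; simp [simpleRoot_apply_self, simpleRoot_apply_ne M (Ne.symm hij)]
      by_cases hl' : l = j
      · subst hl'; simp [simpleRoot_apply_self, simpleRoot_apply_ne M hij]
      · simp [hδK l (by simp [K, hl, hl']), simpleRoot_apply_ne M (Ne.symm hl),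
          simpleRoot_apply_ne M (Ne.symm hl')]
  have hpq : ∀ β, cs.geomRep (p * k)⁻¹ β = cs.geomRep k⁻¹ (cs.geomRep p⁻¹ β) := fun β => by
    rw [mul_inv_rev, geomRep_mul]
  -- If an inversion β of p were lost, -p⁻¹β would be an inversion of k, and -β would be a
  -- nonnegative combination of the positive roots p α_i and p α_j.
  have hsub : cs.inversions p ⊆ cs.inversions (p * k) := by
    rintro β ⟨h1, h2, h3⟩
    refine ⟨h1, h2, ?_⟩
    rw [hpq]
    refine ((h1.geomRep _).geomRep _).nonpos_of_not_nonneg fun h4 => ?_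
    have h5 : -cs.geomRep p⁻¹ β ∈ cs.inversions k :=
      ⟨(h1.geomRep _).neg, neg_nonneg.2 h3, by rw [map_neg]; exact neg_nonpos.2 h4⟩
    obtain ⟨a, b, ha, hb, h6⟩ := hkinv _ h5
    rw [map_neg, geomRep_self_inv] at h6
    have h7 : 0 ≤ -β := by
      rw [h6]
      exact add_nonneg (smul_nonneg ha hpi) (smul_nonneg hb hpj)
    exact h1.not_nonpos h2 (neg_nonneg.1 h7)
  have hcov : ∀ l ∈ K, cs.length p < cs.length (p * cs.simple l) →
      cs.WeakLE (p * cs.simple l) u → cs.WeakLE (p * cs.simple l) (p * k) := by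
    intro l hlK hl hlu
    rw [weakLE_iff]
    intro β hβ
    rcases (cs.mem_inversions_mul_simple hl).1 hβ with rfl | hβ
    · refine ⟨(cs.isRoot_simpleRoot l).geomRep p, cs.geomRep_simpleRoot_nonneg hl, ?_⟩
      rw [hpq, geomRep_inv_self]
      have h1 : M.simpleRoot l ∈ cs.inversions k := by
        rw [hk, mem_inversions_parabolicProj]
        refine ⟨⟨cs.isRoot_simpleRoot l, simpleRoot_nonneg M l, ?_⟩, ?_⟩
        · have h2 := hlu.inversions_subset
            ((cs.mem_inversions_mul_simple hl).2 (Or.inl rfl))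
          rw [mul_inv_rev, inv_inv, geomRep_mul]
          exact h2.2.2
        · intro i' hi'
          exact simpleRoot_apply_ne M fun h => hi' (h ▸ hlK)
      exact h1.2.2
    · exact hsub hβ
  refine ⟨p * k, hcov i (by simp [K]) hi hiu, hcov j (by simp [K]) hj hju, ?_⟩
  rintro β ⟨h1, h2, h3⟩
  by_cases hβ : β ∈ cs.inversions p
  · exact Or.inl hβ
  · right
    rw [hpq] at h3
    obtain ⟨a, b, ha, hb, h4⟩ := hkinv _ ⟨h1.geomRep p⁻¹, geomRep_inv_nonneg h1 h2 hβ, h3⟩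
    rw [geomRep_self_inv] at h4
    exact ⟨a, b, ha, hb, h4⟩

theorem geomRep_mem_inversions_of_weakLE {p u : W} {i : B}
    (hi : cs.length p < cs.length (p * cs.simple i)) (hiu : cs.WeakLE (p * cs.simple i) u) :
    cs.geomRep p (M.simpleRoot i) ∈ cs.inversions u :=
  hiu.inversions_subset ((cs.mem_inversions_mul_simple hi).2 (Or.inl rfl))

theorem rank_two_upper_bound_weakLE {p q u : W} {i j : B}
    (hq : ∀ β ∈ cs.inversions q, β ∈ cs.inversions p ∨ ∃ a b : ℝ, 0 ≤ a ∧ 0 ≤ b ∧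
        β = a • cs.geomRep p (M.simpleRoot i) + b • cs.geomRep p (M.simpleRoot j))
    (hi : cs.length p < cs.length (p * cs.simple i))
    (hj : cs.length p < cs.length (p * cs.simple j))
    (hiu : cs.WeakLE (p * cs.simple i) u) (hju : cs.WeakLE (p * cs.simple j) u) :
    cs.WeakLE q u := by
  rw [weakLE_iff]
  intro β hβ
  rcases hq β hβ with h | ⟨a, b, ha, hb, h⟩
  · exact hiu.inversions_subset ((cs.mem_inversions_mul_simple hi).2 (Or.inr h))
  · refine ⟨hβ.1, hβ.2.1, ?_⟩
    rw [h, map_add, map_smul, map_smul]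
    exact add_nonpos
      (smul_nonpos_of_nonneg_of_nonpos ha (cs.geomRep_mem_inversions_of_weakLE hi hiu).2.2)
      (smul_nonpos_of_nonneg_of_nonpos hb (cs.geomRep_mem_inversions_of_weakLE hj hju).2.2)

/-- The weak order is a meet semilattice; equivalently, two elements with an upper bound have a
join. -/
theorem exists_isWeakJoin {x y u : W} (hx : cs.WeakLE x u) (hy : cs.WeakLE y u) :
    ∃ z, cs.IsWeakJoin x y z := by
  -- The ideal consists of the elements below all common upper bounds of x and y; its greatest
  -- element is the join.
  obtain ⟨m, hm, hmax⟩ := cs.exists_greatest_of_diamond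
    (I := {w | ∀ u, cs.WeakLE x u → cs.WeakLE y u → cs.WeakLE w u}) (N := cs.length u)
    ⟨x, fun _ h _ => h⟩ (fun w hw v hv u' h1 h2 => hv.trans (hw u' h1 h2))
    (fun w hw => (hw u hx hy).length_le) (by
      intro p i j hi hj hiI hjI
      obtain ⟨q, hiq, hjq, hq⟩ :=
        cs.exists_rank_two_upper_bound hi hj (hiI u hx hy) (hjI u hx hy)
      exact ⟨q, fun u' h1 h2 =>
        cs.rank_two_upper_bound_weakLE hq hi hj (hiI u' h1 h2) (hjI u' h1 h2), hiq, hjq⟩)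
  exact ⟨m, hmax x fun _ h _ => h, hmax y fun _ _ h => h, hm⟩

theorem eq_zero_of_smul_add_smul {a b : ℝ} (ha : 0 ≤ a) (hb : 0 ≤ b) {x y : B →₀ ℝ} (hx : 0 ≤ x)
    (hy : 0 ≤ y) {i : B} (h : (a • x + b • y) i = 0) : (a = 0 ∨ x i = 0) ∧ (b = 0 ∨ y i = 0) := by
  have h1 : 0 ≤ a * x i := mul_nonneg ha (hx i)
  have h2 : 0 ≤ b * y i := mul_nonneg hb (hy i)
  simp only [Finsupp.add_apply, Finsupp.smul_apply, smul_eq_mul] at h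
  exact ⟨mul_eq_zero.1 (by linarith), mul_eq_zero.1 (by linarith)⟩

/-- If `s` is not in `J`, then all inversions of `s ∨ v` in the standard parabolic subgroup of `J`
are inversions of `v`. -/
theorem mem_inversions_of_isWeakJoin_simple {J : Set B} {s : B} (hs : s ∉ J) {v z : W}
    (hz : cs.IsWeakJoin (cs.simple s) v z)
    {β : B →₀ ℝ} (hβ : β ∈ cs.inversions z) (hβJ : ∀ i ∉ J, β i = 0) : β ∈ cs.inversions v := by
  -- The ideal consists of the elements below z whose inversions supported on J are inversions of v.
  -- The diamond condition holds because, if a nonnegative combination of two positive roots is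
  -- supported on J, so is each root with nonzero coefficient. Both s and v belong to the ideal,
  -- which forces z ≤ m.
  obtain ⟨m, hm, hmax⟩ := cs.exists_greatest_of_diamond
    (I := {w | cs.WeakLE w z ∧ ∀ β ∈ cs.inversions w, (∀ i ∉ J, β i = 0) → β ∈ cs.inversions v})
    (N := cs.length z) ⟨v, hz.2.1, fun _ h _ => h⟩
    (fun w hw v hv => ⟨hv.trans hw.1, fun β hβ hJ => hw.2 β (hv.inversions_subset hβ) hJ⟩)
    (fun w hw => hw.1.length_le) (by
      intro p i j hi hj hiI hjI
      obtain ⟨q, hiq, hjq, hq⟩ := cs.exists_rank_two_upper_bound hi hj hiI.1 hjI.1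
      refine ⟨q, ⟨cs.rank_two_upper_bound_weakLE hq hi hj hiI.1 hjI.1, fun β hβ hJ => ?_⟩,
        hiq, hjq⟩
      rcases hq β hβ with h | ⟨a, b, ha, hb, rfl⟩
      · exact hiI.2 β ((cs.mem_inversions_mul_simple hi).2 (Or.inr h)) hJ
      · have hz' : ∀ k ∉ J, _ := fun k hk => eq_zero_of_smul_add_smul ha hb
          (cs.geomRep_simpleRoot_nonneg hi) (cs.geomRep_simpleRoot_nonneg hj) (hJ k hk)
        refine ⟨hβ.1, hβ.2.1, ?_⟩
        rw [map_add, map_smul, map_smul]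
        refine add_nonpos ?_ ?_
        · by_cases ha0 : a = 0
          · rw [ha0, zero_smul]
          · exact smul_nonpos_of_nonneg_of_nonpos ha
              (hiI.2 _ ((cs.mem_inversions_mul_simple hi).2 (Or.inl rfl))
                fun k hk => (hz' k hk).1.resolve_left ha0).2.2
        · by_cases hb0 : b = 0
          · rw [hb0, zero_smul]
          · exact smul_nonpos_of_nonneg_of_nonpos hb
              (hjI.2 _ ((cs.mem_inversions_mul_simple hj).2 (Or.inl rfl))
                fun k hk => (hz' k hk).2.resolve_left hb0).2.2)
  have hzm : cs.WeakLE z m := by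
    refine hz.2.2 m (hmax _ ⟨hz.1, fun β hβ hJ => ?_⟩) (hmax _ ⟨hz.2.1, fun _ h _ => h⟩)
    rw [inversions_simple, Set.mem_singleton_iff] at hβ
    have := hJ s hs
    rw [hβ, simpleRoot_apply_self] at this
    exact absurd this one_ne_zero
  exact hm.2 β (hzm.inversions_subset hβ) hβJ

end CoxeterSystem

namespace CoxeterMatrix

variable {B : Type*} (M : CoxeterMatrix B)

/-! ### The Euler form of a word -/

/-- The vector `x` has no coordinates outside the letters of `l`. -/
def SupportedOn (l : List B) (x : B →₀ ℝ) : Prop :=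
  ∀ j, j ∉ l → x j = 0

/-- The part of the `i`-th row of the Cartan matrix with columns in `l`. -/
noncomputable def cartanRow (i : B) : List B → (B →₀ ℝ) →ₗ[ℝ] ℝ
  | [] => 0
  | j :: l => M.cartanEntry i j • Finsupp.lapply j + cartanRow i l

/-- The Euler form of a word `l` without repetitions: the (non-symmetric) bilinear form given by
`1` on the diagonal and by the Cartan entry at `(i, j)` if `i` precedes `j` in `l`. -/
noncomputable def eulerForm : List B → (B →₀ ℝ) →ₗ[ℝ] (B →₀ ℝ) →ₗ[ℝ] ℝ
  | [] => 0
  | i :: l => (Finsupp.lapply i).smulRight (Finsupp.lapply i + M.cartanRow i l) + eulerForm l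

@[simp]
theorem cartanRow_nil (i : B) (x : B →₀ ℝ) : M.cartanRow i [] x = 0 := rfl

@[simp]
theorem cartanRow_cons (i j : B) (l : List B) (x : B →₀ ℝ) :
    M.cartanRow i (j :: l) x = M.cartanEntry i j * x j + M.cartanRow i l x := rfl

@[simp]
theorem eulerForm_nil (x y : B →₀ ℝ) : M.eulerForm [] x y = 0 := rfl

@[simp]
theorem eulerForm_cons (i : B) (l : List B) (x y : B →₀ ℝ) :
    M.eulerForm (i :: l) x y = x i * (y i + M.cartanRow i l y) + M.eulerForm l x y := rfl

theorem cartanRow_append_singleton (i s : B) (l : List B) (x : B →₀ ℝ) :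
    M.cartanRow i (l ++ [s]) x = M.cartanRow i l x + M.cartanEntry i s * x s := by
  induction l with
  | nil => simp
  | cons j l ih => simp [ih]; ring

theorem eulerForm_append_singleton (s : B) (l : List B) (x y : B →₀ ℝ) :
    M.eulerForm (l ++ [s]) x y = M.eulerForm l x y + (x s + M.cartanRow s l x) * y s := by
  induction l with
  | nil => simp
  | cons j l ih =>
    simp [ih, cartanRow_append_singleton, M.cartanEntry_comm j s]
    ring

variable {M} in
theorem cartanRow_congr (i : B) {l : List B} {x y : B →₀ ℝ} (h : ∀ j ∈ l, x j = y j) :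
    M.cartanRow i l x = M.cartanRow i l y := by
  induction l with
  | nil => rfl
  | cons j l ih =>
    rw [cartanRow_cons, cartanRow_cons, h j (by simp), ih fun k hk => h k (by simp [hk])]

variable {M} in
theorem eulerForm_congr {l : List B} {x x' y y' : B →₀ ℝ} (hx : ∀ j ∈ l, x j = x' j)
    (hy : ∀ j ∈ l, y j = y' j) : M.eulerForm l x y = M.eulerForm l x' y' := by
  induction l with
  | nil => rfl
  | cons j l ih =>
    rw [eulerForm_cons, eulerForm_cons, hx j (by simp), hy j (by simp),
      cartanRow_congr j (x := y) (y := y') fun k hk => hy k (by simp [hk]),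
      ih (fun k hk => hx k (by simp [hk])) fun k hk => hy k (by simp [hk])]

theorem cartanForm_simpleRoot_eq_cartanRow (i : B) {l : List B} (hl : l.Nodup) {x : B →₀ ℝ}
    (hx : SupportedOn l x) : M.cartanForm (M.simpleRoot i) x = M.cartanRow i l x := by
  induction l generalizing x with
  | nil =>
    have : x = 0 := Finsupp.ext fun j => hx j (by simp)
    simp [this]
  | cons j l ih =>
    rw [List.nodup_cons] at hl
    have hx' : SupportedOn l (x - x j • M.simpleRoot j) := by
      intro k hk
      by_cases hkj : k = j
      · subst hkj
        simp [CoxeterSystem.simpleRoot_apply_self]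
      · simp [CoxeterSystem.simpleRoot_apply_ne M (Ne.symm hkj), hx k (by simp [hk, hkj])]
    have h := ih hl.2 hx'
    rw [map_sub, map_smul, M.cartanForm_simpleRoot, smul_eq_mul] at h
    have h2 : M.cartanRow i l (x - x j • M.simpleRoot j) = M.cartanRow i l x :=
      cartanRow_congr i fun k hk => by
        have hkj : j ≠ k := fun h => hl.1 (h ▸ hk)
        simp [CoxeterSystem.simpleRoot_apply_ne M hkj]
    rw [h2] at h
    rw [cartanRow_cons]
    linarith

theorem cartanForm_simpleRoot_cons {i : B} {l : List B} (hl : (i :: l).Nodup) {x : B →₀ ℝ}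
    (hx : SupportedOn (i :: l) x) :
    M.cartanForm (M.simpleRoot i) x = 2 * x i + M.cartanRow i l x := by
  rw [M.cartanForm_simpleRoot_eq_cartanRow i hl hx, cartanRow_cons, cartanEntry_self]

theorem SupportedOn.append_singleton {i : B} {l : List B} {x : B →₀ ℝ}
    (h : SupportedOn (i :: l) x) : SupportedOn (l ++ [i]) x :=
  fun _ hj => h _ fun h' => hj (by simpa [or_comm] using h')

theorem SupportedOn.cons {i : B} {l : List B} {x : B →₀ ℝ}
    (h : SupportedOn (l ++ [i]) x) : SupportedOn (i :: l) x :=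
  fun _ hj => h _ fun h' => hj (by simpa [or_comm] using h')

theorem supportedOn_simpleRoot {i : B} {l : List B} (hi : i ∈ l) :
    SupportedOn l (M.simpleRoot i) := fun _ hj =>
  CoxeterSystem.simpleRoot_apply_ne M fun h => hj (h ▸ hi)

theorem cartanRow_nonpos {i : B} {l : List B} (hi : i ∉ l) {x : B →₀ ℝ} (hx : 0 ≤ x) :
    M.cartanRow i l x ≤ 0 := by
  induction l with
  | nil => simp
  | cons j l ih =>
    simp only [List.mem_cons, not_or] at hi
    rw [cartanRow_cons]
    have h1 := mul_nonpos_of_nonpos_of_nonneg (M.cartanEntry_nonpos hi.1) (hx j)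
    have h2 := ih hi.2
    linarith

/-- The Euler form is the upper triangular half of the Cartan form, with 1 instead of 2 on the
diagonal. -/
theorem eulerForm_add_eulerForm {l : List B} (hl : l.Nodup) {x y : B →₀ ℝ} (hx : SupportedOn l x)
    (hy : SupportedOn l y) : M.eulerForm l x y + M.eulerForm l y x = M.cartanForm x y := by
  induction l generalizing x y with
  | nil =>
    have : x = 0 := Finsupp.ext fun j => hx j (by simp)
    simp [this]
  | cons i l ih =>
    have hi : i ∉ l := (List.nodup_cons.1 hl).1
    have hsub : ∀ {z : B →₀ ℝ}, SupportedOn (i :: l) z →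
        SupportedOn l (z - z i • M.simpleRoot i) := by
      intro z hz k hk
      by_cases hki : k = i
      · subst hki
        simp [CoxeterSystem.simpleRoot_apply_self]
      · simp [CoxeterSystem.simpleRoot_apply_ne M (Ne.symm hki), hz k (by simp [hk, hki])]
    have hcongr : ∀ z : B →₀ ℝ, ∀ k ∈ l, (z - z i • M.simpleRoot i) k = z k := by
      intro z k hk
      have hik : i ≠ k := fun h => hi (h ▸ hk)
      simp [CoxeterSystem.simpleRoot_apply_ne M hik]
    have h := ih (List.nodup_cons.1 hl).2 (hsub hx) (hsub hy)
    rw [eulerForm_congr (hcongr x) (hcongr y), eulerForm_congr (hcongr y) (hcongr x)] at h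
    simp only [map_sub, map_smul, LinearMap.sub_apply, LinearMap.smul_apply, smul_eq_mul,
      M.cartanForm_simpleRoot_self] at h
    rw [M.cartanForm_comm x (M.simpleRoot i), M.cartanForm_simpleRoot_cons hl hx,
      M.cartanForm_simpleRoot_cons hl hy] at h
    rw [eulerForm_cons, eulerForm_cons]
    linarith

/-- The skew-symmetric form of a word. -/
noncomputable def skewForm (l : List B) (x y : B →₀ ℝ) : ℝ :=
  M.eulerForm l y x - M.eulerForm l x y

theorem eulerForm_simpleRoot_cons {i : B} {l : List B} (hl : (i :: l).Nodup) (x : B →₀ ℝ) :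
    M.eulerForm (i :: l) x (M.simpleRoot i) = x i := by
  have hi : i ∉ l := (List.nodup_cons.1 hl).1
  have h0 : ∀ j ∈ l, M.simpleRoot i j = (0 : B →₀ ℝ) j := fun j hj =>
    CoxeterSystem.simpleRoot_apply_ne M fun h => hi (h ▸ hj)
  rw [eulerForm_cons, cartanRow_congr i h0, eulerForm_congr (fun _ _ => rfl) h0]
  simp [CoxeterSystem.simpleRoot_apply_self]

theorem eulerForm_simpleRoot_append {i : B} {l : List B} (hl : (l ++ [i]).Nodup) (x : B →₀ ℝ) :
    M.eulerForm (l ++ [i]) (M.simpleRoot i) x = x i := by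
  have hi : i ∉ l := by
    rw [List.nodup_append_comm] at hl
    exact (List.nodup_cons.1 hl).1
  have h0 : ∀ j ∈ l, M.simpleRoot i j = (0 : B →₀ ℝ) j := fun j hj =>
    CoxeterSystem.simpleRoot_apply_ne M fun h => hi (h ▸ hj)
  rw [eulerForm_append_singleton, cartanRow_congr i h0, eulerForm_congr h0 (fun _ _ => rfl)]
  simp [CoxeterSystem.simpleRoot_apply_self]

/-- By `cartanRow_nonpos` this value is nonnegative on nonnegative vectors: an initial simple root
may come before everything, and by `skewForm_simpleRoot_append` a final one may come after
everything. -/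
theorem skewForm_simpleRoot_cons {i : B} {l : List B} (hl : (i :: l).Nodup) {x : B →₀ ℝ}
    (hx : SupportedOn (i :: l) x) :
    M.skewForm (i :: l) (M.simpleRoot i) x = -M.cartanRow i l x := by
  have h1 := M.eulerForm_add_eulerForm hl (M.supportedOn_simpleRoot (i := i) (by simp)) hx
  rw [M.cartanForm_simpleRoot_cons hl hx, M.eulerForm_simpleRoot_cons hl] at h1
  rw [skewForm, M.eulerForm_simpleRoot_cons hl]
  linarith

theorem skewForm_simpleRoot_append {i : B} {l : List B} (hl : (l ++ [i]).Nodup) {x : B →₀ ℝ}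
    (hx : SupportedOn (l ++ [i]) x) :
    M.skewForm (l ++ [i]) x (M.simpleRoot i) = -M.cartanRow i l x := by
  have h1 := M.eulerForm_add_eulerForm hl (M.supportedOn_simpleRoot (i := i) (by simp)) hx
  have hl' : (i :: l).Nodup := by rwa [List.nodup_append_comm] at hl
  rw [M.cartanForm_simpleRoot_cons hl' hx.cons, M.eulerForm_simpleRoot_append hl] at h1
  rw [skewForm, M.eulerForm_simpleRoot_append hl]
  linarith

/-- In the order defined by the word `l`, the root `β` can be used before the root `γ`. -/
def Precedes (l : List B) (β γ : B →₀ ℝ) : Prop :=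
  0 ≤ M.skewForm l β γ ∧ (M.skewForm l β γ = 0 → M.cartanForm β γ = 0)

end CoxeterMatrix

namespace CoxeterSystem

open CoxeterMatrix

variable {B : Type*} {M : CoxeterMatrix B} {W : Type*} [Group W] (cs : CoxeterSystem M W)

theorem supportedOn_geomRep_simple {i : B} {l : List B} (hi : i ∈ l) {x : B →₀ ℝ}
    (hx : SupportedOn l x) : SupportedOn l (cs.geomRep (cs.simple i) x) := fun j hj => by
  have hij : i ≠ j := fun h => hj (h ▸ hi)
  rw [geomRep_simple]
  simp [hx j hj, simpleRoot_apply_ne M hij]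

theorem geomRep_simple_apply_ne {i j : B} (hij : i ≠ j) (x : B →₀ ℝ) :
    cs.geomRep (cs.simple i) x j = x j := by
  rw [geomRep_simple]
  simp [simpleRoot_apply_ne M hij]

/-- The reflection changes only the coordinate i, replacing z_i by -z_i minus the row sum. This
moves the row of i from the second argument to the first, which is where it stands when i is the
last letter. -/
theorem eulerForm_rotate {i : B} {l : List B} (hl : (i :: l).Nodup) {x y : B →₀ ℝ}
    (hx : SupportedOn (i :: l) x) (hy : SupportedOn (i :: l) y) :
    M.eulerForm (i :: l) (cs.geomRep (cs.simple i) x) (cs.geomRep (cs.simple i) y) =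
      M.eulerForm (l ++ [i]) x y := by
  have hi : i ∉ l := (List.nodup_cons.1 hl).1
  have hne : ∀ j ∈ l, i ≠ j := fun j hj h => hi (h ▸ hj)
  have e : ∀ z, SupportedOn (i :: l) z →
      cs.geomRep (cs.simple i) z i = -z i - M.cartanRow i l z := by
    intro z hz
    rw [geomRep_simple, M.cartanForm_simpleRoot_cons hl hz]
    simp [simpleRoot_apply_self]
    ring
  have hc : ∀ z : B →₀ ℝ, ∀ j ∈ l, cs.geomRep (cs.simple i) z j = z j := fun z j hj =>
    cs.geomRep_simple_apply_ne (hne j hj) z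
  rw [eulerForm_cons, eulerForm_append_singleton, e x hx, e y hy, eulerForm_congr (hc x) (hc y),
    cartanRow_congr i (hc y)]
  ring

theorem precedes_rotate {i : B} {l : List B} (hl : (i :: l).Nodup) {x y : B →₀ ℝ}
    (hx : SupportedOn (i :: l) x) (hy : SupportedOn (i :: l) y) :
    M.Precedes (i :: l) (cs.geomRep (cs.simple i) x) (cs.geomRep (cs.simple i) y) ↔
      M.Precedes (l ++ [i]) x y := by
  rw [Precedes, Precedes, skewForm, skewForm, cs.eulerForm_rotate hl hx hy,
    cs.eulerForm_rotate hl hy hx, cs.cartanForm_geomRep]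

variable {cs} in
-- If the skew form vanishes, so does the row sum, and s_i γ has i-coordinate -γ_i. As s_i γ is
-- positive, γ_i = 0, and the Cartan pairing vanishes too.
theorem IsRoot.precedes_of_initial {i : B} {l : List B} (hl : (i :: l).Nodup) {γ : B →₀ ℝ}
    (hγ : cs.IsRoot γ) (h0 : 0 ≤ γ) (hs : SupportedOn (i :: l) γ) (hne : γ ≠ M.simpleRoot i) :
    M.Precedes (i :: l) (M.simpleRoot i) γ := by
  rw [Precedes, M.skewForm_simpleRoot_cons hl hs, M.cartanForm_simpleRoot_cons hl hs]
  refine ⟨neg_nonneg.2 (M.cartanRow_nonpos (List.nodup_cons.1 hl).1 h0), fun h => ?_⟩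
  have h1 := hγ.geomRep_simple_nonneg h0 hne i
  rw [geomRep_simple, M.cartanForm_simpleRoot_cons hl hs] at h1
  simp [simpleRoot_apply_self] at h1
  have h2 : 0 ≤ γ i := h0 i
  linarith

/-! ### Aligned elements -/

/-- An element is aligned with respect to the word `l` if it has a reduced word whose sequence of
inversions is compatible with the skew-symmetric form of `l`. -/
inductive Aligned (l : List B) : W → Prop
  | one : Aligned l 1
  | mul_simple (x : W) (i : B) : Aligned l x → cs.length x < cs.length (x * cs.simple i) →
      (∀ β ∈ cs.inversions x, M.Precedes l β (cs.geomRep x (M.simpleRoot i))) →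
      Aligned l (x * cs.simple i)

variable {cs}

theorem inversions_subset_mul_simple {x : W} {i : B}
    (h : cs.length x < cs.length (x * cs.simple i)) :
    cs.inversions x ⊆ cs.inversions (x * cs.simple i) := fun _ hβ =>
  (cs.mem_inversions_mul_simple h).2 (Or.inr hβ)

theorem geomRep_mem_inversions_mul_simple {x : W} {i : B}
    (h : cs.length x < cs.length (x * cs.simple i)) :
    cs.geomRep x (M.simpleRoot i) ∈ cs.inversions (x * cs.simple i) :=
  (cs.mem_inversions_mul_simple h).2 (Or.inl rfl)

theorem Aligned.congr {l l' : List B} {x : W} (h : cs.Aligned l x)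
    (heq : ∀ β ∈ cs.inversions x, ∀ γ ∈ cs.inversions x, M.skewForm l β γ = M.skewForm l' β γ) :
    cs.Aligned l' x := by
  induction h with
  | one => exact .one
  | mul_simple x i _ hlt hp ih =>
    have hsub := inversions_subset_mul_simple hlt
    refine .mul_simple x i (ih fun β hβ γ hγ => heq β (hsub hβ) γ (hsub hγ)) hlt fun β hβ => ?_
    have := hp β hβ
    rwa [Precedes, heq β (hsub hβ) _ (geomRep_mem_inversions_mul_simple hlt)] at this

/-- Compatibility is a condition on pairs of inversions, so it is inherited by the subsequence of
inversions supported on J, which is the inversion sequence of the projection. -/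
theorem Aligned.parabolicProj {l : List B} {x : W} (h : cs.Aligned l x) (J : Set B) :
    cs.Aligned l (cs.parabolicProj J x) := by
  induction h with
  | one =>
    have : cs.parabolicProj J 1 = 1 := cs.parabolicProj_eq fun β => by simp [inversions_one]
    rw [this]
    exact .one
  | mul_simple x i _ hlt hp ih =>
    by_cases hJ : ∀ k ∉ J, cs.geomRep x (M.simpleRoot i) k = 0
    · obtain ⟨j, h1, h2, h3⟩ := cs.parabolicProj_mul_simple_of_supported hlt hJ
      rw [h1]
      refine .mul_simple _ _ ih h2 fun β hβ => ?_
      rw [h3]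
      exact hp β (cs.mem_inversions_parabolicProj.1 hβ).1
    · rwa [cs.parabolicProj_mul_simple_of_not_supported hlt hJ]

variable (cs)

theorem mem_inversions_simple_mul_iff {x : W} {i : B} (hi : M.simpleRoot i ∉ cs.inversions x)
    {β : B →₀ ℝ} : β ∈ cs.inversions (cs.simple i * x) ↔
      β = M.simpleRoot i ∨ cs.geomRep (cs.simple i) β ∈ cs.inversions x := by
  by_cases hβ : β = M.simpleRoot i
  · simp only [hβ, true_or, iff_true]
    exact cs.simpleRoot_mem_inversions_simple_mul.2 hi
  · rw [cs.mem_inversions_simple_mul hβ]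
    simp only [hβ, false_or, and_iff_left_iff_imp]
    exact fun h h' => hi (h' ▸ h)

theorem mem_inversions_iff_of_simpleRoot_mem {x : W} {i : B}
    (hi : M.simpleRoot i ∈ cs.inversions x) {β : B →₀ ℝ} : β ∈ cs.inversions x ↔
      β = M.simpleRoot i ∨ cs.geomRep (cs.simple i) β ∈ cs.inversions (cs.simple i * x) := by
  rw [← cs.mem_inversions_simple_mul_iff (x := cs.simple i * x)
    (by rwa [cs.simpleRoot_mem_inversions_simple_mul, not_not]), cs.simple_mul_simple_cancel_left]

theorem mul_simple_eq_simple_mul {x : W} {i j : B}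
    (h : cs.geomRep x (M.simpleRoot j) = M.simpleRoot i) :
    x * cs.simple j = cs.simple i * x := by
  apply cs.geomRep_injective
  intro v
  rw [geomRep_mul, geomRep_mul, geomRep_simple, geomRep_simple, map_sub, map_smul, h, ← h,
    cartanForm_geomRep]

variable {cs}

/-- The new inversion sequence is α_i followed by the reflected old one. The root α_i precedes
everything because i is initial; the other pairs are handled by rotation. -/
theorem Aligned.simple_mul {i : B} {l : List B} (hl : (i :: l).Nodup) {u : W}
    (h : cs.Aligned (l ++ [i]) u) (hi : M.simpleRoot i ∉ cs.inversions u)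
    (hs : ∀ β ∈ cs.inversions u, SupportedOn (i :: l) β) :
    cs.Aligned (i :: l) (cs.simple i * u) := by
  induction h with
  | one =>
    rw [mul_one, ← one_mul (cs.simple i)]
    exact .mul_simple 1 i .one (by simp) fun β hβ => by simp [inversions_one] at hβ
  | mul_simple x j _ hlt hp ih =>
    have hsub := inversions_subset_mul_simple hlt
    have hix : M.simpleRoot i ∉ cs.inversions x := fun h' => hi (hsub h')
    have hγ := geomRep_mem_inversions_mul_simple hlt
    set γ := cs.geomRep x (M.simpleRoot j) with hγd
    have hγi : γ ≠ M.simpleRoot i := fun h' => hi (h' ▸ hγ)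
    have hsγ := hγ.1.geomRep_simple_nonneg hγ.2.1 hγi
    have hmul : cs.geomRep (cs.simple i * x) (M.simpleRoot j) = cs.geomRep (cs.simple i) γ := by
      rw [geomRep_mul]
    rw [← mul_assoc]
    refine .mul_simple _ j (ih hix fun β hβ => hs β (hsub hβ)) ?_ fun β hβ => ?_
    · rw [← geomRep_simpleRoot_nonneg_iff, hmul]
      exact hsγ
    · rw [hmul]
      rcases (cs.mem_inversions_simple_mul_iff hix).1 hβ with rfl | hβ
      · refine (hγ.1.geomRep _).precedes_of_initial hl hsγ
          (cs.supportedOn_geomRep_simple (by simp) (hs γ hγ)) fun h' => ?_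
        have h2 : γ = -M.simpleRoot i := by
          rw [← cs.geomRep_simple_self, ← h', geomRep_simple_simple]
        exact hγ.1.not_nonpos hγ.2.1 (h2 ▸ neg_nonpos.2 (simpleRoot_nonneg M i))
      · have := (cs.precedes_rotate hl (hs _ (hsub hβ)) (hs γ hγ)).2 (hp _ hβ)
        rwa [geomRep_simple_simple] at this

/-- Along a reduced word each step adds -A_{ji} f(y α_j), where j ≠ i makes the Cartan factor
nonnegative and y α_j is an inversion of x. -/
theorem apply_simpleRoot_le_apply_geomRep (f : (B →₀ ℝ) →ₗ[ℝ] ℝ) {x : W} {i : B}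
    (hx : ∀ β ∈ cs.inversions x, β i = 0) (hf : ∀ β ∈ cs.inversions x, 0 ≤ f β) :
    f (M.simpleRoot i) ≤ f (cs.geomRep x (M.simpleRoot i)) := by
  induction hn : cs.length x using Nat.strong_induction_on generalizing x with
  | _ n ih =>
  subst hn
  by_cases h1 : x = 1
  · simp [h1]
  obtain ⟨j, hj⟩ := cs.exists_rightDescent_of_ne_one h1
  obtain ⟨y, rfl⟩ : ∃ y, x = y * cs.simple j :=
    ⟨x * cs.simple j, (cs.simple_mul_simple_cancel_right j).symm⟩
  rw [IsRightDescent, cs.simple_mul_simple_cancel_right] at hj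
  have hsub := inversions_subset_mul_simple hj
  have hγ := geomRep_mem_inversions_mul_simple hj
  have hy : y ∈ cs.standardParabolic {i}ᶜ := by
    rw [mem_standardParabolic_iff]
    intro β hβ k hk
    simp only [Set.mem_compl_iff, Set.mem_singleton_iff, not_not] at hk
    subst hk
    exact hx β (hsub hβ)
  have hij : j ≠ i := by
    rintro rfl
    have h2 := hx _ hγ
    rw [cs.geomRep_apply_of_mem_standardParabolic hy _ (by simp), simpleRoot_apply_self] at h2
    exact one_ne_zero h2
  have h3 := ih _ hj (fun β hβ => hx β (hsub hβ)) (fun β hβ => hf β (hsub hβ)) rfl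
  have h4 := hf _ hγ
  rw [geomRep_mul, geomRep_simple_simpleRoot, map_sub, map_smul, map_sub, map_smul, smul_eq_mul]
  have := mul_nonneg (neg_nonneg.2 (M.cartanEntry_nonpos hij)) h4
  linarith

/-- This justifies deleting an initial letter that is not used. The first inversion with nonzero
i-coordinate would be γ = x α_i with x in W_⟨i⟩, and this contradicts alignment. -/
theorem Aligned.apply_eq_zero {i : B} {l : List B} (hl : (i :: l).Nodup) {x : W}
    (h : cs.Aligned (i :: l) x) (hi : M.simpleRoot i ∉ cs.inversions x)
    (hs : ∀ β ∈ cs.inversions x, SupportedOn (i :: l) β) : ∀ β ∈ cs.inversions x, β i = 0 := by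
  induction h with
  | one => intro β hβ; simp [inversions_one] at hβ
  | mul_simple x j _ hlt hp ih =>
    have hsub := inversions_subset_mul_simple hlt
    have hγ := geomRep_mem_inversions_mul_simple hlt
    have hx := ih (fun h' => hi (hsub h')) fun β hβ => hs β (hsub hβ)
    have hxJ : x ∈ cs.standardParabolic {i}ᶜ := by
      rw [mem_standardParabolic_iff]
      intro β hβ k hk
      simp only [Set.mem_compl_iff, Set.mem_singleton_iff, not_not] at hk
      subst hk
      exact hx β hβ
    have hfix := cs.geomRep_apply_of_mem_standardParabolic hxJ (M.simpleRoot j) (i := i) (by simp)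
    intro β hβ
    rcases (cs.mem_inversions_mul_simple hlt).1 hβ with rfl | hβ'
    · by_cases hij : j = i
      · exfalso
        subst hij
        set γ := cs.geomRep x (M.simpleRoot j) with hγd
        -- The functional is the skew form with γ in the second place. It is nonnegative on the
        -- inversions of x and zero at γ, so it is at most 0 at α_i; as α_i precedes γ it is 0
        -- there. Then α_i and γ are orthogonal, although the row sum is 0 and γ_i = 1 give the
        -- pairing 2.
        have h1 := apply_simpleRoot_le_apply_geomRep
          (M.eulerForm (j :: l) γ - (M.eulerForm (j :: l)).flip γ) hx fun β hβ => (hp β hβ).1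
        simp only [LinearMap.sub_apply, LinearMap.flip_apply, ← hγd, sub_self] at h1
        have h2 := hγ.1.precedes_of_initial hl hγ.2.1 (hs γ hγ) fun h' => hi (h' ▸ hγ)
        have h3 : M.skewForm (j :: l) (M.simpleRoot j) γ = 0 := le_antisymm h1 h2.1
        have h4 := h2.2 h3
        rw [M.skewForm_simpleRoot_cons hl (hs γ hγ)] at h3
        rw [M.cartanForm_simpleRoot_cons hl (hs γ hγ), hfix, simpleRoot_apply_self] at h4
        linarith
      · rw [hfix, simpleRoot_apply_ne M hij]
    · exact hx β hβ'

/-- After α_i has appeared, the remaining inversions are reflected by rotation. Those before α_i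
both precede it and are preceded by it, hence are orthogonal to it and fixed by s_i. -/
theorem Aligned.simple_mul_of_mem {i : B} {l : List B} (hl : (i :: l).Nodup) {x : W}
    (h : cs.Aligned (i :: l) x) (hi : M.simpleRoot i ∈ cs.inversions x)
    (hs : ∀ β ∈ cs.inversions x, SupportedOn (i :: l) β) :
    cs.Aligned (l ++ [i]) (cs.simple i * x) := by
  induction h with
  | one => simp [inversions_one] at hi
  | mul_simple x j h hlt hp ih =>
    have hsub := inversions_subset_mul_simple hlt
    have hγ := geomRep_mem_inversions_mul_simple hlt
    by_cases hix : M.simpleRoot i ∈ cs.inversions x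
    · have hmul : cs.geomRep (cs.simple i * x) (M.simpleRoot j) =
          cs.geomRep (cs.simple i) (cs.geomRep x (M.simpleRoot j)) := geomRep_mul ..
      have hγi : cs.geomRep x (M.simpleRoot j) ≠ M.simpleRoot i := fun h' =>
        cs.geomRep_simpleRoot_not_mem_inversions x j (h' ▸ hix)
      rw [← mul_assoc]
      refine .mul_simple _ j (ih hix fun β hβ => hs β (hsub hβ)) ?_ fun β hβ => ?_
      · rw [← geomRep_simpleRoot_nonneg_iff, hmul]
        exact hγ.1.geomRep_simple_nonneg hγ.2.1 hγi
      · have h1 : cs.geomRep (cs.simple i) β ∈ cs.inversions x :=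
          (cs.mem_inversions_iff_of_simpleRoot_mem hix).2
            (Or.inr (by rwa [geomRep_simple_simple]))
        have hβs : SupportedOn (i :: l) β := by
          have := cs.supportedOn_geomRep_simple (i := i) (by simp) (hs _ (hsub h1))
          rwa [geomRep_simple_simple] at this
        rw [hmul, ← cs.precedes_rotate hl hβs
          (cs.supportedOn_geomRep_simple (by simp) (hs _ hγ)), geomRep_simple_simple]
        exact hp _ h1
    · have hγi : cs.geomRep x (M.simpleRoot j) = M.simpleRoot i :=
        (((cs.mem_inversions_mul_simple hlt).1 hi).resolve_right hix).symm
      rw [cs.mul_simple_eq_simple_mul hγi, cs.simple_mul_simple_cancel_left]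
      have hfix : ∀ β ∈ cs.inversions x, cs.geomRep (cs.simple i) β = β := by
        intro β hβ
        have h1 := (hp β hβ).1
        rw [hγi] at h1
        have h2 := hβ.1.precedes_of_initial hl hβ.2.1 (hs β (hsub hβ)) fun h' => hix (h' ▸ hβ)
        have h3 : M.skewForm (i :: l) (M.simpleRoot i) β = 0 := by
          refine le_antisymm ?_ h2.1
          rw [skewForm] at h1 ⊢
          linarith
        rw [geomRep_simple, h2.2 h3, zero_smul, sub_zero]
      refine h.congr fun β hβ γ hγ' => ?_
      rw [skewForm, skewForm, ← cs.eulerForm_rotate hl (hs β (hsub hβ)) (hs γ (hsub hγ')),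
        ← cs.eulerForm_rotate hl (hs γ (hsub hγ')) (hs β (hsub hβ)), hfix β hβ, hfix γ hγ']

/-- If `s` is the last letter of the word, then `s` can be removed from an aligned element above
`s` as its last inversion. -/
theorem Aligned.final_simple_mul {s : B} {l : List B} (hl : (l ++ [s]).Nodup) {z : W}
    (h : cs.Aligned (l ++ [s]) z) (hsz : M.simpleRoot s ∈ cs.inversions z)
    (hs : ∀ β ∈ cs.inversions z, SupportedOn (l ++ [s]) β) :
    cs.Aligned (l ++ [s]) (cs.simple s * z) ∧
      ∀ β, β ∈ cs.inversions z ↔ β = M.simpleRoot s ∨ β ∈ cs.inversions (cs.simple s * z) := by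
  have hl' : (s :: l).Nodup := by rwa [List.nodup_append_comm] at hl
  induction h with
  | one => simp [inversions_one] at hsz
  | mul_simple x j h hlt hp ih =>
    have hsub := inversions_subset_mul_simple hlt
    have hγ := geomRep_mem_inversions_mul_simple hlt
    by_cases hsx : M.simpleRoot s ∈ cs.inversions x
    · obtain ⟨ih1, ih2⟩ := ih hsx fun β hβ => hs β (hsub hβ)
      set γ := cs.geomRep x (M.simpleRoot j) with hγd
      -- Alignment gives one sign because α_s comes before γ, and finality of s gives the other. So
      -- γ is orthogonal to α_s and fixed by s: everything after α_s commutes past it.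
      have h0 : M.skewForm (l ++ [s]) (M.simpleRoot s) γ = 0 := by
        have h1 := (hp _ hsx).1
        refine le_antisymm ?_ h1
        have h2 : 0 ≤ M.skewForm (l ++ [s]) γ (M.simpleRoot s) := by
          rw [M.skewForm_simpleRoot_append hl (hs γ hγ)]
          exact neg_nonneg.2 (M.cartanRow_nonpos (List.nodup_cons.1 hl').1 hγ.2.1)
        rw [skewForm] at h2 ⊢
        linarith
      have hfix : cs.geomRep (cs.simple s * x) (M.simpleRoot j) = γ := by
        rw [geomRep_mul, ← hγd, geomRep_simple, (hp _ hsx).2 h0, zero_smul, sub_zero]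
      have hlt' : cs.length (cs.simple s * x) < cs.length (cs.simple s * x * cs.simple j) := by
        rw [← geomRep_simpleRoot_nonneg_iff, hfix]
        exact hγ.2.1
      rw [← mul_assoc]
      refine ⟨.mul_simple _ j ih1 hlt' fun β hβ => ?_, fun β => ?_⟩
      · rw [hfix]
        exact hp β ((ih2 β).2 (Or.inr hβ))
      · rw [cs.mem_inversions_mul_simple hlt, cs.mem_inversions_mul_simple hlt', hfix, ih2]
        tauto
    · have hγi : cs.geomRep x (M.simpleRoot j) = M.simpleRoot s :=
        (((cs.mem_inversions_mul_simple hlt).1 hsz).resolve_right hsx).symm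
      have e := cs.mul_simple_eq_simple_mul hγi
      have e' : cs.simple s * (x * cs.simple j) = x := by
        rw [e, cs.simple_mul_simple_cancel_left]
      rw [e']
      refine ⟨h, fun β => ?_⟩
      rw [cs.mem_inversions_mul_simple hlt, hγi]

variable (cs)

/-! ### Sortable elements of a word -/

/-- The recursive characterization of the sortable elements with respect to (the product of) a
word `l` without repetitions. -/
inductive WordSortable : List B → W → Prop
  | nil : WordSortable [] 1
  | skip {i : B} {l : List B} {v : W} : M.simpleRoot i ∉ cs.inversions v → WordSortable l v →
      WordSortable (i :: l) v
  | use {i : B} {l : List B} {v : W} : M.simpleRoot i ∈ cs.inversions v →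
      WordSortable (l ++ [i]) (cs.simple i * v) → WordSortable (i :: l) v

theorem wordSortable_one (l : List B) : cs.WordSortable l 1 := by
  induction l with
  | nil => exact .nil
  | cons i l ih => exact .skip (by simp [inversions_one]) ih

variable {cs}

theorem WordSortable.of_not_mem {i : B} {l : List B} {v : W} (h : cs.WordSortable (i :: l) v)
    (hi : M.simpleRoot i ∉ cs.inversions v) : cs.WordSortable l v := by
  cases h with
  | skip _ h => exact h
  | use h' _ => exact absurd h' hi

theorem WordSortable.of_mem {i : B} {l : List B} {v : W} (h : cs.WordSortable (i :: l) v)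
    (hi : M.simpleRoot i ∈ cs.inversions v) : cs.WordSortable (l ++ [i]) (cs.simple i * v) := by
  cases h with
  | skip h' _ => exact absurd hi h'
  | use _ h => exact h

theorem WordSortable.supportedOn {l : List B} {v : W} (h : cs.WordSortable l v) :
    ∀ β ∈ cs.inversions v, SupportedOn l β := by
  induction h with
  | nil => intro β hβ; simp [inversions_one] at hβ
  | skip _ _ ih => exact fun β hβ j hj => ih β hβ j fun h => hj (by simp [h])
  | @use i l v hi _ ih =>
    intro β hβ
    rcases (cs.mem_inversions_iff_of_simpleRoot_mem hi).1 hβ with rfl | hβ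
    · exact M.supportedOn_simpleRoot (by simp)
    · have := cs.supportedOn_geomRep_simple (i := i) (by simp) (ih _ hβ).cons
      rwa [geomRep_simple_simple] at this

theorem WordSortable.simpleRoot_not_mem {l : List B} {v : W} (h : cs.WordSortable l v) {i : B}
    (hi : i ∉ l) : M.simpleRoot i ∉ cs.inversions v := fun h' => by
  have := h.supportedOn _ h' i hi
  rw [simpleRoot_apply_self] at this
  exact one_ne_zero this

/-- With the converse below, this makes sortability a condition on the skew form restricted to the
inversions. Deleting an unused letter does not change that form, because the inversions have zero
coordinate there. -/
theorem WordSortable.aligned {l : List B} (hl : l.Nodup) {v : W} (h : cs.WordSortable l v) :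
    cs.Aligned l v := by
  induction h with
  | nil => exact .one
  | @skip i l v hi h ih =>
    rw [List.nodup_cons] at hl
    refine (ih hl.2).congr fun β hβ γ hγ => ?_
    have h1 := h.supportedOn β hβ i hl.1
    have h2 := h.supportedOn γ hγ i hl.1
    simp [skewForm, h1, h2]
  | @use i l v hi h ih =>
    have hl' : (l ++ [i]).Nodup := by rw [List.nodup_append_comm]; exact hl
    have := (ih hl').simple_mul hl (by rwa [cs.simpleRoot_mem_inversions_simple_mul, not_not])
      fun β hβ => (h.supportedOn β hβ).cons
    rwa [cs.simple_mul_simple_cancel_left] at this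

theorem Aligned.wordSortable {l : List B} (hl : l.Nodup) {v : W} (h : cs.Aligned l v)
    (hs : ∀ β ∈ cs.inversions v, SupportedOn l β) : cs.WordSortable l v := by
  -- Using a letter shortens v and keeps the length of the word; skipping a letter shortens the
  -- word.
  induction hn : cs.length v + l.length using Nat.strong_induction_on generalizing l v with
  | _ n ih =>
  subst hn
  cases l with
  | nil =>
    have : v = 1 := by
      by_contra hv
      obtain ⟨i, hi⟩ := cs.exists_simpleRoot_mem_inversions hv
      have := hs _ hi i (by simp)
      rw [simpleRoot_apply_self] at this
      exact one_ne_zero this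
    rw [this]
    exact .nil
  | cons i l =>
    by_cases hi : M.simpleRoot i ∈ cs.inversions v
    · refine .use hi ?_
      have hlt := cs.simpleRoot_mem_inversions.1 hi
      refine ih _ (by simpa using hlt) (by rw [List.nodup_append_comm]; exact hl)
        (h.simple_mul_of_mem hl hi hs) (fun β hβ => ?_) rfl
      have h1 : cs.geomRep (cs.simple i) β ∈ cs.inversions v :=
        (cs.mem_inversions_iff_of_simpleRoot_mem hi).2 (Or.inr (by rwa [geomRep_simple_simple]))
      have := cs.supportedOn_geomRep_simple (i := i) (by simp) (hs _ h1)
      rw [geomRep_simple_simple] at this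
      exact this.append_singleton
    · have h0 := h.apply_eq_zero hl hi hs
      refine .skip hi (ih _ (by simp) (List.nodup_cons.1 hl).2 ?_ ?_ rfl)
      · refine h.congr fun β hβ γ hγ => ?_
        simp [skewForm, h0 β hβ, h0 γ hγ]
      · intro β hβ j hj
        by_cases hji : j = i
        · rw [hji, h0 β hβ]
        · exact hs β hβ j (by simp [hj, hji])

end CoxeterSystem

/-! ### Change of word, projection and rank two -/

namespace CoxeterSystem

open CoxeterMatrix

variable {B : Type*} {M : CoxeterMatrix B} {W : Type*} [Group W] {cs : CoxeterSystem M W}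

theorem cartanRow_eq_of_sublist {l l' : List B} (h : l.Sublist l') (hl : l'.Nodup) (i : B)
    {x : B →₀ ℝ} (hx : ∀ j ∈ l', j ∉ l → x j = 0) : M.cartanRow i l' x = M.cartanRow i l x := by
  induction h with
  | slnil => rfl
  | @cons l l' a h ih =>
    rw [List.nodup_cons] at hl
    rw [cartanRow_cons, ih hl.2 fun j hj => hx j (by simp [hj]),
      hx a (by simp) fun ha => hl.1 (h.subset ha), mul_zero, zero_add]
  | @cons_cons l l' a h ih =>
    rw [List.nodup_cons] at hl
    rw [cartanRow_cons, cartanRow_cons, ih hl.2 fun j hj hj' => hx j (by simp [hj]) fun hja => ?_]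
    rcases List.mem_cons.1 hja with rfl | hja
    · exact hl.1 hj
    · exact hj' hja

theorem eulerForm_eq_of_sublist {l l' : List B} (h : l.Sublist l') (hl : l'.Nodup)
    {x y : B →₀ ℝ} (hx : ∀ j ∈ l', j ∉ l → x j = 0) (hy : ∀ j ∈ l', j ∉ l → y j = 0) :
    M.eulerForm l' x y = M.eulerForm l x y := by
  induction h with
  | slnil => rfl
  | @cons l l' a h ih =>
    rw [List.nodup_cons] at hl
    rw [eulerForm_cons, ih hl.2 (fun j hj => hx j (by simp [hj])) fun j hj => hy j (by simp [hj]),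
      hx a (by simp) fun ha => hl.1 (h.subset ha), zero_mul, zero_add]
  | @cons_cons l l' a h ih =>
    rw [List.nodup_cons] at hl
    have hmem : ∀ j ∈ l', j ∉ l → j ∉ a :: l := by
      intro j hj hj' hja
      rcases List.mem_cons.1 hja with rfl | hja
      · exact hl.1 hj
      · exact hj' hja
    rw [eulerForm_cons, eulerForm_cons,
      ih hl.2 (fun j hj hj' => hx j (by simp [hj]) (hmem j hj hj'))
        fun j hj hj' => hy j (by simp [hj]) (hmem j hj hj'),
      cartanRow_eq_of_sublist h hl.2 a fun j hj hj' => hy j (by simp [hj]) (hmem j hj hj')]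

/-- Alignment depends only on the Euler form on the inversions, whose coordinates at the additional
letters are zero. -/
theorem WordSortable.of_sublist {l l' : List B} (h : l.Sublist l') (hl : l'.Nodup) {v : W}
    (hv : cs.WordSortable l v) : cs.WordSortable l' v := by
  refine Aligned.wordSortable hl ((hv.aligned (hl.sublist h)).congr fun β hβ γ hγ => ?_)
    fun β hβ j hj => hv.supportedOn β hβ j fun h' => hj (h.subset h')
  rw [skewForm, skewForm,
    eulerForm_eq_of_sublist h hl (fun j _ => hv.supportedOn γ hγ j)
      fun j _ => hv.supportedOn β hβ j,
    eulerForm_eq_of_sublist h hl (fun j _ => hv.supportedOn β hβ j)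
      fun j _ => hv.supportedOn γ hγ j]

theorem wordSortable_simple {i : B} {l : List B} (hi : i ∈ l) (hl : l.Nodup) :
    cs.WordSortable l (cs.simple i) := by
  refine WordSortable.of_sublist (List.singleton_sublist.2 hi) hl (.use ?_ ?_)
  · rw [inversions_simple]; rfl
  · rw [cs.simple_mul_simple_self]
    exact cs.wordSortable_one _

theorem WordSortable.parabolicProj {l : List B} {s : B} (hl : (l ++ [s]).Nodup) {x : W}
    (h : cs.WordSortable (l ++ [s]) x) : cs.WordSortable l (cs.parabolicProj {s}ᶜ x) := by
  have h0 : ∀ β ∈ cs.inversions (cs.parabolicProj {s}ᶜ x), β s = 0 := fun β hβ =>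
    (cs.mem_inversions_parabolicProj.1 hβ).2 s (by simp)
  refine Aligned.wordSortable (hl.sublist (List.sublist_append_left _ _))
    (((h.aligned hl).parabolicProj _).congr fun β hβ γ hγ => ?_) fun β hβ j hj => ?_
  · simp [skewForm, eulerForm_append_singleton, h0 β hβ, h0 γ hγ]
  · by_cases hjs : j = s
    · rw [hjs, h0 β hβ]
    · exact h.supportedOn β (cs.mem_inversions_parabolicProj.1 hβ).1 j (by simp [hj, hjs])

theorem WordSortable.final_simple_mul {l : List B} {s : B} (hl : (l ++ [s]).Nodup) {z : W}
    (h : cs.WordSortable (l ++ [s]) z) (hs : M.simpleRoot s ∈ cs.inversions z) :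
    cs.WordSortable (l ++ [s]) (cs.simple s * z) ∧
      ∀ β, β ∈ cs.inversions z ↔ β = M.simpleRoot s ∨ β ∈ cs.inversions (cs.simple s * z) := by
  obtain ⟨h1, h2⟩ := (h.aligned hl).final_simple_mul hl hs h.supportedOn
  exact ⟨h1.wordSortable hl fun β hβ => h.supportedOn β ((h2 β).2 (Or.inr hβ)), h2⟩

theorem WeakLE.simple_mul_of_mem {x z : W} {i : B} (h : cs.WeakLE x z)
    (hi : M.simpleRoot i ∈ cs.inversions x) :
    cs.WeakLE (cs.simple i * x) (cs.simple i * z) := by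
  rw [weakLE_iff]
  intro β hβ
  have hne : β ≠ M.simpleRoot i := by
    rintro rfl
    exact cs.simpleRoot_mem_inversions_simple_mul.1 hβ hi
  rw [cs.mem_inversions_simple_mul hne] at hβ ⊢
  exact ⟨h.inversions_subset hβ.1, hβ.2⟩

/-- Left multiplication by s_i is an isomorphism from the elements above s_i to those not above it.
An upper bound of s_i x and s_i y may lie above s_i, but their join lies below s_i z and so does
not. -/
theorem IsWeakJoin.simple_mul {x y z : W} {i : B} (h : cs.IsWeakJoin x y z)
    (hx : M.simpleRoot i ∈ cs.inversions x) (hy : M.simpleRoot i ∈ cs.inversions y) :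
    cs.IsWeakJoin (cs.simple i * x) (cs.simple i * y) (cs.simple i * z) := by
  have hxz := h.1.simple_mul_of_mem hx
  have hyz := h.2.1.simple_mul_of_mem hy
  have hz : M.simpleRoot i ∈ cs.inversions z := h.1.inversions_subset hx
  refine ⟨hxz, hyz, fun u hxu hyu => ?_⟩
  obtain ⟨j, hj1, hj2, hj3⟩ := cs.exists_isWeakJoin hxz hyz
  refine WeakLE.trans ?_ (hj3 u hxu hyu)
  have hij : M.simpleRoot i ∉ cs.inversions j := fun h' =>
    cs.simpleRoot_mem_inversions_simple_mul.1 ((hj3 _ hxz hyz).inversions_subset h') hz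
  have h1 := hj1.simple_mul hij
  have h2 := hj2.simple_mul hij
  rw [cs.simple_mul_simple_cancel_left] at h1 h2
  have := (h.2.2 _ h1 h2).simple_mul_of_mem hz
  rwa [cs.simple_mul_simple_cancel_left] at this

/-- The only possible left descent is s; after removing it s is no longer a descent, and the roles
of s and r are exchanged. -/
theorem wordSortable_pair {r s : B} {u : W}
    (hu : ∀ β ∈ cs.inversions u, SupportedOn [s, r] β) (hr : M.simpleRoot r ∉ cs.inversions u) :
    cs.WordSortable [s, r] u := by
  induction hn : cs.length u using Nat.strong_induction_on generalizing u r s with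
  | _ n ih =>
  subst hn
  by_cases h1 : u = 1
  · rw [h1]; exact cs.wordSortable_one _
  obtain ⟨k, hk⟩ := cs.exists_simpleRoot_mem_inversions h1
  have hks : k = s := by
    by_contra hks
    by_cases hkr : k = r
    · exact hr (hkr ▸ hk)
    · have := hu _ hk k (by simp [hks, hkr])
      rw [simpleRoot_apply_self] at this
      exact one_ne_zero this
  subst hks
  refine .use hk (ih _ (cs.simpleRoot_mem_inversions.1 hk) (fun β hβ => ?_) ?_ rfl)
  · have h2 : cs.geomRep (cs.simple k) β ∈ cs.inversions u :=
      (cs.mem_inversions_iff_of_simpleRoot_mem hk).2 (Or.inr (by rwa [geomRep_simple_simple]))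
    have := cs.supportedOn_geomRep_simple (i := k) (by simp) (hu _ h2)
    rw [geomRep_simple_simple] at this
    exact this.append_singleton
  · rw [cs.simpleRoot_mem_inversions_simple_mul, not_not]
    exact hk

/-! ### Joins of sortable elements -/

section Join

variable {n : ℕ} (hP : ∀ (l : List B) (x y z : W), l.Nodup → cs.IsWeakJoin x y z →
    cs.length z < n → cs.WordSortable l x → cs.WordSortable l y → cs.WordSortable l z)

include hP

/-- Here `hP` is the induction hypothesis of `WordSortable.join`. If the first letter r is not below
v, it is not below s ∨ v either and is skipped. Otherwise z = v ∨ (r ∨ s), and dividing by r gives a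
shorter join of r v and a rank two element. -/
theorem WordSortable.join_final_of {s : B} {l : List B} {v z : W} (hl : (l ++ [s]).Nodup)
    (hz : cs.IsWeakJoin (cs.simple s) v z) (hn : cs.length z ≤ n) (hv : cs.WordSortable l v) :
    cs.WordSortable (l ++ [s]) z := by
  induction l generalizing v with
  | nil =>
    have h1 : v = 1 := by cases hv; rfl
    have h2 : z = cs.simple s := by
      refine WeakLE.antisymm cs (hz.2.2 _ (cs.weakLE_refl _) ?_) hz.1
      rw [h1]
      exact cs.weakLE_one _
    rw [h2]
    exact wordSortable_simple (by simp) hl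
  | cons r l ih =>
    rw [List.cons_append] at hl ⊢
    have hrs : r ≠ s := by
      rintro rfl
      simp at hl
    have hl' : (l ++ [s] ++ [r]).Nodup := by rw [List.nodup_append_comm]; exact hl
    by_cases hr : M.simpleRoot r ∈ cs.inversions v
    · obtain ⟨k, hk⟩ := cs.exists_isWeakJoin hz.1
        ((cs.simple_weakLE_iff).2 (hz.2.1.inversions_subset hr))
      have hrk : M.simpleRoot r ∈ cs.inversions k := (cs.simple_weakLE_iff).1 hk.2.1
      have hz' : cs.IsWeakJoin v k z :=
        ⟨hz.2.1, hk.2.2 _ hz.1 ((cs.simple_weakLE_iff).2 (hz.2.1.inversions_subset hr)),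
          fun u h1 h2 => hz.2.2 u (hk.1.trans h2) h1⟩
      -- The projection of k to the parabolic subgroup of s and r is already an upper bound of both,
      -- so k lies below it.
      have hks : ∀ β ∈ cs.inversions k, SupportedOn [s, r] β := by
        have hkp : cs.WeakLE k (cs.parabolicProj {i | i ∈ [s, r]} k) := by
          refine hk.2.2 _ ?_ ?_
          · rw [simple_weakLE_iff, mem_inversions_parabolicProj]
            exact ⟨(cs.simple_weakLE_iff).1 hk.1, M.supportedOn_simpleRoot (by simp)⟩
          · rw [simple_weakLE_iff, mem_inversions_parabolicProj]
            exact ⟨hrk, M.supportedOn_simpleRoot (by simp)⟩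
        exact fun β hβ => (cs.mem_inversions_parabolicProj.1 (hkp.inversions_subset hβ)).2
      have hrks : cs.WordSortable [s, r] (cs.simple r * k) := by
        refine wordSortable_pair (fun β hβ => ?_) ?_
        · have h2 : cs.geomRep (cs.simple r) β ∈ cs.inversions k :=
            (cs.mem_inversions_iff_of_simpleRoot_mem hrk).2
              (Or.inr (by rwa [geomRep_simple_simple]))
          have := cs.supportedOn_geomRep_simple (i := r) (by simp) (hks _ h2)
          rwa [geomRep_simple_simple] at this
        · rw [cs.simpleRoot_mem_inversions_simple_mul, not_not]
          exact hrk
      have hrz : M.simpleRoot r ∈ cs.inversions z := hz.2.1.inversions_subset hr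
      refine .use hrz (hP _ _ _ _ hl' (hz'.simple_mul hr hrk) ?_ ?_ ?_)
      · exact (cs.simpleRoot_mem_inversions.1 hrz).trans_le hn
      · refine (hv.of_mem hr).of_sublist ?_ hl'
        exact (List.sublist_append_left _ _).append (List.Sublist.refl _)
      · refine hrks.of_sublist ?_ hl'
        rw [List.append_assoc]
        exact List.sublist_append_right _ _
    · refine .skip (fun h => hr ?_) (ih (List.nodup_cons.1 hl).2 hz (hv.of_not_mem hr))
      refine cs.mem_inversions_of_isWeakJoin_simple (J := {s}ᶜ) (by simp) hz h ?_
      intro i hi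
      simp only [Set.mem_compl_iff, Set.mem_singleton_iff, not_not] at hi
      rw [hi, simpleRoot_apply_ne M hrs]

/-- With r moved to the end, z is sortable by the final case. Removing r from z keeps it sortable
for the same word, which is what the recursion with r in front demands. -/
theorem WordSortable.join_initial_of {r : B} {l : List B} {y z : W} (hl : (r :: l).Nodup)
    (hz : cs.IsWeakJoin (cs.simple r) y z) (hn : cs.length z ≤ n) (hy : cs.WordSortable l y) :
    cs.WordSortable (r :: l) z := by
  have hl' : (l ++ [r]).Nodup := by rw [List.nodup_append_comm]; exact hl
  have hrz := (cs.simple_weakLE_iff).1 hz.1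
  exact .use hrz ((WordSortable.join_final_of hP hl' hz hn hy).final_simple_mul hl' hrz).1

end Join

/-- Joins of sortable elements are sortable. -/
theorem WordSortable.join {l : List B} (hl : l.Nodup) {x y z : W} (hz : cs.IsWeakJoin x y z)
    (hx : cs.WordSortable l x) (hy : cs.WordSortable l y) : cs.WordSortable l z := by
  induction hn : cs.length z using Nat.strong_induction_on generalizing l x y z with
  | _ n ih =>
  subst hn
  have hP : ∀ (l : List B) (x y z' : W), l.Nodup → cs.IsWeakJoin x y z' →
      cs.length z' < cs.length z → cs.WordSortable l x → cs.WordSortable l y →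
      cs.WordSortable l z' := fun l x y z' hl hz' hlt hx hy => ih _ hlt hl hz' hx hy rfl
  clear ih
  induction l generalizing x y with
  | nil =>
    have h1 : x = 1 := by cases hx; rfl
    have h2 : y = 1 := by cases hy; rfl
    have h3 : z = 1 := by
      refine WeakLE.antisymm cs (hz.2.2 _ ?_ ?_) (cs.weakLE_one _)
      · rw [h1]; exact cs.weakLE_refl _
      · rw [h2]; exact cs.weakLE_refl _
    rw [h3]
    exact cs.wordSortable_one _
  | cons r l ih =>
    by_cases hr : M.simpleRoot r ∈ cs.inversions z
    -- Replacing x and y by r ∨ x and r ∨ y does not change the join z and puts both above r, so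
    -- that r can be divided out of the whole join.
    · have hup : ∀ w, cs.WeakLE w z → cs.WordSortable (r :: l) w → ∃ w',
          cs.IsWeakJoin (cs.simple r) w w' ∧ cs.WeakLE w' z ∧ cs.WordSortable (r :: l) w' := by
        intro w hw hws
        obtain ⟨w', hw'⟩ := cs.exists_isWeakJoin ((cs.simple_weakLE_iff).2 hr) hw
        have hle := hw'.2.2 _ ((cs.simple_weakLE_iff).2 hr) hw
        refine ⟨w', hw', hle, ?_⟩
        by_cases hrw : M.simpleRoot r ∈ cs.inversions w
        · have : w' = w := WeakLE.antisymm cs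
            (hw'.2.2 _ ((cs.simple_weakLE_iff).2 hrw) (cs.weakLE_refl _)) hw'.2.1
          rwa [this]
        · exact WordSortable.join_initial_of hP hl hw' hle.length_le (hws.of_not_mem hrw)
      obtain ⟨x', hx1, hx2, hx3⟩ := hup x hz.1 hx
      obtain ⟨y', hy1, hy2, hy3⟩ := hup y hz.2.1 hy
      have hz' : cs.IsWeakJoin x' y' z :=
        ⟨hx2, hy2, fun u h1 h2 => hz.2.2 u (hx1.2.1.trans h1) (hy1.2.1.trans h2)⟩
      have hrx := (cs.simple_weakLE_iff).1 hx1.1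
      have hry := (cs.simple_weakLE_iff).1 hy1.1
      exact .use hr (hP _ _ _ _ (by rw [List.nodup_append_comm]; exact hl)
        (hz'.simple_mul hrx hry) (cs.simpleRoot_mem_inversions.1 hr) (hx3.of_mem hrx)
        (hy3.of_mem hry))
    · refine .skip hr (ih (List.nodup_cons.1 hl).2 hz (hx.of_not_mem fun h => ?_)
        (hy.of_not_mem fun h => ?_))
      · exact hr (hz.1.inversions_subset h)
      · exact hr (hz.2.1.inversions_subset h)

/-- If `v` is sortable with respect to `l` and `s` is not a letter of `l`, then `s ∨ v` is sortable
with respect to the word `l` followed by `s`. -/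
theorem WordSortable.join_final {s : B} {l : List B} {v z : W} (hl : (l ++ [s]).Nodup)
    (hz : cs.IsWeakJoin (cs.simple s) v z) (hv : cs.WordSortable l v) :
    cs.WordSortable (l ++ [s]) z :=
  WordSortable.join_final_of (n := cs.length z) (fun _ _ _ _ hl hz _ hx hy => hx.join hl hz hy)
    hl hz le_rfl hv

/-! ### Cover reflections of sortable elements -/

/-- For a right descent p the reflection in the positive root -x α_p is a cover reflection of x. -/
theorem neg_geomRep_mem_inversions {x : W} {p : B}
    (hp : cs.length (x * cs.simple p) < cs.length x) :
    -cs.geomRep x (M.simpleRoot p) ∈ cs.inversions x := by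
  refine ⟨((cs.isRoot_simpleRoot p).geomRep x).neg,
    neg_nonneg.2 (cs.geomRep_simpleRoot_nonpos hp), ?_⟩
  rw [map_neg, geomRep_inv_self]
  exact neg_nonpos.2 (simpleRoot_nonneg M p)

theorem supportedOn_geomRep_of_descent {l : List B} {x : W} (h : cs.WordSortable l x) {p : B}
    (hp : cs.length (x * cs.simple p) < cs.length x) :
    SupportedOn l (cs.geomRep x (M.simpleRoot p)) := fun j hj => by
  have := h.supportedOn _ (neg_geomRep_mem_inversions hp) j hj
  rwa [Finsupp.neg_apply, neg_eq_zero] at this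

theorem simple_mul_descent {x : W} {r p : B} (hp : cs.length (x * cs.simple p) < cs.length x)
    (hne : cs.geomRep x (M.simpleRoot p) ≠ -M.simpleRoot r) :
    cs.length (cs.simple r * x * cs.simple p) < cs.length (cs.simple r * x) := by
  rw [← geomRep_simpleRoot_nonpos_iff, geomRep_mul]
  obtain ⟨h1, h2, -⟩ := neg_geomRep_mem_inversions hp
  have := h1.geomRep_simple_nonneg h2 (i := r) fun h => hne (by rw [← h, neg_neg])
  rw [map_neg] at this
  exact neg_nonneg.1 this

/-- Distinct cover reflections of a sortable element are orthogonal with respect to the Euler form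
in one of the two orders. -/
def CoversOrthogonal (M : CoxeterMatrix B) (cs : CoxeterSystem M W) (l : List B) (x : W) : Prop :=
  ∀ p q, p ≠ q → cs.length (x * cs.simple p) < cs.length x →
    cs.length (x * cs.simple q) < cs.length x →
    M.eulerForm l (cs.geomRep x (M.simpleRoot p)) (cs.geomRep x (M.simpleRoot q)) = 0 ∨
      M.eulerForm l (cs.geomRep x (M.simpleRoot q)) (cs.geomRep x (M.simpleRoot p)) = 0

/-- Skip letters until the first letter r is below x, then apply `hT` to s_r x and rotate back. If
E(x α_q, x α_p) = 0, the s-coordinate is 0 because s is final. In the other order, the negative of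
that coordinate equals the Cartan entry at (p, q), which is at most 0, while it is also a coordinate
of the positive root -x α_p. -/
theorem apply_eq_zero_of_final_cover {n : ℕ}
    (hT : ∀ (l : List B) (x : W), l.Nodup → cs.length x < n → cs.WordSortable l x →
      CoversOrthogonal M cs l x) {l : List B} {s : B} {x : W} (hl : (l ++ [s]).Nodup)
    (hn : cs.length x ≤ n) (hx : cs.WordSortable (l ++ [s]) x) {p q : B} (hpq : p ≠ q)
    (hq : cs.geomRep x (M.simpleRoot q) = -M.simpleRoot s)
    (hp : cs.length (x * cs.simple p) < cs.length x) :
    cs.geomRep x (M.simpleRoot p) s = 0 := by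
  have hqd : cs.length (x * cs.simple q) < cs.length x := by
    rw [← geomRep_simpleRoot_nonpos_iff, hq]
    exact neg_nonpos.2 (simpleRoot_nonneg M s)
  have hγ := neg_geomRep_mem_inversions hp
  induction l with
  | nil =>
    exfalso
    have h1 : -cs.geomRep x (M.simpleRoot p) = M.simpleRoot s :=
      hγ.1.eq_simpleRoot hγ.2.1 fun j hj => hx.supportedOn _ hγ j (by simpa using hj)
    rw [neg_eq_iff_eq_neg, ← hq] at h1
    exact hpq (simpleRoot_injective M ((cs.geomRep x).injective h1))
  | cons r l ih =>
    rw [List.cons_append] at hl hx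
    have hrs : r ≠ s := by
      rintro rfl
      simp at hl
    by_cases hr : M.simpleRoot r ∈ cs.inversions x
    · by_cases hpr : cs.geomRep x (M.simpleRoot p) = -M.simpleRoot r
      · rw [hpr, Finsupp.neg_apply, simpleRoot_apply_ne M hrs, neg_zero]
      have hqr : cs.geomRep x (M.simpleRoot q) ≠ -M.simpleRoot r := by
        rw [hq]
        exact fun h => hrs (simpleRoot_injective M (neg_injective h)).symm
      have hl' : (l ++ [s] ++ [r]).Nodup := by rw [List.nodup_append_comm]; exact hl
      have hlt := cs.simpleRoot_mem_inversions.1 hr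
      have h1 := hT _ _ hl' (hlt.trans_le hn) (hx.of_mem hr) p q hpq (simple_mul_descent hp hpr)
        (simple_mul_descent hqd hqr)
      have hsp := supportedOn_geomRep_of_descent hx hp
      have hsq := supportedOn_geomRep_of_descent hx hqd
      have hsp' := cs.supportedOn_geomRep_simple (i := r) (by simp) hsp
      have hsq' := cs.supportedOn_geomRep_simple (i := r) (by simp) hsq
      rw [geomRep_mul, geomRep_mul, ← cs.eulerForm_rotate hl hsp' hsq',
        ← cs.eulerForm_rotate hl hsq' hsp', geomRep_simple_simple, geomRep_simple_simple] at h1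
      have hl2 : (r :: l ++ [s]).Nodup := hl
      have h2 := M.eulerForm_simpleRoot_append hl2 (cs.geomRep x (M.simpleRoot p))
      have h3 : M.eulerForm (r :: (l ++ [s])) (cs.geomRep x (M.simpleRoot q))
          (cs.geomRep x (M.simpleRoot p)) = -cs.geomRep x (M.simpleRoot p) s := by
        rw [hq, map_neg, LinearMap.neg_apply]
        exact congrArg Neg.neg h2
      rcases h1 with h1 | h1
      · have h4 := M.eulerForm_add_eulerForm hl hsp hsq
        rw [h1, h3, cs.cartanForm_geomRep, M.cartanForm_simpleRoot] at h4
        have h5 := M.cartanEntry_nonpos hpq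
        have h6 : 0 ≤ (-cs.geomRep x (M.simpleRoot p)) s := hγ.2.1 s
        rw [Finsupp.neg_apply] at h6
        linarith
      · linarith
    · exact ih (List.nodup_cons.1 hl).2 (hx.of_not_mem hr)

/-- If α_r is not one of the two cover roots, rotation reduces the claim to s_r x. If it is, then x
= r ∨ s_r x is also sortable with r at the end of the word, so the other cover root has zero
r-coordinate, and this coordinate is the Euler pairing with the initial root α_r up to sign. -/
theorem WordSortable.coversOrthogonal {l : List B} (hl : l.Nodup) {x : W}
    (hx : cs.WordSortable l x) : CoversOrthogonal M cs l x := by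
  induction hn : cs.length x using Nat.strong_induction_on generalizing l x with
  | _ n ih =>
  subst hn
  have hT : ∀ (l : List B) (x' : W), l.Nodup → cs.length x' < cs.length x →
      cs.WordSortable l x' → CoversOrthogonal M cs l x' :=
    fun l x' hl hlt hx' => ih _ hlt hl hx' rfl
  clear ih
  induction l with
  | nil =>
    have h1 : x = 1 := by cases hx; rfl
    intro p q _ hp
    simp [h1] at hp
  | cons r l ih =>
    by_cases hr : M.simpleRoot r ∈ cs.inversions x
    · have hl' : (l ++ [r]).Nodup := by rw [List.nodup_append_comm]; exact hl
      have hlt := cs.simpleRoot_mem_inversions.1 hr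
      have key : ∀ p q, p ≠ q → cs.geomRep x (M.simpleRoot q) = -M.simpleRoot r →
          cs.length (x * cs.simple p) < cs.length x →
          M.eulerForm (r :: l) (cs.geomRep x (M.simpleRoot p)) (cs.geomRep x (M.simpleRoot q))
            = 0 := by
        intro p q hpq hq hp
        have h1 : cs.geomRep (x * cs.simple q) (M.simpleRoot q) = M.simpleRoot r := by
          rw [geomRep_mul, geomRep_simple_self, map_neg, hq, neg_neg]
        have h2 := cs.mul_simple_eq_simple_mul h1
        rw [cs.simple_mul_simple_cancel_right] at h2
        have h3 : cs.length (x * cs.simple q) < cs.length (x * cs.simple q * cs.simple q) := by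
          rw [← geomRep_simpleRoot_nonneg_iff, h1]
          exact simpleRoot_nonneg M r
        have h4 : cs.simple r * x = x * cs.simple q := by
          conv_lhs => rw [h2]
          rw [cs.simple_mul_simple_cancel_left]
        have hj : cs.IsWeakJoin (cs.simple r) (cs.simple r * x) x := by
          have hinv : ∀ β, β ∈ cs.inversions x ↔
              β = M.simpleRoot r ∨ β ∈ cs.inversions (cs.simple r * x) := fun β => by
            have := cs.mem_inversions_mul_simple h3 (β := β)
            rwa [cs.simple_mul_simple_cancel_right, h1, ← h4] at this
          refine ⟨(cs.simple_weakLE_iff).2 hr, ?_, fun u hu1 hu2 => ?_⟩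
          · rw [weakLE_iff]
            exact fun β hβ => (hinv β).2 (Or.inr hβ)
          · rw [weakLE_iff]
            intro β hβ
            rcases (hinv β).1 hβ with rfl | hβ
            · exact (cs.simple_weakLE_iff).1 hu1
            · exact hu2.inversions_subset hβ
        have hxs : cs.WordSortable (l ++ [r]) x :=
          WordSortable.join hl' hj (wordSortable_simple (by simp) hl') (hx.of_mem hr)
        rw [hq, map_neg, M.eulerForm_simpleRoot_cons hl,
          apply_eq_zero_of_final_cover hT hl' le_rfl hxs hpq hq hp, neg_zero]
      intro p q hpq hp hq
      by_cases hpr : cs.geomRep x (M.simpleRoot p) = -M.simpleRoot r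
      · exact Or.inr (key q p hpq.symm hpr hq)
      by_cases hqr : cs.geomRep x (M.simpleRoot q) = -M.simpleRoot r
      · exact Or.inl (key p q hpq hqr hp)
      have h1 := hT _ _ hl' hlt (hx.of_mem hr) p q hpq (simple_mul_descent hp hpr)
        (simple_mul_descent hq hqr)
      have hsp := cs.supportedOn_geomRep_simple (i := r) (by simp)
        (supportedOn_geomRep_of_descent hx hp)
      have hsq := cs.supportedOn_geomRep_simple (i := r) (by simp)
        (supportedOn_geomRep_of_descent hx hq)
      rwa [geomRep_mul, geomRep_mul, ← cs.eulerForm_rotate hl hsp hsq,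
        ← cs.eulerForm_rotate hl hsq hsp, geomRep_simple_simple, geomRep_simple_simple] at h1
    · have hx' := hx.of_not_mem hr
      intro p q hpq hp hq
      have hrl := (List.nodup_cons.1 hl).1
      have h1 := supportedOn_geomRep_of_descent hx' hp r hrl
      have h2 := supportedOn_geomRep_of_descent hx' hq r hrl
      have := ih (List.nodup_cons.1 hl).2 hx' p q hpq hp hq
      simpa [h1, h2] using this

/-- If `x` is sortable with respect to a word ending in `s` and `x ≥ s`, then `x` is the join of
`s` and the projection of `x` to the parabolic subgroup generated by the other generators. -/
theorem WordSortable.isWeakJoin_parabolicProj {l : List B} {s : B} (hl : (l ++ [s]).Nodup) {x : W}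
    (hx : cs.WordSortable (l ++ [s]) x) (hs : M.simpleRoot s ∈ cs.inversions x) :
    cs.IsWeakJoin (cs.simple s) (cs.parabolicProj {s}ᶜ x) x := by
  have hpx : cs.WeakLE (cs.parabolicProj {s}ᶜ x) x := by
    rw [weakLE_iff]
    exact fun β hβ => (cs.mem_inversions_parabolicProj.1 hβ).1
  obtain ⟨y, hy⟩ := cs.exists_isWeakJoin ((cs.simple_weakLE_iff).2 hs) hpx
  have hyx := hy.2.2 _ ((cs.simple_weakLE_iff).2 hs) hpx
  by_cases hne : y = x
  · exact hne ▸ hy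
  exfalso
  have hroot : ∀ {u : W} {p : B}, x = u * cs.simple p → cs.length u < cs.length x →
      cs.geomRep u (M.simpleRoot p) ∈ cs.inversions x ∧
      cs.geomRep x (M.simpleRoot p) = -cs.geomRep u (M.simpleRoot p) := by
    rintro u p rfl hlt
    exact ⟨geomRep_mem_inversions_mul_simple hlt, by
      rw [geomRep_mul, geomRep_simple_self, map_neg]⟩
  obtain ⟨-, hinv⟩ := hx.final_simple_mul hl hs
  have hsx : cs.WeakLE (cs.simple s * x) x := by
    rw [weakLE_iff]
    exact fun β hβ => (hinv β).2 (Or.inr hβ)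
  -- The inversions of x are α_s and those of s x, so a cover of x above s x shows that α_s is a
  -- cover root of x.
  obtain ⟨u, q, hu1, hu2, hu3⟩ := cs.exists_cover_of_weakLE hsx fun h => by
    have := cs.simpleRoot_mem_inversions.1 hs
    rw [h] at this
    exact lt_irrefl _ this
  obtain ⟨hq1, hq2⟩ := hroot hu1 hu2
  have hq : cs.geomRep u (M.simpleRoot q) = M.simpleRoot s :=
    ((hinv _).1 hq1).resolve_right fun h =>
      cs.geomRep_simpleRoot_not_mem_inversions u q (hu3.inversions_subset h)
  -- If the join y were smaller than x, some cover root of x would be missing from y. It is not α_s,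
  -- so its s-coordinate is 0 and it is an inversion of x_⟨s⟩ ≤ y.
  obtain ⟨v, p, hv1, hv2, hv3⟩ := cs.exists_cover_of_weakLE hyx hne
  obtain ⟨hp1, hp2⟩ := hroot hv1 hv2
  have hnot : cs.geomRep v (M.simpleRoot p) ∉ cs.inversions y := fun h =>
    cs.geomRep_simpleRoot_not_mem_inversions v p (hv3.inversions_subset h)
  have hpq : p ≠ q := by
    rintro rfl
    rw [hp2, hq, neg_inj] at hq2
    exact hnot (hq2 ▸ (cs.simple_weakLE_iff).1 hy.1)
  have hlt : cs.length (x * cs.simple p) < cs.length x := by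
    rw [hv1, cs.simple_mul_simple_cancel_right, ← hv1]
    exact hv2
  have h0 := apply_eq_zero_of_final_cover (n := cs.length x)
    (fun l x hl _ hx => hx.coversOrthogonal hl) hl le_rfl hx hpq (hq2.trans (by rw [hq])) hlt
  rw [hp2, Finsupp.neg_apply, neg_eq_zero] at h0
  refine hnot (hy.2.1.inversions_subset (cs.mem_inversions_parabolicProj.2 ⟨hp1, ?_⟩))
  intro i hi
  simp only [Set.mem_compl_iff, Set.mem_singleton_iff, not_not] at hi
  rw [hi, h0]

end CoxeterSystem

namespace CoxeterSystem

open CoxeterMatrix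

variable {B : Type*} {M : CoxeterMatrix B} {W : Type*} [Group W] (cs : CoxeterSystem M W)

/-! ### Words without repetitions -/

theorem geomRep_wordProd_apply {ω : List B} {j : B} (hj : j ∉ ω) (x : B →₀ ℝ) :
    cs.geomRep (cs.wordProd ω) x j = x j := by
  induction ω with
  | nil => simp
  | cons i ω ih =>
    simp only [List.mem_cons, not_or] at hj
    rw [wordProd_cons, geomRep_mul, cs.geomRep_simple_apply_ne (Ne.symm hj.1), ih hj.2]

theorem geomRep_wordProd_inv_apply {ω : List B} {j : B} (hj : j ∉ ω) (x : B →₀ ℝ) :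
    cs.geomRep (cs.wordProd ω)⁻¹ x j = x j := by
  rw [← wordProd_reverse]
  exact cs.geomRep_wordProd_apply (by simpa using hj) x

theorem simpleRoot_mem_inversions_wordProd_cons {j : B} {ω : List B} (hj : j ∉ ω) :
    M.simpleRoot j ∈ cs.inversions (cs.wordProd (j :: ω)) := by
  rw [wordProd_cons, simpleRoot_mem_inversions_simple_mul]
  refine not_mem_inversions (((cs.isRoot_simpleRoot j).geomRep _).nonneg_of_apply_pos (i := j) ?_)
  rw [cs.geomRep_wordProd_inv_apply hj, simpleRoot_apply_self]
  exact one_pos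

theorem isReduced_of_nodup {ω : List B} (h : ω.Nodup) : cs.IsReduced ω := by
  induction ω with
  | nil => simp [IsReduced]
  | cons j ω ih =>
    rw [List.nodup_cons] at h
    have h1 := cs.simpleRoot_mem_inversions.1 (cs.simpleRoot_mem_inversions_wordProd_cons h.1)
    have h2 := (ih h.2).eq
    have h3 := cs.length_wordProd_le (j :: ω)
    rw [wordProd_cons, cs.simple_mul_simple_cancel_left, ← wordProd_cons] at h1
    rw [IsReduced]
    rw [List.length_cons] at h3 ⊢
    omega

/-- Write ω = a j d. On the vector d⁻¹α_j the first word turns the j-coordinate 1 into -1, whereas a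
word without j leaves it unchanged. -/
theorem mem_of_wordProd_eq {ω ω' : List B} (h : ω.Nodup) (heq : cs.wordProd ω = cs.wordProd ω')
    {j : B} (hj : j ∈ ω) : j ∈ ω' := by
  by_contra hj'
  obtain ⟨a, d, rfl⟩ := List.append_of_mem hj
  have hja : j ∉ a := fun h' => by
    rw [List.nodup_append_comm] at h
    exact (List.nodup_cons.1 h).1 (by simp [h'])
  have hjd : j ∉ d := fun h' => by
    rw [List.nodup_append_comm] at h
    exact (List.nodup_cons.1 h).1 (by simp [h'])
  have h1 := cs.geomRep_wordProd_apply hj' (cs.geomRep (cs.wordProd d)⁻¹ (M.simpleRoot j))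
  rw [← heq, wordProd_append, wordProd_cons, geomRep_mul, geomRep_mul, geomRep_self_inv,
    geomRep_simple_self, cs.geomRep_wordProd_apply hja, cs.geomRep_wordProd_inv_apply hjd,
    Finsupp.neg_apply, simpleRoot_apply_self] at h1
  norm_num at h1

/-- Moving the first letter a to the other side leaves -A_{ai} as the a-coordinate, which the
remaining letters cannot produce. -/
theorem cartanEntry_eq_zero_of_wordProd_fixes {ω : List B} (h : ω.Nodup) {i : B} (hi : i ∉ ω)
    (hfix : cs.geomRep (cs.wordProd ω) (M.simpleRoot i) = M.simpleRoot i) :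
    ∀ a ∈ ω, M.cartanEntry a i = 0 := by
  induction ω with
  | nil => simp
  | cons a ω ih =>
    rw [List.nodup_cons] at h
    simp only [List.mem_cons, not_or] at hi
    rw [wordProd_cons, geomRep_mul] at hfix
    have h1 : cs.geomRep (cs.wordProd ω) (M.simpleRoot i) =
        M.simpleRoot i - M.cartanEntry a i • M.simpleRoot a := by
      rw [← cs.geomRep_simple_simpleRoot, ← cs.geomRep_simple_simple a
        (cs.geomRep (cs.wordProd ω) (M.simpleRoot i)), hfix]
    have h2 := cs.geomRep_wordProd_apply h.1 (M.simpleRoot i)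
    have h3 : M.cartanEntry a i = 0 := by
      rw [h1] at h2
      simpa [simpleRoot_apply_self] using h2
    rw [h3, zero_smul, sub_zero] at h1
    intro b hb
    rcases List.mem_cons.1 hb with rfl | hb
    · exact h3
    · exact ih h.2 hi.2 h1 b hb

theorem cartanRow_perm {l l' : List B} (h : l.Perm l') (i : B) (x : B →₀ ℝ) :
    M.cartanRow i l x = M.cartanRow i l' x := by
  induction h with
  | nil => rfl
  | cons j _ ih => simp [ih]
  | swap j k l => simp only [cartanRow_cons]; ring
  | trans _ _ h1 h2 => rw [h1, h2]

theorem eulerForm_append_cons {a d : List B} {i : B} (ha : ∀ k ∈ a, M.cartanEntry k i = 0)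
    (x y : B →₀ ℝ) :
    M.eulerForm (a ++ i :: d) x y = M.eulerForm (i :: (a ++ d)) x y := by
  induction a with
  | nil => rfl
  | cons k a ih =>
    have h1 : M.cartanRow k (a ++ i :: d) y = M.cartanRow k (a ++ d) y := by
      rw [cartanRow_perm (M := M) (List.perm_middle (a := i) (l₁ := a) (l₂ := d)) k y,
        cartanRow_cons, ha k (by simp), zero_mul, zero_add]
    rw [List.cons_append, eulerForm_cons, ih fun k hk => ha k (by simp [hk]), h1]
    simp only [List.cons_append, eulerForm_cons, cartanRow_cons, M.cartanEntry_comm i k,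
      ha k (by simp)]
    ring

/-- Two words without repetitions for the same element have the same letters and the same Euler
form. -/
theorem perm_and_eulerForm_eq_of_wordProd_eq {l l' : List B} (hl : l.Nodup) (hl' : l'.Nodup)
    (h : cs.wordProd l = cs.wordProd l') :
    l.Perm l' ∧ ∀ x y, M.eulerForm l x y = M.eulerForm l' x y := by
  induction l generalizing l' with
  | nil =>
    cases l' with
    | nil => exact ⟨.nil, fun _ _ => rfl⟩
    | cons j l' => exact absurd (cs.mem_of_wordProd_eq hl' h.symm (j := j) (by simp)) (by simp)
  | cons i l ih =>
    have hil := List.nodup_cons.1 hl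
    have hneg := (cs.simpleRoot_mem_inversions_wordProd_cons hil.1).2.2
    rw [h] at hneg
    obtain ⟨a, d, rfl⟩ := List.append_of_mem (cs.mem_of_wordProd_eq hl h (j := i) (by simp))
    have hmid := (List.perm_middle (a := i) (l₁ := a) (l₂ := d)).nodup_iff.1 hl'
    rw [List.nodup_cons, List.mem_append, not_or] at hmid
    obtain ⟨⟨hia, hid⟩, had⟩ := hmid
    have hdisj := List.disjoint_of_nodup_append had
    set δ := cs.geomRep (cs.wordProd a)⁻¹ (M.simpleRoot i) with hδ
    have hδr : cs.IsRoot δ := (cs.isRoot_simpleRoot i).geomRep _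
    have hδ0 : 0 ≤ δ := hδr.nonneg_of_apply_pos (i := i) (by
      rw [hδ, cs.geomRep_wordProd_inv_apply hia, simpleRoot_apply_self]; exact one_pos)
    -- The inverse of the whole word makes α_i negative, and beyond a⁻¹ it does not touch the
    -- coordinates at letters of a. So these coordinates of the positive root δ are 0, and i
    -- commutes with all letters of a.
    have hδi : δ = M.simpleRoot i := by
      refine hδr.eq_simpleRoot hδ0 fun j hj => ?_
      by_cases hja : j ∈ a
      · refine le_antisymm ?_ (hδ0 j)
        have := hneg j
        rw [wordProd_append, wordProd_cons, mul_inv_rev, mul_inv_rev, geomRep_mul, geomRep_mul,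
          cs.geomRep_wordProd_inv_apply (hdisj hja), cs.inv_simple,
          cs.geomRep_simple_apply_ne (Ne.symm hj)] at this
        exact this
      · rw [hδ, cs.geomRep_wordProd_inv_apply hja, simpleRoot_apply_ne M (Ne.symm hj)]
    have hfix : cs.geomRep (cs.wordProd a) (M.simpleRoot i) = M.simpleRoot i := by
      conv_lhs => rw [← hδi, hδ, geomRep_self_inv]
    have hzero := cs.cartanEntry_eq_zero_of_wordProd_fixes
      (had.sublist (List.sublist_append_left _ _)) hia hfix
    have hcomm := cs.mul_simple_eq_simple_mul hfix
    have hprod : cs.wordProd l = cs.wordProd (a ++ d) := by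
      rw [wordProd_cons, wordProd_append, wordProd_cons, ← mul_assoc, hcomm, mul_assoc] at h
      rw [wordProd_append]
      exact mul_left_cancel h
    obtain ⟨hperm, heq⟩ := ih hil.2 had hprod
    refine ⟨(hperm.cons i).trans List.perm_middle.symm, fun x y => ?_⟩
    rw [eulerForm_append_cons hzero, eulerForm_cons, eulerForm_cons, heq,
      cartanRow_perm (M := M) hperm]

variable {cs} in
theorem WordSortable.of_wordProd_eq {l l' : List B} (hl : l.Nodup) (hl' : l'.Nodup)
    (h : cs.wordProd l = cs.wordProd l') {v : W} (hv : cs.WordSortable l v) :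
    cs.WordSortable l' v := by
  obtain ⟨h1, h2⟩ := cs.perm_and_eulerForm_eq_of_wordProd_eq hl hl' h
  refine Aligned.wordSortable hl' ((hv.aligned hl).congr fun β _ γ _ => ?_) fun β hβ j hj =>
    hv.supportedOn β hβ j fun h' => hj (h1.subset h')
  rw [skewForm, skewForm, h2, h2]

/-- Every letter must occur, and a reduced word is no longer than the given word with each letter
once. -/
theorem IsCoxeterElement.nodup_and_mem {c : W} (hc : cs.IsCoxeterElement c) {ω : List B}
    (hω : cs.IsReducedWordFor ω c) : ω.Nodup ∧ ∀ i, i ∈ ω := by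
  obtain ⟨ω₀, h1, h2, h3⟩ := hc
  have hmem : ∀ i, i ∈ ω := fun i =>
    cs.mem_of_wordProd_eq h1 (h3.trans hω.2.symm) (h2 i)
  refine ⟨?_, hmem⟩
  have hlen : ω.length ≤ ω₀.length := by
    rw [← hω.1.eq, hω.2, ← h3]
    exact cs.length_wordProd_le ω₀
  exact ((h1.subperm fun i _ => hmem i).perm_of_length_le hlen).nodup_iff.1 h1

/-! ### The greedy construction of sorting words -/

section Greedy

variable (ω : List B) (hω : ω ≠ [])

/-- The `n`-th position in `ω^∞`. -/
def nthPosition (n : ℕ) : Position ω :=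
  toLex (n / ω.length, ⟨n % ω.length, Nat.mod_lt _ (List.length_pos_iff.2 hω)⟩)

/-- The `n`-th letter of `ω^∞`. -/
def nthLetter (n : ℕ) : B :=
  ω.get ⟨n % ω.length, Nat.mod_lt _ (List.length_pos_iff.2 hω)⟩

open Classical in
/-- The part of `v` that remains after using greedily the first `n` letters of `ω^∞`. -/
noncomputable def greedyRest (v : W) : ℕ → W
  | 0 => v
  | n + 1 =>
    if M.simpleRoot (nthLetter ω hω n) ∈ cs.inversions (greedyRest v n) then
      cs.simple (nthLetter ω hω n) * greedyRest v n
    else greedyRest v n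

/-- The greedy procedure uses the `n`-th letter of `ω^∞`. -/
def GreedyUses (v : W) (n : ℕ) : Prop :=
  M.simpleRoot (nthLetter ω hω n) ∈ cs.inversions (cs.greedyRest ω hω v n)

variable {ω hω}

theorem greedyRest_succ_of_uses {v : W} {n : ℕ} (h : cs.GreedyUses ω hω v n) :
    cs.greedyRest ω hω v (n + 1) = cs.simple (nthLetter ω hω n) * cs.greedyRest ω hω v n :=
  if_pos h

theorem greedyRest_succ_of_not_uses {v : W} {n : ℕ} (h : ¬ cs.GreedyUses ω hω v n) :
    cs.greedyRest ω hω v (n + 1) = cs.greedyRest ω hω v n :=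
  if_neg h

theorem length_greedyRest_succ_lt {v : W} {n : ℕ} (h : cs.GreedyUses ω hω v n) :
    cs.length (cs.greedyRest ω hω v (n + 1)) < cs.length (cs.greedyRest ω hω v n) := by
  rw [cs.greedyRest_succ_of_uses h]
  exact cs.simpleRoot_mem_inversions.1 h

theorem length_greedyRest_antitone (v : W) :
    Antitone fun n => cs.length (cs.greedyRest ω hω v n) := by
  refine antitone_nat_of_succ_le fun n => ?_
  by_cases h : cs.GreedyUses ω hω v n
  · exact (cs.length_greedyRest_succ_lt h).le
  · rw [cs.greedyRest_succ_of_not_uses h]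

theorem greedyRest_eq_one_of_le {v : W} {n m : ℕ} (h : cs.greedyRest ω hω v n = 1) (hnm : n ≤ m) :
    cs.greedyRest ω hω v m = 1 := by
  have := cs.length_greedyRest_antitone (ω := ω) (hω := hω) v hnm
  simp only [h, length_one, Nat.le_zero] at this
  exact cs.length_eq_zero_iff.1 this

theorem not_greedyUses_of_le {v : W} {n m : ℕ} (h : cs.greedyRest ω hω v n = 1) (hnm : n ≤ m) :
    ¬ cs.GreedyUses ω hω v m := by
  rw [GreedyUses, cs.greedyRest_eq_one_of_le h hnm, inversions_one]
  exact Set.notMem_empty _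

theorem nthLetter_add (n : ℕ) : nthLetter ω hω (n + ω.length) = nthLetter ω hω n := by
  simp [nthLetter]

theorem exists_nthLetter_eq {i : B} (hi : i ∈ ω) (n : ℕ) : ∃ m, n ≤ m ∧ nthLetter ω hω m = i := by
  obtain ⟨j, hj, rfl⟩ := List.getElem_of_mem hi
  have hpos := List.length_pos_iff.2 hω
  refine ⟨n * ω.length + j, ?_, ?_⟩
  · have := Nat.le_mul_of_pos_right n hpos
    omega
  · simp only [nthLetter, List.get_eq_getElem]
    congr 1
    rw [Nat.mul_add_mod_of_lt hj]

theorem exists_greedyRest_eq_one (hall : ∀ i, i ∈ ω) (v : W) :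
    ∃ n, cs.greedyRest ω hω v n = 1 := by
  have key : ∀ k n, cs.length (cs.greedyRest ω hω v n) = k → ∃ m, cs.greedyRest ω hω v m = 1 := by
    intro k
    induction k using Nat.strong_induction_on with
    | _ k ih =>
    rintro n rfl
    by_cases h1 : cs.greedyRest ω hω v n = 1
    · exact ⟨n, h1⟩
    obtain ⟨m, hnm, hm⟩ : ∃ m, n ≤ m ∧ cs.GreedyUses ω hω v m := by
      by_contra hcon
      push Not at hcon
      have hconst : ∀ d, cs.greedyRest ω hω v (n + d) = cs.greedyRest ω hω v n := by
        intro d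
        induction d with
        | zero => rfl
        | succ d ihd =>
          rw [← add_assoc, cs.greedyRest_succ_of_not_uses (hcon _ (by omega)), ihd]
      obtain ⟨i, hi⟩ := cs.exists_simpleRoot_mem_inversions h1
      obtain ⟨m, hnm, rfl⟩ := exists_nthLetter_eq (hω := hω) (hall i) n
      obtain ⟨d, rfl⟩ := Nat.exists_eq_add_of_le hnm
      exact hcon _ hnm (by rw [GreedyUses, hconst]; exact hi)
    exact ih _ ((cs.length_greedyRest_succ_lt hm).trans_le
      (cs.length_greedyRest_antitone v hnm)) (m + 1) rfl
  exact key _ 0 rfl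

theorem nthLetter_inj (hnd : ω.Nodup) {m n : ℕ} (h : nthLetter ω hω m = nthLetter ω hω n) :
    m % ω.length = n % ω.length := by
  have := (hnd.get_inj_iff).1 h
  simpa using this

theorem rotate_eq_cons (n : ℕ) :
    ∃ t, ω.rotate n = nthLetter ω hω n :: t ∧ ω.rotate (n + 1) = t ++ [nthLetter ω hω n] := by
  have hpos := List.length_pos_iff.2 hω
  cases hr : ω.rotate n with
  | nil => simp [List.rotate_eq_nil_iff, hω] at hr
  | cons i t =>
    have hi : i = nthLetter ω hω n := by
      have h1 : (ω.rotate n)[0]'(by simpa using hpos) = i := by simp [hr]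
      rw [← h1, List.getElem_rotate]
      simp [nthLetter]
    refine ⟨t, by rw [hi], ?_⟩
    rw [← List.rotate_rotate, hr, ← hi]
    simp

theorem greedyUses_of_add_mul {v : W} {n : ℕ}
    (h : ∀ m, n ≤ m → cs.GreedyUses ω hω v (m + ω.length) → cs.GreedyUses ω hω v m) (k : ℕ)
    (hk : cs.GreedyUses ω hω v (n + k * ω.length)) : cs.GreedyUses ω hω v n := by
  induction k with
  | zero => simpa using hk
  | succ k ih =>
    refine ih (h _ (by omega) ?_)
    rwa [Nat.succ_mul, ← add_assoc] at hk

/-- The recursive characterization of sortability in terms of the letters used by the greedy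
procedure from the `n`-th position on, where only the letters in `A` are still allowed. -/
theorem greedyUses_iff_wordSortable (hnd : ω.Nodup) {v : W} (d n : ℕ)
    (h1 : cs.greedyRest ω hω v (n + d) = 1) (A : B → Bool) :
    ((∀ m, n ≤ m → cs.GreedyUses ω hω v m → A (nthLetter ω hω m)) ∧
      ∀ m, n ≤ m → cs.GreedyUses ω hω v (m + ω.length) → cs.GreedyUses ω hω v m) ↔
      cs.WordSortable ((ω.rotate n).filter A) (cs.greedyRest ω hω v n) := by
  have hpos := List.length_pos_iff.2 hω
  induction d generalizing n A with
  | zero =>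
    have hn : cs.greedyRest ω hω v n = 1 := h1
    rw [hn]
    exact ⟨fun _ => cs.wordSortable_one _, fun _ =>
      ⟨fun m hm h => absurd h (cs.not_greedyUses_of_le hn hm),
        fun m hm h => absurd h (cs.not_greedyUses_of_le hn (by omega))⟩⟩
  | succ d ih =>
    have ih' := ih (n + 1) (by rw [← h1]; congr 1; omega)
    obtain ⟨t, ht1, ht2⟩ := rotate_eq_cons (ω := ω) (hω := hω) n
    set i := nthLetter ω hω n with hi
    have hit : i ∉ t := by
      have : (ω.rotate n).Nodup := List.nodup_rotate.2 hnd
      rw [ht1] at this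
      exact (List.nodup_cons.1 this).1
    rw [ht1]
    rw [ht2] at ih'
    by_cases hA : A i
    · rw [List.filter_cons_of_pos hA]
      by_cases hu : cs.GreedyUses ω hω v n
      · have e : cs.WordSortable (i :: t.filter A) (cs.greedyRest ω hω v n) ↔
            cs.WordSortable ((t ++ [i]).filter A) (cs.greedyRest ω hω v (n + 1)) := by
          rw [cs.greedyRest_succ_of_uses hu, List.filter_append, List.filter_cons_of_pos hA,
            List.filter_nil]
          exact ⟨fun h => h.of_mem hu, fun h => .use hu h⟩
        rw [e]
        refine Iff.trans ?_ (ih' A)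
        refine ⟨fun h => ⟨fun m hm => h.1 m (by omega), fun m hm => h.2 m (by omega)⟩,
          fun h => ⟨fun m hm hm' => ?_, fun m hm hm' => ?_⟩⟩
        · rcases Nat.eq_or_lt_of_le hm with rfl | hm
          · exact hA
          · exact h.1 m hm hm'
        · rcases Nat.eq_or_lt_of_le hm with rfl | hm
          · exact hu
          · exact h.2 m hm hm'
      -- An unused letter is deleted from the word, so i is withdrawn from the allowed letters. The
      -- shift condition makes this consistent: a later use of i would propagate back to position n.
      · classical
        have e1 : (t ++ [i]).filter (fun j => A j && !decide (j = i)) = t.filter A := by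
          rw [List.filter_append]
          simp only [List.filter_cons, decide_true, Bool.not_true, Bool.and_false,
            Bool.false_eq_true, if_false, List.filter_nil, List.append_nil]
          refine List.filter_congr fun j hj => ?_
          have : j ≠ i := fun h => hit (h ▸ hj)
          simp [this]
        have e : cs.WordSortable (i :: t.filter A) (cs.greedyRest ω hω v n) ↔
            cs.WordSortable ((t ++ [i]).filter (fun j => A j && !decide (j = i)))
              (cs.greedyRest ω hω v (n + 1)) := by
          rw [e1, cs.greedyRest_succ_of_not_uses hu]
          exact ⟨fun h => h.of_not_mem hu, fun h => .skip hu h⟩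
        rw [e]
        refine Iff.trans ?_ (ih' _)
        refine ⟨fun h => ⟨fun m hm hm' => ?_, fun m hm => h.2 m (by omega)⟩,
          fun h => ⟨fun m hm hm' => ?_, fun m hm hm' => ?_⟩⟩
        · have hne : nthLetter ω hω m ≠ i := by
            intro hmi
            have hmod := nthLetter_inj hnd hmi
            refine hu (cs.greedyUses_of_add_mul h.2 ((m - n) / ω.length) ?_)
            have hdvd : ω.length ∣ m - n := (Nat.modEq_iff_dvd' (by omega)).1 hmod.symm
            rw [Nat.div_mul_cancel hdvd]
            rwa [show n + (m - n) = m by omega]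
          simp [hne, h.1 m (by omega) hm']
        · rcases Nat.eq_or_lt_of_le hm with rfl | hm
          · exact absurd hm' hu
          · have := h.1 m hm hm'
            simp only [Bool.and_eq_true] at this
            exact this.1
        · rcases Nat.eq_or_lt_of_le hm with rfl | hm
          · have := h.1 _ (by omega) hm'
            rw [nthLetter_add, ← hi] at this
            simp at this
          · exact h.2 m hm hm'
    · have e1 : (t ++ [i]).filter A = t.filter A := by
        rw [List.filter_append, List.filter_cons_of_neg hA, List.filter_nil, List.append_nil]
      rw [List.filter_cons_of_neg hA]
      by_cases hu : cs.GreedyUses ω hω v n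
      · exact ⟨fun h => absurd (h.1 n le_rfl hu) hA,
          fun h => absurd hu (h.simpleRoot_not_mem fun h' => hit (List.mem_of_mem_filter h'))⟩
      · have ihA := ih' A
        rw [e1, cs.greedyRest_succ_of_not_uses hu] at ihA
        refine Iff.trans ?_ ihA
        refine ⟨fun h => ⟨fun m hm => h.1 m (by omega), fun m hm => h.2 m (by omega)⟩,
          fun h => ⟨fun m hm hm' => ?_, fun m hm hm' => ?_⟩⟩
        · rcases Nat.eq_or_lt_of_le hm with rfl | hm
          · exact absurd hm' hu
          · exact h.1 m hm hm'
        · rcases Nat.eq_or_lt_of_le hm with rfl | hm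
          · have := h.1 _ (by omega) hm'
            rw [nthLetter_add, ← hi] at this
            exact absurd this hA
          · exact h.2 m hm hm'

theorem nthPosition_strictMono : StrictMono (nthPosition ω hω) := by
  intro m n hmn
  have hpos := List.length_pos_iff.2 hω
  rw [nthPosition, nthPosition, Prod.Lex.toLex_lt_toLex]
  rcases Nat.lt_or_ge (m / ω.length) (n / ω.length) with h | h
  · exact Or.inl h
  · have he : m / ω.length = n / ω.length := le_antisymm (Nat.div_le_div_right hmn.le) h
    refine Or.inr ⟨he, ?_⟩
    have h1 := Nat.div_add_mod m ω.length
    have h2 := Nat.div_add_mod n ω.length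
    rw [he] at h1
    change m % ω.length < n % ω.length
    omega

theorem nthPosition_mul_add (k : ℕ) (j : Fin ω.length) :
    nthPosition ω hω (k * ω.length + j) = toLex (k, j) := by
  have hpos := List.length_pos_iff.2 hω
  rw [nthPosition]
  congr 1
  refine Prod.ext ?_ (Fin.ext ?_)
  · change (k * ω.length + j) / ω.length = k
    rw [mul_comm, Nat.mul_add_div hpos, Nat.div_eq_of_lt j.2, add_zero]
  · exact Nat.mul_add_mod_of_lt j.2

theorem nthPosition_surjective : Function.Surjective (nthPosition ω hω) := fun a =>
  ⟨(ofLex a).1 * ω.length + (ofLex a).2, nthPosition_mul_add _ _⟩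

open Classical in
/-- The positions among `n, …, n + d - 1` used by the greedy procedure. -/
noncomputable def greedyPositions (ω : List B) (hω : ω ≠ []) (v : W) (n d : ℕ) :
    List (Position ω) :=
  ((List.range' n d).filter fun m => cs.GreedyUses ω hω v m).map (nthPosition ω hω)

theorem greedyPositions_succ_of_uses {v : W} {n : ℕ} (h : cs.GreedyUses ω hω v n) (d : ℕ) :
    cs.greedyPositions ω hω v n (d + 1) =
      nthPosition ω hω n :: cs.greedyPositions ω hω v (n + 1) d := by
  rw [greedyPositions, List.range'_succ, List.filter_cons_of_pos (by simpa using h), List.map_cons]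
  rfl

theorem greedyPositions_succ_of_not_uses {v : W} {n : ℕ} (h : ¬ cs.GreedyUses ω hω v n) (d : ℕ) :
    cs.greedyPositions ω hω v n (d + 1) = cs.greedyPositions ω hω v (n + 1) d := by
  rw [greedyPositions, List.range'_succ, List.filter_cons_of_neg (by simpa using h)]
  rfl

theorem pairwise_greedyPositions (v : W) (n d : ℕ) :
    (cs.greedyPositions ω hω v n d).Pairwise (· < ·) := by
  rw [greedyPositions, List.pairwise_map]
  exact ((List.pairwise_lt_range' (s := n) (n := d)).imp
    fun h => nthPosition_strictMono h).filter _

theorem letters_nthPosition_cons (n : ℕ) (p : List (Position ω)) :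
    letters ω (nthPosition ω hω n :: p) = nthLetter ω hω n :: letters ω p := rfl

theorem isReducedWordFor_cons_iff {i : B} {a : List B} {w : W} :
    cs.IsReducedWordFor (i :: a) w ↔
      M.simpleRoot i ∈ cs.inversions w ∧ cs.IsReducedWordFor a (cs.simple i * w) := by
  rw [simpleRoot_mem_inversions]
  constructor
  · rintro ⟨h1, rfl⟩
    have h2 : cs.IsReduced a := by simpa using h1.drop 1
    rw [wordProd_cons, cs.simple_mul_simple_cancel_left]
    refine ⟨?_, h2, rfl⟩
    have h3 := h1.eq
    rw [wordProd_cons, List.length_cons] at h3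
    rw [h3, h2.eq]
    omega
  · rintro ⟨h1, h2, h3⟩
    have h4 : cs.wordProd (i :: a) = w := by
      rw [wordProd_cons, h3, cs.simple_mul_simple_cancel_left]
    refine ⟨?_, h4⟩
    rw [IsReduced, h4, List.length_cons, ← h2.eq, h3]
    rcases cs.length_simple_mul w i with h5 | h5 <;> omega

theorem isReducedWordFor_greedyPositions {v : W} (d n : ℕ)
    (h1 : cs.greedyRest ω hω v (n + d) = 1) :
    cs.IsReducedWordFor (letters ω (cs.greedyPositions ω hω v n d))
      (cs.greedyRest ω hω v n) := by
  induction d generalizing n with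
  | zero =>
    have hn : cs.greedyRest ω hω v n = 1 := h1
    rw [hn]
    exact ⟨by simp [greedyPositions, letters, IsReduced], by simp [greedyPositions, letters]⟩
  | succ d ih =>
    have ih' := ih (n + 1) (by rw [← h1]; congr 1; omega)
    by_cases hu : cs.GreedyUses ω hω v n
    · rw [cs.greedyPositions_succ_of_uses hu, letters_nthPosition_cons, isReducedWordFor_cons_iff]
      rw [cs.greedyRest_succ_of_uses hu] at ih'
      exact ⟨hu, ih'⟩
    · rw [cs.greedyPositions_succ_of_not_uses hu]
      rwa [cs.greedyRest_succ_of_not_uses hu] at ih'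

theorem IsReducedWordFor.eq_nil {a : List B} (h : cs.IsReducedWordFor a 1) : a = [] := by
  have := h.1.eq
  rw [h.2, length_one] at this
  exact List.length_eq_zero_iff.1 this.symm

theorem nthPosition_succ_le {n : ℕ} {x : Position ω} (h : nthPosition ω hω n < x) :
    nthPosition ω hω (n + 1) ≤ x := by
  obtain ⟨m, rfl⟩ := nthPosition_surjective (hω := hω) x
  rw [nthPosition_strictMono.lt_iff_lt] at h
  exact nthPosition_strictMono.monotone h

/-- A competitor using position n has a left descent there, so the greedy procedure uses it too and
the tails are compared. If only the greedy procedure uses n, the competitor starts later and is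
lexicographically larger. -/
theorem greedyPositions_le {v : W} (d n : ℕ) (h1 : cs.greedyRest ω hω v (n + d) = 1)
    (q : List (Position ω)) (hq : q.Pairwise (· < ·)) (hqn : ∀ x ∈ q, nthPosition ω hω n ≤ x)
    (hqr : cs.IsReducedWordFor (letters ω q) (cs.greedyRest ω hω v n)) :
    cs.greedyPositions ω hω v n d ≤ q := by
  induction d generalizing n q with
  | zero =>
    cases q with
    | nil => exact le_rfl
    | cons a q => exact le_of_lt (List.Lex.nil)
  | succ d ih =>
    have h1' : cs.greedyRest ω hω v (n + 1 + d) = 1 := by rw [← h1]; congr 1; omega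
    cases q with
    | nil =>
      have h2 := cs.isReducedWordFor_greedyPositions (d + 1) n h1
      have h3 : cs.greedyRest ω hω v n = 1 := by simpa [letters] using hqr.2.symm
      rw [h3] at h2
      have h4 := IsReducedWordFor.eq_nil cs h2
      rw [letters, List.map_eq_nil_iff] at h4
      rw [h4]
    | cons a q =>
      rw [List.pairwise_cons] at hq
      rcases (hqn a (by simp)).eq_or_lt with ha | ha
      · subst ha
        rw [letters_nthPosition_cons, isReducedWordFor_cons_iff] at hqr
        have hu : cs.GreedyUses ω hω v n := hqr.1
        rw [cs.greedyPositions_succ_of_uses hu]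
        refine List.cons_le_cons _
          (ih (n + 1) h1' q hq.2 (fun x hx => nthPosition_succ_le (hq.1 x hx)) ?_)
        rw [cs.greedyRest_succ_of_uses hu]
        exact hqr.2
      · by_cases hu : cs.GreedyUses ω hω v n
        · rw [cs.greedyPositions_succ_of_uses hu]
          exact le_of_lt (List.Lex.rel ha)
        · rw [cs.greedyPositions_succ_of_not_uses hu]
          refine ih (n + 1) h1' _ (List.pairwise_cons.2 hq) (fun x hx => ?_)
            (by rwa [cs.greedyRest_succ_of_not_uses hu])
          rcases List.mem_cons.1 hx with rfl | hx
          · exact nthPosition_succ_le ha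
          · exact nthPosition_succ_le (ha.trans (hq.1 x hx))

theorem isSortingSubword_greedyPositions {v : W} {d : ℕ} (h1 : cs.greedyRest ω hω v d = 1) :
    cs.IsSortingSubword ω v (cs.greedyPositions ω hω v 0 d) := by
  have h1' : cs.greedyRest ω hω v (0 + d) = 1 := by rwa [zero_add]
  refine ⟨⟨cs.pairwise_greedyPositions v 0 d, cs.isReducedWordFor_greedyPositions d 0 h1'⟩,
    fun q hq => cs.greedyPositions_le d 0 h1' q hq.1 (fun x _ => ?_) hq.2⟩
  obtain ⟨m, rfl⟩ := nthPosition_surjective (hω := hω) x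
  exact nthPosition_strictMono.monotone (Nat.zero_le m)

theorem nthPosition_mem_greedyPositions {v : W} {d : ℕ} (h1 : cs.greedyRest ω hω v d = 1) {m : ℕ} :
    nthPosition ω hω m ∈ cs.greedyPositions ω hω v 0 d ↔ cs.GreedyUses ω hω v m := by
  classical
  rw [greedyPositions, List.mem_map_of_injective nthPosition_strictMono.injective,
    List.mem_filter]
  simp only [decide_eq_true_eq, and_iff_right_iff_imp]
  intro h
  have : m < d := by
    by_contra hcon
    exact cs.not_greedyUses_of_le h1 (not_lt.1 hcon) h
  simpa using this

/-- Without repeated letters, each letter has one position in a block, and the same letter of the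
previous block is `ω.length` positions earlier. -/
theorem antitone_blockLetters_iff (hnd : ω.Nodup) {v : W} {d : ℕ}
    (h1 : cs.greedyRest ω hω v d = 1) :
    Antitone (blockLetters ω (cs.greedyPositions ω hω v 0 d)) ↔
      ∀ m, cs.GreedyUses ω hω v (m + ω.length) → cs.GreedyUses ω hω v m := by
  have hpos := List.length_pos_iff.2 hω
  constructor
  · intro h m hm
    rw [← cs.nthPosition_mem_greedyPositions h1] at hm ⊢
    have h2 : nthLetter ω hω m ∈ blockLetters ω (cs.greedyPositions ω hω v 0 d)
        (m / ω.length + 1) := by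
      refine ⟨⟨m % ω.length, Nat.mod_lt _ hpos⟩, ?_, rfl⟩
      have e : nthPosition ω hω (m + ω.length) =
          toLex (m / ω.length + 1, ⟨m % ω.length, Nat.mod_lt _ hpos⟩) := by
        rw [nthPosition]
        simp only [Nat.add_div_right _ hpos, Nat.add_mod_right]
      rwa [← e]
    obtain ⟨j, hj1, hj2⟩ := h (Nat.le_succ _) h2
    have hj3 := (hnd.get_inj_iff).1 hj2
    rw [hj3] at hj1
    exact hj1
  · intro h
    refine antitone_nat_of_succ_le fun k i hi => ?_
    obtain ⟨j, hj1, hj2⟩ := hi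
    refine ⟨j, ?_, hj2⟩
    rw [← nthPosition_mul_add (hω := hω), cs.nthPosition_mem_greedyPositions h1] at hj1 ⊢
    refine h _ ?_
    rwa [Nat.succ_mul, Nat.add_right_comm] at hj1

theorem exists_isSortingSubword_iff_wordSortable (hω : ω ≠ []) (hnd : ω.Nodup)
    (hall : ∀ i, i ∈ ω) (v : W) :
    (∃ p, cs.IsSortingSubword ω v p ∧ Antitone (blockLetters ω p)) ↔ cs.WordSortable ω v := by
  obtain ⟨d, hd⟩ := cs.exists_greedyRest_eq_one (hω := hω) hall v
  have hs := cs.isSortingSubword_greedyPositions hd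
  have h1 := cs.greedyUses_iff_wordSortable hnd d 0 (by rwa [zero_add]) fun _ => true
  have h2 : cs.greedyRest ω hω v 0 = v := rfl
  simp only [implies_true, true_and, Nat.zero_le, forall_const, List.rotate_zero,
    List.filter_true, h2] at h1
  rw [← h1, ← cs.antitone_blockLetters_iff hnd hd]
  constructor
  · rintro ⟨p, hp1, hp2⟩
    have : p = cs.greedyPositions ω hω v 0 d := le_antisymm (hp1.2 _ hs.1) (hs.2 _ hp1.1)
    rwa [← this]
  · exact fun h => ⟨_, hs, h⟩

end Greedy

/-- The sortable elements for a Coxeter element can be computed with any reduced word. -/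
theorem isSortable_iff_wordSortable {c : W} (hc : cs.IsCoxeterElement c) {ω : List B}
    (hω : cs.IsReducedWordFor ω c) (hne : ω ≠ []) (v : W) :
    cs.IsSortable c v ↔ cs.WordSortable ω v := by
  obtain ⟨hnd, hall⟩ := IsCoxeterElement.nodup_and_mem cs hc hω
  constructor
  · rintro ⟨ω', p, h1, h2, h3⟩
    obtain ⟨hnd', hall'⟩ := IsCoxeterElement.nodup_and_mem cs hc h1
    have hne' : ω' ≠ [] := by
      obtain ⟨i, -⟩ := List.exists_mem_of_ne_nil ω hne
      exact List.ne_nil_of_mem (hall' i)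
    exact ((cs.exists_isSortingSubword_iff_wordSortable hne' hnd' hall' v).1
      ⟨p, h2, h3⟩).of_wordProd_eq hnd' hnd (h1.2.trans hω.2.symm)
  · intro h
    obtain ⟨p, h1, h2⟩ := (cs.exists_isSortingSubword_iff_wordSortable hne hnd hall v).2 h
    exact ⟨ω, p, hω, h1, h2⟩

end CoxeterSystem

namespace CoxeterSystem

open CoxeterMatrix

variable {B : Type*} {M : CoxeterMatrix B} {W : Type*} [Group W] (cs : CoxeterSystem M W)

/-! ### The two maps -/

variable {cs}

theorem sortableMap_of_mem {s : B} {v : W} (h : M.simpleRoot s ∈ cs.inversions v) :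
    cs.sortableMap s v = cs.simple s * v :=
  if_pos ((cs.simple_weakLE_iff).2 h)

theorem sortableMap_of_not_mem {s : B} {v z : W} (h : M.simpleRoot s ∉ cs.inversions v)
    (hz : cs.IsWeakJoin (cs.simple s) v z) : cs.sortableMap s v = z :=
  (if_neg fun h' => h ((cs.simple_weakLE_iff).1 h')).trans hz.weakJoin_eq

theorem sortableInvMap_of_mem {s : B} {x : W} (h : M.simpleRoot s ∈ cs.inversions x) :
    cs.sortableInvMap s x = cs.parabolicProj {s}ᶜ x :=
  if_pos ((cs.simple_weakLE_iff).2 h)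

theorem sortableInvMap_of_not_mem {s : B} {x : W} (h : M.simpleRoot s ∉ cs.inversions x) :
    cs.sortableInvMap s x = cs.simple s * x :=
  if_neg fun h' => h ((cs.simple_weakLE_iff).1 h')

/-- If v ≥ s this is the recursion. Otherwise v lies in W_⟨s⟩, and projecting s ∨ v back gives v
because the join adds no inversions supported off s. -/
theorem wordSortable_sortableMap {s : B} {l : List B} (hl : (s :: l).Nodup) {v : W}
    (hv : cs.WordSortable (s :: l) v) (hj : cs.HasWeakJoin (cs.simple s) v) :
    cs.WordSortable (l ++ [s]) (cs.sortableMap s v) ∧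
      cs.sortableInvMap s (cs.sortableMap s v) = v := by
  have hl' : (l ++ [s]).Nodup := by rw [List.nodup_append_comm]; exact hl
  by_cases h : M.simpleRoot s ∈ cs.inversions v
  · rw [sortableMap_of_mem h, sortableInvMap_of_not_mem
      (by rwa [cs.simpleRoot_mem_inversions_simple_mul, not_not]),
      cs.simple_mul_simple_cancel_left]
    exact ⟨hv.of_mem h, rfl⟩
  · obtain ⟨z, hz⟩ := hj
    have hv' := hv.of_not_mem h
    rw [sortableMap_of_not_mem h hz, sortableInvMap_of_mem ((cs.simple_weakLE_iff).1 hz.1)]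
    refine ⟨hv'.join_final hl' hz, cs.parabolicProj_eq fun β => ⟨fun hβ => ?_, fun hβ => ?_⟩⟩
    · refine ⟨hz.2.1.inversions_subset hβ, fun i hi => hv'.supportedOn β hβ i ?_⟩
      simp only [Set.mem_compl_iff, Set.mem_singleton_iff, not_not] at hi
      rw [hi]
      exact (List.nodup_cons.1 hl).1
    · exact cs.mem_inversions_of_isWeakJoin_simple (by simp) hz hβ.1 hβ.2

theorem wordSortable_sortableInvMap {s : B} {l : List B} (hl : (s :: l).Nodup) {x : W}
    (hx : cs.WordSortable (l ++ [s]) x) :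
    cs.WordSortable (s :: l) (cs.sortableInvMap s x) ∧
      cs.HasWeakJoin (cs.simple s) (cs.sortableInvMap s x) ∧
      cs.sortableMap s (cs.sortableInvMap s x) = x := by
  have hl' : (l ++ [s]).Nodup := by rw [List.nodup_append_comm]; exact hl
  by_cases h : M.simpleRoot s ∈ cs.inversions x
  · have hj := hx.isWeakJoin_parabolicProj hl' h
    have hv := hx.parabolicProj hl'
    have hs := hv.simpleRoot_not_mem (List.nodup_cons.1 hl).1
    rw [sortableInvMap_of_mem h, sortableMap_of_not_mem hs hj]
    exact ⟨.skip hs hv, ⟨x, hj⟩, rfl⟩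
  · have hs := cs.simpleRoot_mem_inversions_simple_mul.2 h
    rw [sortableInvMap_of_not_mem h, sortableMap_of_mem hs, cs.simple_mul_simple_cancel_left]
    -- Since s ≤ s x here, the element s x is itself an upper bound, so the join exists.
    refine ⟨.use hs ?_, cs.exists_isWeakJoin ((cs.simple_weakLE_iff).2 hs) (cs.weakLE_refl _), rfl⟩
    rwa [cs.simple_mul_simple_cancel_left]

end CoxeterSystem

/-! ### The theorem -/

theorem theoremc {B : Type*} [Finite B] {M : CoxeterMatrix B} {W : Type*} [Group W]
    (cs : CoxeterSystem M W) (c : W) (hc : cs.IsCoxeterElement c)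
    (s : B) (hs : cs.IsInitial s c) :
    Set.BijOn (cs.sortableMap s)
        {v : W | cs.IsSortable c v ∧ cs.HasWeakJoin (cs.simple s) v}
        {x : W | cs.IsSortable (cs.simple s * c * cs.simple s) x} ∧
      Set.InvOn (cs.sortableInvMap s) (cs.sortableMap s)
        {v : W | cs.IsSortable c v ∧ cs.HasWeakJoin (cs.simple s) v}
        {x : W | cs.IsSortable (cs.simple s * c * cs.simple s) x} := by
  obtain ⟨l, hl⟩ := hs
  obtain ⟨hnd, hall⟩ := CoxeterSystem.IsCoxeterElement.nodup_and_mem cs hc hl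
  have hnd' : (l ++ [s]).Nodup := by rw [List.nodup_append_comm]; exact hnd
  have hprod : cs.wordProd (l ++ [s]) = cs.simple s * c * cs.simple s := by
    rw [← hl.2, cs.wordProd_append, cs.wordProd_singleton, cs.wordProd_cons,
      cs.simple_mul_simple_cancel_left]
  have hc' : cs.IsCoxeterElement (cs.simple s * c * cs.simple s) :=
    ⟨l ++ [s], hnd', fun i => by simpa [or_comm] using hall i, hprod⟩
  have h1 := cs.isSortable_iff_wordSortable hc hl (List.cons_ne_nil _ _)
  have h2 := cs.isSortable_iff_wordSortable hc' ⟨cs.isReduced_of_nodup hnd', hprod⟩ (by simp)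
  have hmaps : Set.MapsTo (cs.sortableMap s)
      {v : W | cs.IsSortable c v ∧ cs.HasWeakJoin (cs.simple s) v}
      {x : W | cs.IsSortable (cs.simple s * c * cs.simple s) x} := fun v hv =>
    (h2 _).2 (CoxeterSystem.wordSortable_sortableMap hnd ((h1 v).1 hv.1) hv.2).1
  have hmaps' : Set.MapsTo (cs.sortableInvMap s)
      {x : W | cs.IsSortable (cs.simple s * c * cs.simple s) x}
      {v : W | cs.IsSortable c v ∧ cs.HasWeakJoin (cs.simple s) v} := fun x hx =>
    have h := CoxeterSystem.wordSortable_sortableInvMap hnd ((h2 x).1 hx)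
    ⟨(h1 _).2 h.1, h.2.1⟩
  have hinv : Set.InvOn (cs.sortableInvMap s) (cs.sortableMap s)
      {v : W | cs.IsSortable c v ∧ cs.HasWeakJoin (cs.simple s) v}
      {x : W | cs.IsSortable (cs.simple s * c * cs.simple s) x} :=
    ⟨fun v hv => (CoxeterSystem.wordSortable_sortableMap hnd ((h1 v).1 hv.1) hv.2).2,
      fun x hx => (CoxeterSystem.wordSortable_sortableInvMap hnd ((h2 x).1 hx)).2.2⟩
  exact ⟨hinv.bijOn hmaps hmaps', hinv⟩
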